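/- Let $0<m<n$ be integers. Affine side. Let $\widetilde S_n$ be the affine symmetric group, with simple generators $s_i$ ($i\in\mathbb Z/n\mathbb Z$) and relations $s_i^2=1$, $s_is_{i+1}s_i=s_{i+1}s_is_{i+1}$, $s_is_j=s_js_i$ if $i-j\ne\pm1$ (for $n=2$: the infinite dihedral group, with only $s_i^2=1$), and let $\ell$ be its length function. The weak order $\le$ on $\widetilde S_n$ is generated by the covers $w\lessdot s_iw$ with $\ell(s_iw)=\ell(w)+1$. An element $w$ is $0$-Grassmannian if every nonempty reduced word of $w$ ends with $s_0$, and $321$-avoiding if no reduced word of $w$ contains consecutive letters $s_is_{i+1}s_i$ (for $n=2$ every element is $321$-avoiding). For $J\subsetneq\mathbb Z/n\mathbb Z$ let $d_J$ (resp. $u_J$) be the product of the generators $s_j$, $j\in J$, each taken once, such that $s_{i+1}$ precedes $s_i$ (resp. $s_i$ precedes $s_{i+1}$) whenever $i,i+1\in J$. Let $\mathrm{maxr}(w)$ (resp. $\mathrm{maxc}(w)$) be the largest $|J|$ such that $w=vd_J$ (resp. $w=vu_J$) with $\ell(w)=\ell(v)+|J|$. The affine Stanley function of $w$ (called an affine Schur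 function if $w$ is $0$-Grassmannian) is $F_w=\sum x_1^{\ell(w_1)}x_2^{\ell(w_2)}\cdots$, the sum over all sequences $(w_1,w_2,\dots)$ of elements of the form $d_J$, almost all trivial, with $w_1w_2\cdots=w$ and $\sum_k\ell(w_k)=\ell(w)$. Let $A^0_{(n-m,m)}$ be the set of $321$-avoiding $0$-Grassmannian $w\in\widetilde S_n$ with $\mathrm{maxc}(w)\le m$ and $\mathrm{maxr}(w)\le n-m$. Cylindric side. Let $P_{mn}$ be the set of partitions $\lambda$ with $\lambda_1\le n-m$ and at most $m$ parts. For $\lambda\in P_{mn}$ and $r\in\mathbb Z$ let $\lambda[r]$ be the sequence indexed by $\mathbb Z$ with $\lambda[r]_{i+r}=\lambda_i+r$ for $1\le i\le m$ and $\lambda[r]_k=\lambda[r]_{k+m}+(n-m)$ for all $k$. A cylindric shape is a pair $\lambda[r]/\mu[s]$ with $\mu[s]_k\le\lambda[r]_k$ for all $k$; its diagram is $$D_{\lambda[r]/\mu[s]}=\{\langle i,j\rangle:\ \mu[s]_i<j\le\lambda[r]_i\}\subset \mathbb Z^2/\mathbb Z(-m,n-m).$$ Write $\lambda/d/\mu=\lambda[d]/\mu[0]$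 for integers $d\ge0$. For a cylindric shape $x$ let $A_i\cdot x$ be the cylindric shape with the same inner sequence whose diagram is that of $x$ together with one new box $\langle p,q\rangle$, $q-p\equiv i \pmod n$, if such a shape exists (it is then unique), and $0$ otherwise. For a reduced word $w=s_{i_1}\cdots s_{i_l}$ put $A_w\cdot x=A_{i_1}\cdots A_{i_l}\cdot x$. The cylindric Schur function $s_x$ is $\sum_T\prod_{b}x_{T(b)}$, the sum over all maps $T$ from the diagram of $x$ to the positive integers with $T(\langle i,j\rangle)\le T(\langle i,j+1\rangle)$ and $T(\langle i,j\rangle)<T(\langle i+1,j\rangle)$ whenever both boxes lie in the diagram. **Theorem.** There is a bijection $\phi$ from $A^0_{(n-m,m)}$ onto the set of cylindric shapes $\lambda/d/\emptyset$ with $\lambda\in P_{mn}$, $d\ge0$, such that 1. $\phi(w)=A_w\cdot(\emptyset/0/\emptyset)$ for all $w\in A^0_{(n-m,m)}$, whichever reduced word of $w$ is used; 2. for all $w,v\in A^0_{(n-m,m)}$: $w\le v$ in the weak order of $\widetilde S_n$ if and only if $D_{\phi(w)}\subseteq D_{\phi(v)}$; 3. $F_w=s_{\phi(w)}$ for all $w\in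 A^0_{(n-m,m)}$. -/

import Mathlib

/-! ### The affine symmetric group and its combinatorics -/

/-- The Coxeter matrix of the affine symmetric group: generators `s_i`, `i ∈ ℤ/n`, with
`s_i s_{i+1} s_i = s_{i+1} s_i s_{i+1}` and `s_i s_j = s_j s_i` for `i - j ≠ ±1`.
For `n = 2` the two generators satisfy no braid relation (Mathlib encodes the order `∞` as `0`),
so that the group is the infinite dihedral group. -/
def affineMatrix (n : ℕ) : CoxeterMatrix (ZMod n) where
  M := Matrix.of fun i j => if i = j then 1 else if n = 2 then 0 else
    if j = i + 1 ∨ i = j + 1 then 3 else 2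
  isSymm := by
    refine Matrix.IsSymm.ext fun i j => ?_
    simp only [Matrix.of_apply, eq_comm (a := j) (b := i), or_comm]
  diagonal := by intro i; simp
  off_diagonal := by
    intro i j h
    rw [Matrix.of_apply, if_neg h]
    split_ifs <;> norm_num

/-- The affine symmetric group `S̃_n`. -/
abbrev AffSym (n : ℕ) : Type := (affineMatrix n).Group

/-- `S̃_n` with its simple generators. It provides the length `(affSys n).length`, products of words
`(affSys n).wordProd` and reduced words `(affSys n).IsReduced`. -/
abbrev affSys (n : ℕ) : CoxeterSystem (affineMatrix n) (AffSym n) :=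
  (affineMatrix n).toCoxeterSystem

/-- A word is cyclically decreasing if each letter occurs at most once and `i + 1` precedes `i`
whenever both occur. -/
def IsCycDecWord {n : ℕ} (ω : List (ZMod n)) : Prop :=
  ω.Nodup ∧ ∀ i, i ∈ ω → i + 1 ∈ ω → ω.idxOf (i + 1) < ω.idxOf i

/-- A word is cyclically increasing if each letter occurs at most once and `i` precedes `i + 1`
whenever both occur. -/
def IsCycIncWord {n : ℕ} (ω : List (ZMod n)) : Prop :=
  ω.Nodup ∧ ∀ i, i ∈ ω → i + 1 ∈ ω → ω.idxOf i < ω.idxOf (i + 1)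

/-- `d = d_J`: the element `d` has a cyclically decreasing word whose set of letters is `J`. -/
def IsCycDecOn {n : ℕ} (J : Finset (ZMod n)) (d : AffSym n) : Prop :=
  ∃ ω : List (ZMod n), IsCycDecWord ω ∧ ω.toFinset = J ∧ (affSys n).wordProd ω = d

/-- `u = u_J`: the element `u` has a cyclically increasing word whose set of letters is `J`. -/
def IsCycIncOn {n : ℕ} (J : Finset (ZMod n)) (u : AffSym n) : Prop :=
  ∃ ω : List (ZMod n), IsCycIncWord ω ∧ ω.toFinset = J ∧ (affSys n).wordProd ω = u

/-- `maxr(w)`: the largest `|J|` such that `w = v d_J` with `ℓ(w) = ℓ(v) + ℓ(d_J)`. -/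
noncomputable def maxr {n : ℕ} (w : AffSym n) : ℕ :=
  sSup {k | ∃ (J : Finset (ZMod n)) (v d : AffSym n), IsCycDecOn J d ∧ w = v * d ∧
    (affSys n).length w = (affSys n).length v + (affSys n).length d ∧ J.card = k}

/-- `maxc(w)`: the largest `|J|` such that `w = v u_J` with `ℓ(w) = ℓ(v) + ℓ(u_J)`. -/
noncomputable def maxc {n : ℕ} (w : AffSym n) : ℕ :=
  sSup {k | ∃ (J : Finset (ZMod n)) (v u : AffSym n), IsCycIncOn J u ∧ w = v * u ∧
    (affSys n).length w = (affSys n).length v + (affSys n).length u ∧ J.card = k}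

/-- `w` is `0`-Grassmannian: every (nonempty) reduced word of `w` ends with `s_0`. -/
def IsZeroGrassmannian {n : ℕ} (w : AffSym n) : Prop :=
  ∀ (ω : List (ZMod n)) (i : ZMod n), (affSys n).IsReduced (ω ++ [i]) →
    (affSys n).wordProd (ω ++ [i]) = w → i = 0

/-- `w` is `321`-avoiding: no reduced word of `w` contains consecutive letters `s_i s_{i+1} s_i`.
For `n = 2`, where there is no braid relation, every element is `321`-avoiding. -/
def Is321Avoiding {n : ℕ} (w : AffSym n) : Prop :=
  ∀ ω : List (ZMod n), (affSys n).IsReduced ω → (affSys n).wordProd ω = w →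
    ∀ i : ZMod n, 3 ≤ n → ¬ [i, i + 1, i] <:+: ω

/-- The set of `321`-avoiding `0`-Grassmannian `w` with `maxc(w) ≤ m` and `maxr(w) ≤ n - m`. -/
def grassSet (m n : ℕ) : Set (AffSym n) :=
  {w | IsZeroGrassmannian w ∧ Is321Avoiding w ∧ maxc w ≤ m ∧ maxr w ≤ n - m}

/-- Covering relation of the (left) weak order: `v = s_i w` and `ℓ(v) = ℓ(w) + 1`. -/
def WeakCover {n : ℕ} (w v : AffSym n) : Prop :=
  ∃ i : ZMod n, (affSys n).simple i * w = v ∧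
    (affSys n).length w + 1 = (affSys n).length v

/-- The (left) weak order on `S̃_n`. -/
def WeakLE {n : ℕ} (w v : AffSym n) : Prop := Relation.ReflTransGen WeakCover w v

/-- The number of cyclically decreasing decompositions `w = w_0 w_1 w_2 ⋯` (almost all factors are
trivial, and the lengths of the factors add up to `ℓ(w)`) with `ℓ(w_k) = e_k` for all `k`. -/
noncomputable def numCycDecDecomp {n : ℕ} (w : AffSym n) (e : ℕ →₀ ℕ) : ℕ :=
  Nat.card {f : ℕ → AffSym n //
    (∀ k, ∃ J, IsCycDecOn J (f k)) ∧ (∀ k, (affSys n).length (f k) = e k) ∧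
    ∃ N, (∀ k, N ≤ k → f k = 1) ∧ ((List.range N).map f).prod = w ∧
      ∑ k ∈ Finset.range N, (affSys n).length (f k) = (affSys n).length w}

/-- The affine Stanley symmetric function `F_w`, a power series in variables indexed by `ℕ`. -/
noncomputable def affineStanley {n : ℕ} (w : AffSym n) : MvPowerSeries ℕ ℤ :=
  fun e => (numCycDecDecomp w e : ℤ)

/-! ### Cylindric shapes -/

/-- The set `P_{mn}` of partitions (as Young diagrams) with `λ_1 ≤ n - m` and at most `m` parts. -/
def BoxPartition (m n : ℕ) : Type :=
  {Y : YoungDiagram // Y.rowLen 0 ≤ n - m ∧ Y.colLen 0 ≤ m}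

/-- The empty partition. -/
def BoxPartition.empty (m n : ℕ) : BoxPartition m n :=
  ⟨⊥, by
    have h1 : (⊥ : YoungDiagram).rowLen 0 = 0 := by
      by_contra h
      exact YoungDiagram.notMem_bot _
        (YoungDiagram.mem_iff_lt_rowLen.2 (Nat.pos_of_ne_zero h))
    have h2 : (⊥ : YoungDiagram).colLen 0 = 0 := by
      by_contra h
      exact YoungDiagram.notMem_bot _
        (YoungDiagram.mem_iff_lt_colLen.2 (Nat.pos_of_ne_zero h))
    rw [h1, h2]
    exact ⟨Nat.zero_le _, Nat.zero_le _⟩⟩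

/-- The bi-infinite sequence `λ[r]` with `λ[r]_{i+r} = λ_i + r` for `1 ≤ i ≤ m` and
`λ[r]_k = λ[r]_{k+m} + (n - m)` for all `k` (the rows of a Young diagram are numbered from `0`). -/
def BoxPartition.seq {m n : ℕ} (lam : BoxPartition m n) (r k : ℤ) : ℤ :=
  (lam.1.rowLen ((k - r - 1) % m).toNat : ℤ) + r - ((n : ℤ) - m) * ((k - r - 1) / m)

/-- `λ[r]_{i+r} = λ_i + r` for `i = j + 1 = 1, …, m`. -/
theorem BoxPartition.seq_apply {m n : ℕ} (lam : BoxPartition m n) (r : ℤ) (j : ℕ) (hj : j < m) :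
    lam.seq r ((j + 1 : ℕ) + r) = lam.1.rowLen j + r := by
  have h : (((j + 1 : ℕ) : ℤ) + r - r - 1) = (j : ℤ) := by push_cast; ring
  have h1 : (j : ℤ) % m = j := Int.emod_eq_of_lt (by omega) (by omega)
  have h2 : (j : ℤ) / m = 0 := Int.ediv_eq_zero_of_lt (by omega) (by omega)
  rw [BoxPartition.seq, h, h1, h2]
  simp

/-- The sequence `λ[r]` is `(m, n)`-periodic. -/
theorem BoxPartition.seq_periodic {m n : ℕ} (hm : 0 < m) (lam : BoxPartition m n) (r k : ℤ) :
    lam.seq r k = lam.seq r (k + m) + ((n : ℤ) - m) := by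
  have h : k + m - r - 1 = (k - r - 1) + m := by ring
  have hm' : (m : ℤ) ≠ 0 := by omega
  simp only [BoxPartition.seq, h, Int.add_emod_right, Int.add_ediv_of_dvd_right (dvd_refl (m : ℤ)),
    Int.ediv_self hm']
  ring

/-- A cylindric shape `λ[r]/μ[s]` of type `(m, n)`. -/
@[ext]
structure CylShape (m n : ℕ) where
  lam : BoxPartition m n
  r : ℤ
  mu : BoxPartition m n
  s : ℤ
  le : ∀ k, mu.seq s k ≤ lam.seq r k

/-- The cylindric shape `∅/0/∅`. -/
def CylShape.empty (m n : ℕ) : CylShape m n :=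
  ⟨BoxPartition.empty m n, 0, BoxPartition.empty m n, 0, fun _ => le_rfl⟩

/-- The set of cylindric shapes `λ/d/∅ = λ[d]/∅[0]`, `λ ∈ P_{mn}`, `d ≥ 0`. -/
def straightShapes (m n : ℕ) : Set (CylShape m n) :=
  {x | 0 ≤ x.r ∧ x.mu = BoxPartition.empty m n ∧ x.s = 0}

/-- The cylinder `ℤ² / (-m, n - m)ℤ`; in `(i, j)` the row is `i` and the column is `j`. -/
abbrev Cylinder (m n : ℕ) : Type :=
  (ℤ × ℤ) ⧸ AddSubgroup.zmultiples ((-(m : ℤ), (n : ℤ) - m) : ℤ × ℤ)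

/-- The class `⟨i, j⟩` of `(i, j)` in the cylinder. -/
def Cylinder.box {m n : ℕ} (i j : ℤ) : Cylinder m n := QuotientAddGroup.mk (i, j)

/-- The diagram `D_{λ[r]/μ[s]} = {⟨i, j⟩ | μ[s]_i < j ≤ λ[r]_i}`. -/
def CylShape.diagram {m n : ℕ} (x : CylShape m n) : Set (Cylinder m n) :=
  {c | ∃ i j : ℤ, c = Cylinder.box i j ∧ x.mu.seq x.s i < j ∧ j ≤ x.lam.seq x.r i}

/-- `y` arises from `x` by adding a box on the `i`-th diagonal, the inner sequence being fixed. -/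
def CylShape.AddsBox {m n : ℕ} (i : ZMod n) (x y : CylShape m n) : Prop :=
  y.mu = x.mu ∧ y.s = x.s ∧ ∃ p q : ℤ, ((q - p : ℤ) : ZMod n) = i ∧
    Cylinder.box p q ∉ x.diagram ∧ y.diagram = insert (Cylinder.box p q) x.diagram

open Classical in
/-- The action of the generator `A_i` on cylindric shapes: add a box on the `i`-th diagonal if this
is possible, and `none` (that is, `0`) otherwise. -/
noncomputable def CylShape.actGen {m n : ℕ} (i : ZMod n) (x : CylShape m n) :
    Option (CylShape m n) :=
  if h : ∃ y, CylShape.AddsBox i x y then some h.choose else none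

/-- The action of `A_{i_1} A_{i_2} ⋯ A_{i_l}` on cylindric shapes, `none` standing for `0`. For a
reduced word of `w` this is the action of `A_w`. -/
noncomputable def CylShape.actWord {m n : ℕ} : List (ZMod n) → CylShape m n →
    Option (CylShape m n)
  | [], x => some x
  | i :: ω, x => (CylShape.actWord ω x).bind (CylShape.actGen i)

/-- Cylindric semistandard tableaux: weakly increasing along rows (in `j`), strictly increasing down
columns (in `i`). The entry `k : ℕ` belongs to the variable of index `k`. -/
def CylShape.IsSemistandard {m n : ℕ} (x : CylShape m n) (T : x.diagram → ℕ) : Prop :=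
  (∀ (i j : ℤ) (h : Cylinder.box i j ∈ x.diagram) (h' : Cylinder.box i (j + 1) ∈ x.diagram),
    T ⟨_, h⟩ ≤ T ⟨_, h'⟩) ∧
  (∀ (i j : ℤ) (h : Cylinder.box i j ∈ x.diagram) (h' : Cylinder.box (i + 1) j ∈ x.diagram),
    T ⟨_, h⟩ < T ⟨_, h'⟩)

/-- The number of semistandard tableaux of shape `x` and weight `e`. -/
noncomputable def CylShape.numTableaux {m n : ℕ} (x : CylShape m n) (e : ℕ →₀ ℕ) : ℕ :=
  Nat.card {T : x.diagram → ℕ // x.IsSemistandard T ∧ ∀ k, Nat.card {b // T b = k} = e k}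

/-- The cylindric (skew) Schur function `s_{λ[r]/μ[s]}`, in variables indexed by `ℕ`. -/
noncomputable def CylShape.schur {m n : ℕ} (x : CylShape m n) : MvPowerSeries ℕ ℤ :=
  fun e => (x.numTableaux e : ℤ)

/-!
# Affine Schur functions of `321`-avoiding elements are cylindric Schur functions

A cylindric shape `λ[r]` is recorded by the sequence `b k = λ[r]_k - k`: a strictly decreasing
sequence with `b (k + m) = b k - n`, read as the positions of particles on `ℤ`, with `m` occupied
classes modulo `n`. Adding a box on the diagonal `i` moves a particle from the class `i - 1` to the
empty class `i`. The group `S̃_n` acts on `ℤ` by `n`-periodic permutations, hence on sequences of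
particles, and each such move is the effect of `s_i`. The shape `A_w · (∅/0/∅)` is thus `w` applied
to the ground state `b = ground m n`, provided that every letter of a word of `w` really moves a
particle up; such words are called allowed (`Allowed`) and such elements raising (`IsRaising`).

*The bijection.* A generator raises the total position of `m` consecutive particles (`charge`) by at
most one, with equality exactly for an allowed move. So allowed words are reduced, and all reduced
words of a raising element are allowed (`Allowed.of_isReduced`). Two allowed words that lead to the
same configuration have the same product, since their last letters are equal or commute
(`Allowed.wordProd_eq`). As every configuration above the ground state can be reached
(`exists_allowed`), raising elements correspond to the shapes `λ/d/∅`.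

*Raising elements are the elements of `A⁰`* (`mem_grassSet_iff`). One direction is read off from the
moves: a cyclically increasing factor moves distinct particles, a cyclically decreasing one fills
distinct holes. For the other one, let `w = s_i v` be reduced with `v` raising and suppose that
`s_i` does not move a particle of the configuration of `v`. Depending on whether the classes `i - 1`
and `i` are occupied, `v` has a reduced word that shows one of the following: `w` is shorter than
`v`; `w` ends with a letter other than `s_0`; `w` contains `s_i s_{i+1} s_i` or `s_i s_{i-1} s_i`;
`w` has a right factor `u_J` with `|J| = m + 1` or `d_J` with `|J| = n - m + 1`.

*The weak order* becomes the pointwise order of configurations, again by `exists_allowed`.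

*The generating functions.* An allowed word is cyclically decreasing exactly if its boxes form a
horizontal strip (`Allowed.isCycDecWord_iff`). Hence both sides count flags of horizontal strips from
the ground state to the configuration of `w` (`numCycDecDecomp_eq`, `numTableaux_eq`), but with the
strips in opposite orders, as the leftmost factor of `w` adds the outermost strip. The Bender–Knuth
involutions (`card_isFlag_swap`) show that the order of the strip sizes does not matter.
-/

/-! ### The action of the affine symmetric group on the integers -/

theorem intCast_zmod_ne {n : ℕ} {z w : ℤ} (h₁ : z < w) (h₂ : w < z + n) :
    (z : ZMod n) ≠ w := by
  rw [Ne, ZMod.intCast_eq_intCast_iff_dvd_sub]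
  intro h
  have := Int.le_of_dvd (by omega) h
  omega

theorem exists_eq_add_mul_of_intCast_eq {n : ℕ} {z w : ℤ} (h : (z : ZMod n) = w) :
    ∃ t : ℤ, w = z + n * t := by
  obtain ⟨t, ht⟩ := (ZMod.intCast_eq_intCast_iff_dvd_sub z w n).1 h
  exact ⟨t, by omega⟩

/-- The generator `s_i` as a permutation of `ℤ`: it exchanges `z` and `z + 1` whenever
`z ≡ i - 1` modulo `n`. -/
def affSwap {n : ℕ} (i : ZMod n) (z : ℤ) : ℤ :=
  if (z : ZMod n) = i - 1 then z + 1 else if (z : ZMod n) = i then z - 1 else z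

section affSwap

variable {n : ℕ} {i j : ZMod n} {z : ℤ}

theorem affSwap_of_eq_sub_one (h : (z : ZMod n) = i - 1) : affSwap i z = z + 1 := if_pos h

theorem affSwap_of_ne (h : (z : ZMod n) ≠ i - 1) (h' : (z : ZMod n) ≠ i) : affSwap i z = z := by
  rw [affSwap, if_neg h, if_neg h']

theorem affSwap_add_mul (i : ZMod n) (z t : ℤ) : affSwap i (z + n * t) = affSwap i z + n * t := by
  unfold affSwap
  have : ((z + n * t : ℤ) : ZMod n) = z := by simp
  rw [this]
  split_ifs <;> ring

theorem affSwap_sub_nat (i : ZMod n) (z : ℤ) : affSwap i (z - n) = affSwap i z - n := by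
  have := affSwap_add_mul i z (-1)
  simpa [sub_eq_add_neg] using this

variable [Fact (1 < n)]

theorem affSwap_of_eq (h : (z : ZMod n) = i) : affSwap i z = z - 1 := by
  rw [affSwap, if_neg, if_pos h]
  rw [h]
  exact fun h' => one_ne_zero (sub_eq_self.1 h'.symm)

theorem affSwap_affSwap (i : ZMod n) (z : ℤ) : affSwap i (affSwap i z) = z := by
  by_cases h : (z : ZMod n) = i - 1
  · rw [affSwap_of_eq_sub_one h, affSwap_of_eq (by push_cast; rw [h]; ring)]
    ring
  by_cases h' : (z : ZMod n) = i
  · rw [affSwap_of_eq h', affSwap_of_eq_sub_one (by push_cast; rw [h'])]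
    ring
  · rw [affSwap_of_ne h h', affSwap_of_ne h h']

theorem affSwap_comm (h : j ≠ i) (h₁ : j ≠ i + 1) (h₂ : i ≠ j + 1) (z : ℤ) :
    affSwap i (affSwap j z) = affSwap j (affSwap i z) := by
  have e₁ : i - 1 ≠ j := fun h => h₂ (by rw [← h]; ring)
  have e₂ : j - 1 ≠ i := fun h => h₁ (by rw [← h]; ring)
  have e₃ : i - 1 ≠ j - 1 := fun h' => h (sub_left_inj.1 h').symm
  by_cases hi : (z : ZMod n) = i - 1
  · rw [affSwap_of_eq_sub_one hi, affSwap_of_ne (i := j) (by rwa [hi]) (by rwa [hi]),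
      affSwap_of_eq_sub_one hi, affSwap_of_ne]
    · push_cast; rw [hi, sub_add_cancel]; exact e₂.symm
    · push_cast; rw [hi, sub_add_cancel]; exact h.symm
  by_cases hi' : (z : ZMod n) = i
  · rw [affSwap_of_eq hi', affSwap_of_ne (i := j) (by rw [hi']; exact e₂.symm)
      (by rw [hi']; exact h.symm),
      affSwap_of_eq hi', affSwap_of_ne]
    · push_cast; rw [hi']; exact e₃
    · push_cast; rw [hi']; exact e₁
  rw [affSwap_of_ne hi hi']
  by_cases hj : (z : ZMod n) = j - 1
  · rw [affSwap_of_eq_sub_one hj, affSwap_of_ne]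
    · push_cast; rw [hj, sub_add_cancel]; exact e₁.symm
    · push_cast; rw [hj, sub_add_cancel]; exact h
  by_cases hj' : (z : ZMod n) = j
  · rw [affSwap_of_eq hj', affSwap_of_ne]
    · push_cast; rw [hj']; exact e₃.symm
    · push_cast; rw [hj']; exact e₂
  rw [affSwap_of_ne hj hj', affSwap_of_ne hi hi']

theorem affSwap_braid (h3 : 3 ≤ n) (i : ZMod n) (z : ℤ) :
    affSwap i (affSwap (i + 1) (affSwap i z)) =
      affSwap (i + 1) (affSwap i (affSwap (i + 1) z)) := by
  have n1 : (1 : ZMod n) ≠ 0 := one_ne_zero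
  have n2 : (2 : ZMod n) ≠ 0 := by
    have := intCast_zmod_ne (n := n) (z := 0) (w := 2) (by norm_num) (by omega)
    simpa using this.symm
  have f1 : i - 1 ≠ i := fun h => n1 (sub_eq_self.1 h)
  have f2 : i + 1 ≠ i := fun h => n1 (by simp at h)
  have f3 : i + 1 ≠ i - 1 := fun h => n2 (by linear_combination h)
  have key (x : ℤ) (j : ZMod n) : affSwap j x =
    if (x : ZMod n) = j - 1 then x + 1 else if (x : ZMod n) = j then x - 1 else x := rfl
  by_cases hi : (z : ZMod n) = i - 1
  · simp [key, hi, f1, f3.symm, f2, f3]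
  by_cases hi' : (z : ZMod n) = i
  · simp [key, hi', f1, f3.symm, f2, f1.symm, f3]
  by_cases hj : (z : ZMod n) = i + 1
  · simp [key, hj, f1, f3.symm, f2, f1.symm, f3]
  simp [key, hi, hi', hj]

end affSwap

/-- `affSwap i` as a permutation of `ℤ`. -/
def affSwapPerm {n : ℕ} [Fact (1 < n)] (i : ZMod n) : Equiv.Perm ℤ :=
  Function.Involutive.toPerm (affSwap i) (affSwap_affSwap i)

theorem affSwapPerm_mul_self {n : ℕ} [Fact (1 < n)] (i : ZMod n) :
    affSwapPerm i * affSwapPerm i = 1 :=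
  Equiv.ext fun z => affSwap_affSwap i z

theorem pow_three_eq_one_of_braid {G : Type*} [Group G] {a b : G} (ha : a * a = 1) (hb : b * b = 1)
    (h : a * b * a = b * a * b) : (a * b) ^ 3 = 1 := by
  calc (a * b) ^ 3 = (a * b * a) * (b * a * b) := by
        simp only [pow_succ, pow_zero, one_mul, mul_assoc]
    _ = (a * b * a) * (a * b * a) := by rw [h]
    _ = a * b * (a * a) * b * a := by simp only [mul_assoc]
    _ = a * (b * b) * a := by rw [ha]; simp only [mul_assoc, mul_one]
    _ = 1 := by rw [hb, mul_one, ha]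

theorem affineMatrix_apply {n : ℕ} (i j : ZMod n) : (affineMatrix n) i j =
    if i = j then 1 else if n = 2 then 0 else if j = i + 1 ∨ i = j + 1 then 3 else 2 := rfl

theorem isLiftable_affSwapPerm (n : ℕ) [hn : Fact (1 < n)] :
    (affineMatrix n).IsLiftable (affSwapPerm (n := n)) := by
  have hn := hn.out
  have braid (h3 : 3 ≤ n) (i : ZMod n) : affSwapPerm i * affSwapPerm (i + 1) * affSwapPerm i =
      affSwapPerm (i + 1) * affSwapPerm i * affSwapPerm (i + 1) :=
    Equiv.ext fun z => affSwap_braid h3 i z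
  intro i j
  rw [affineMatrix_apply]
  split_ifs with h h2 h3
  · rw [h, pow_one, affSwapPerm_mul_self]
  · rw [pow_zero]
  · have hb (i : ZMod n) := braid (by omega) i
    rcases h3 with rfl | rfl
    · exact pow_three_eq_one_of_braid (affSwapPerm_mul_self _) (affSwapPerm_mul_self _) (hb _)
    · exact pow_three_eq_one_of_braid (affSwapPerm_mul_self _) (affSwapPerm_mul_self _) (hb _).symm
  · rw [not_or] at h3
    have hc : affSwapPerm i * affSwapPerm j = affSwapPerm j * affSwapPerm i :=
      Equiv.ext fun z => affSwap_comm (Ne.symm h) h3.1 h3.2 z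
    rw [pow_two]
    nth_rewrite 2 [hc]
    rw [mul_assoc, ← mul_assoc (affSwapPerm j), affSwapPerm_mul_self, one_mul, affSwapPerm_mul_self]

/-- The action of `S̃_n` on `ℤ` by `n`-periodic permutations. -/
def affPerm {n : ℕ} [Fact (1 < n)] : AffSym n →* Equiv.Perm ℤ :=
  (affSys n).lift ⟨affSwapPerm, isLiftable_affSwapPerm n⟩

theorem affPerm_simple {n : ℕ} [Fact (1 < n)] (i : ZMod n) (z : ℤ) :
    affPerm ((affSys n).simple i) z = affSwap i z := by
  rw [affPerm, CoxeterSystem.lift_apply_simple]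
  rfl

theorem simple_mul_simple_comm {n : ℕ} {i j : ZMod n} (h₁ : j ≠ i + 1)
    (h₂ : i ≠ j + 1) : (affSys n).simple i * (affSys n).simple j =
      (affSys n).simple j * (affSys n).simple i := by
  by_cases h : i = j
  · rw [h]
  have h2 : n ≠ 2 := by
    rintro rfl
    exact h ((by decide : ∀ i j : ZMod 2, j ≠ i + 1 → i = j) i j h₁)
  have := (affSys n).simple_mul_simple_pow i j
  rw [affineMatrix_apply, if_neg h, if_neg h2, if_neg (by tauto), pow_two] at this
  rw [eq_inv_of_mul_eq_one_left this, mul_inv_rev, CoxeterSystem.inv_simple,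
    CoxeterSystem.inv_simple]

theorem simple_braid {n : ℕ} [Fact (1 < n)] (h2 : n ≠ 2) (i : ZMod n) :
    (affSys n).simple i * (affSys n).simple (i + 1) * (affSys n).simple i =
      (affSys n).simple (i + 1) * (affSys n).simple i * (affSys n).simple (i + 1) := by
  have := (affSys n).simple_mul_simple_pow i (i + 1)
  rw [affineMatrix_apply, if_neg (by simp), if_neg h2, if_pos (Or.inl rfl)] at this
  set a := (affSys n).simple i with ha
  set b := (affSys n).simple (i + 1) with hb
  have h : a * b * a * (b * a * b) = 1 := by
    rw [← this]; simp only [pow_succ, pow_zero, one_mul, mul_assoc]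
  rw [eq_inv_of_mul_eq_one_left h, mul_inv_rev, mul_inv_rev, ha, hb, CoxeterSystem.inv_simple,
    CoxeterSystem.inv_simple, mul_assoc]

/-- A generator different from `s_j` does not move integers across the wall between `z - 1` and `z`,
where `z ≡ j`. -/
theorem le_affSwap_iff {n : ℕ} [Fact (1 < n)] {i j : ZMod n} (h : i ≠ j) {w : ℤ}
    (hw : (w : ZMod n) = j) (z : ℤ) : w ≤ affSwap i z ↔ w ≤ z := by
  have key (z : ℤ) (hz : w ≤ z) : w ≤ affSwap i z := by
    by_cases h₁ : (z : ZMod n) = i - 1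
    · rw [affSwap_of_eq_sub_one h₁]; omega
    by_cases h₂ : (z : ZMod n) = i
    · rw [affSwap_of_eq h₂]
      have : z ≠ w := by rintro rfl; exact h (h₂.symm.trans hw)
      omega
    · rwa [affSwap_of_ne h₁ h₂]
  exact ⟨fun hz => by simpa [affSwap_affSwap] using key _ hz, key z⟩

theorem le_affPerm_wordProd_iff {n : ℕ} [Fact (1 < n)] {ω : List (ZMod n)} {j : ZMod n} (h : j ∉ ω)
    {w : ℤ} (hw : (w : ZMod n) = j) (z : ℤ) :
    w ≤ affPerm ((affSys n).wordProd ω) z ↔ w ≤ z := by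
  induction ω with
  | nil => simp
  | cons i ω ih =>
    rw [List.mem_cons, not_or] at h
    rw [CoxeterSystem.wordProd_cons, map_mul, Equiv.Perm.mul_apply, affPerm_simple,
      le_affSwap_iff (Ne.symm h.1) hw, ih h.2]

/-- A letter that occurs exactly once in a word occurs in every word with the same product: the
product moves some integer across the corresponding wall. -/
theorem mem_of_wordProd_eq {n : ℕ} [Fact (1 < n)] {α β ω : List (ZMod n)} {j : ZMod n} (hα : j ∉ α)
    (hβ : j ∉ β) (h : (affSys n).wordProd ω = (affSys n).wordProd (α ++ j :: β)) : j ∈ ω := by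
  by_contra hj
  obtain ⟨w, hw⟩ := ZMod.intCast_surjective j
  set y := (affPerm ((affSys n).wordProd β)).symm (w - 1) with hy
  have hy' : affPerm ((affSys n).wordProd β) y = w - 1 := Equiv.apply_symm_apply _ _
  have h1 : ¬ w ≤ y := by
    rw [← le_affPerm_wordProd_iff hβ hw, hy']; omega
  rw [← le_affPerm_wordProd_iff hj hw, h, CoxeterSystem.wordProd_append,
    CoxeterSystem.wordProd_cons, map_mul, map_mul, Equiv.Perm.mul_apply, Equiv.Perm.mul_apply,
    le_affPerm_wordProd_iff hα hw, hy', affPerm_simple,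
    affSwap_of_eq_sub_one (by push_cast; rw [hw])] at h1
  omega

theorem isReduced_of_nodup {n : ℕ} [Fact (1 < n)] {ω : List (ZMod n)} (h : ω.Nodup) :
    (affSys n).IsReduced ω := by
  obtain ⟨ω', hr, hω'⟩ := (affSys n).exists_isReduced ((affSys n).wordProd ω)
  refine le_antisymm ((affSys n).length_wordProd_le ω) ?_
  rw [hω', hr.eq]
  refine (h.subperm fun j hj => ?_).length_le
  obtain ⟨α, β, rfl⟩ := List.append_of_mem hj
  have h' := List.nodup_middle.1 h
  rw [List.nodup_cons, List.mem_append, not_or] at h'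
  exact mem_of_wordProd_eq h'.1.1 h'.1.2 hω'.symm

/-! ### Particle configurations -/

/-- A sequence `b` of integers, the positions of particles labelled by `ℤ`, that is injective and
`(m, n)`-periodic. -/
structure IsPeriodicInj (m n : ℕ) (b : ℤ → ℤ) : Prop where
  inj : Function.Injective b
  periodic : ∀ k, b (k + m) = b k - n

/-- A particle configuration: a strictly decreasing `(m, n)`-periodic sequence of integers. The
sequence `k ↦ λ[r]_k - k` of a cylindric shape is of this kind, and every configuration arises
in this way from exactly one pair `(λ, r)`. -/
structure IsConf (m n : ℕ) (b : ℤ → ℤ) : Prop where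
  anti : StrictAnti b
  periodic : ∀ k, b (k + m) = b k - n

theorem IsConf.isPeriodicInj {m n : ℕ} {b : ℤ → ℤ} (h : IsConf m n b) : IsPeriodicInj m n b :=
  ⟨h.anti.injective, h.periodic⟩

/-- The residue class `j` is occupied by a particle of `b`. -/
def Occ {n : ℕ} (b : ℤ → ℤ) (j : ZMod n) : Prop := ∃ p, (b p : ZMod n) = j

/-- The sum of the positions of the particles `1, …, m`. -/
def charge (m : ℕ) (b : ℤ → ℤ) : ℤ := ∑ k ∈ Finset.range m, b (k + 1)

/-- The action of `S̃_n` on sequences of integers. -/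
def act {n : ℕ} [Fact (1 < n)] (w : AffSym n) (b : ℤ → ℤ) : ℤ → ℤ := fun k => affPerm w (b k)

/-- Reading `ω` from right to left, every letter `i` moves a particle from the class `i - 1` to the
empty class `i`. -/
def Allowed {n : ℕ} [Fact (1 < n)] : List (ZMod n) → (ℤ → ℤ) → Prop
  | [], _ => True
  | i :: ω, b => Allowed ω b ∧ Occ (act ((affSys n).wordProd ω) b) (i - 1) ∧
      ¬ Occ (act ((affSys n).wordProd ω) b) i

theorem exists_eq_add_mul_of_pos {m : ℕ} (hm : 0 < m) (p : ℤ) :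
    ∃ q < m, ∃ t : ℤ, p = (q + 1 : ℤ) + m * t := by
  refine ⟨((p - 1) % m).toNat, ?_, (p - 1) / m, ?_⟩
  · have := Int.emod_lt_of_pos (p - 1) (b := m) (by omega)
    have := Int.emod_nonneg (p - 1) (b := m) (by omega)
    omega
  · have := Int.emod_nonneg (p - 1) (b := m) (by omega)
    have := Int.emod_add_mul_ediv (p - 1) m
    omega

section periodic

variable {m n : ℕ} {b : ℤ → ℤ}

theorem periodic_mul (h : ∀ k, b (k + m) = b k - n) (k t : ℤ) : b (k + m * t) = b k - n * t := by
  induction t with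
  | zero => simp
  | succ t ih => rw [mul_add, mul_one, ← add_assoc, h, ih]; ring
  | pred t ih =>
    have := h (k + m * (-t - 1))
    rw [show k + m * (-(t : ℤ) - 1) + m = k + m * -t by ring, ih] at this
    linarith

theorem IsPeriodicInj.eq_of_cast_eq (h : IsPeriodicInj m n b) {p q : ℤ}
    (hpq : (b p : ZMod n) = b q) : ∃ t : ℤ, q = p + m * t ∧ b q = b p - n * t := by
  obtain ⟨t, ht⟩ := exists_eq_add_mul_of_intCast_eq hpq
  have h1 := periodic_mul h.periodic p (-t)
  have h2 : q = p + m * (-t) := h.inj (by rw [ht, h1]; ring)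
  exact ⟨-t, h2, by rw [ht]; ring⟩

/-- A particle in the class of `z` can be relabelled to sit at `z` itself. -/
theorem Occ.exists_eq (h : ∀ k, b (k + m) = b k - n) {z : ℤ} (ho : Occ b (z : ZMod n)) :
    ∃ p, b p = z := by
  obtain ⟨p, hp⟩ := ho
  obtain ⟨t, ht⟩ := exists_eq_add_mul_of_intCast_eq hp
  exact ⟨p + m * (-t), by rw [periodic_mul h, ht]; ring⟩

theorem Occ.exists_mem_range (hm : 0 < m) (h : ∀ k, b (k + m) = b k - n) {j : ZMod n}
    (ho : Occ b j) : ∃ q < m, (b (q + 1 : ℤ) : ZMod n) = j := by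
  obtain ⟨p, hp⟩ := ho
  obtain ⟨q, hq, t, rfl⟩ := exists_eq_add_mul_of_pos hm p
  refine ⟨q, hq, ?_⟩
  rw [← hp, periodic_mul h]
  simp

theorem IsPeriodicInj.eq_of_mem_range (h : IsPeriodicInj m n b) {p q : ℕ} (hp : p < m)
    (hq : q < m) (hpq : (b (p + 1 : ℤ) : ZMod n) = b (q + 1 : ℤ)) : p = q := by
  obtain ⟨t, ht, -⟩ := h.eq_of_cast_eq hpq
  have h1 : (m : ℤ) ∣ (q : ℤ) - p := ⟨t, by linarith⟩
  have h2 : (p : ℤ) ≡ q [ZMOD m] := (Int.modEq_iff_dvd).2 h1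
  exact Nat.ModEq.eq_of_lt_of_lt (Int.natCast_modEq_iff.1 h2) hp hq

open Classical in
theorem IsPeriodicInj.sum_occ (hm : 0 < m) (h : IsPeriodicInj m n b) (j : ZMod n) :
    ∑ k ∈ Finset.range m, (if (b (k + 1 : ℤ) : ZMod n) = j then (1 : ℤ) else 0) =
      if Occ b j then 1 else 0 := by
  split_ifs with ho
  · obtain ⟨q, hq, hqj⟩ := ho.exists_mem_range hm h.periodic
    rw [Finset.sum_eq_single_of_mem q (Finset.mem_range.2 hq), if_pos hqj]
    intro k hk hkq
    rw [if_neg]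
    exact fun hk' => hkq (h.eq_of_mem_range (Finset.mem_range.1 hk) hq (hk'.trans hqj.symm))
  · exact Finset.sum_eq_zero fun k _ => if_neg fun hk => ho ⟨_, hk⟩

theorem IsConf.eq_sub_one_iff (h : IsConf m n b) {p q : ℤ} (hq : b q = b p + 1) : q = p - 1 := by
  have h1 : q < p := h.anti.lt_iff_gt.1 (by omega)
  by_contra h2
  have h3 := h.anti (show q < p - 1 by omega)
  have h4 := h.anti (show p - 1 < p by omega)
  omega

theorem IsConf.not_occ_iff (h : IsConf m n b) (p : ℤ) :
    ¬ Occ b ((b p + 1 : ℤ) : ZMod n) ↔ b (p - 1) ≠ b p + 1 := by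
  rw [Ne, not_iff_not]
  constructor
  · intro ho
    obtain ⟨q, hq⟩ := ho.exists_eq h.periodic
    rwa [← h.eq_sub_one_iff hq]
  · intro h1
    exact ⟨_, by rw [h1]⟩

/-- Between two comparable distinct configurations, a particle can make a step. -/
theorem IsConf.exists_step (hmn : m < n) {b' : ℤ → ℤ} (h : IsConf m n b) (h' : IsConf m n b')
    (hle : b ≤ b') (hne : b ≠ b') : ∃ p, b p < b' p ∧ b (p - 1) ≠ b p + 1 := by
  by_contra! hc
  obtain ⟨p, hp⟩ : ∃ p, b p < b' p := by
    by_contra! hc'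
    exact hne (le_antisymm hle hc')
  have key (t : ℕ) : b (p - t) = b p + t ∧ b (p - t) < b' (p - t) := by
    induction t with
    | zero => simpa using hp
    | succ t ih =>
      have h1 := hc _ ih.2
      have h2 := h'.anti (show p - (t : ℤ) - 1 < p - t by omega)
      have h3 : p - ((t + 1 : ℕ) : ℤ) = p - t - 1 := by push_cast; ring
      rw [h3]
      push_cast
      constructor <;> omega
  have h1 := (key m).1
  have h2 := h.periodic (p - m)
  rw [sub_add_cancel] at h2
  omega

variable [Fact (1 < n)]

theorem act_one (b : ℤ → ℤ) : act (1 : AffSym n) b = b := by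
  funext k; simp [act]

theorem act_mul (v w : AffSym n) (b : ℤ → ℤ) : act (v * w) b = act v (act w b) := by
  funext k; simp [act]

theorem act_simple (i : ZMod n) (b : ℤ → ℤ) (k : ℤ) :
    act ((affSys n).simple i) b k = affSwap i (b k) := affPerm_simple i (b k)

theorem act_cons (i : ZMod n) (ω : List (ZMod n)) (b : ℤ → ℤ) :
    act ((affSys n).wordProd (i :: ω)) b =
      act ((affSys n).simple i) (act ((affSys n).wordProd ω) b) := by
  rw [CoxeterSystem.wordProd_cons, act_mul]

theorem act_simple_act_simple (i : ZMod n) (b : ℤ → ℤ) :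
    act ((affSys n).simple i) (act ((affSys n).simple i) b) = b := by
  rw [← act_mul, CoxeterSystem.simple_mul_simple_self, act_one]

theorem IsPeriodicInj.act_simple (h : IsPeriodicInj m n b) (i : ZMod n) :
    IsPeriodicInj m n (act ((affSys n).simple i) b) :=
  ⟨(Equiv.injective _).comp h.inj, fun k => by
    rw [_root_.act_simple, _root_.act_simple, h.periodic, affSwap_sub_nat]⟩

theorem IsPeriodicInj.act_wordProd (h : IsPeriodicInj m n b) (ω : List (ZMod n)) :
    IsPeriodicInj m n (act ((affSys n).wordProd ω) b) := by
  induction ω with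
  | nil => rwa [CoxeterSystem.wordProd_nil, act_one]
  | cons i ω ih => rw [act_cons]; exact ih.act_simple i

open Classical in
theorem IsPeriodicInj.charge_act_simple (hm : 0 < m) (h : IsPeriodicInj m n b) (i : ZMod n) :
    charge m (act ((affSys n).simple i) b) =
      charge m b + (if Occ b (i - 1) then 1 else 0) - (if Occ b i then 1 else 0) := by
  rw [← h.sum_occ hm, ← h.sum_occ hm, charge, charge, ← Finset.sum_add_distrib,
    ← Finset.sum_sub_distrib]
  refine Finset.sum_congr rfl fun k _ => ?_
  rw [_root_.act_simple]
  by_cases h1 : (b (k + 1 : ℤ) : ZMod n) = i - 1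
  · rw [affSwap_of_eq_sub_one h1, if_pos h1, if_neg]
    · ring
    · rw [h1]; exact fun h' => one_ne_zero (sub_eq_self.1 h')
  by_cases h2 : (b (k + 1 : ℤ) : ZMod n) = i
  · rw [affSwap_of_eq h2, if_neg h1, if_pos h2]; ring
  · rw [affSwap_of_ne h1 h2, if_neg h1, if_neg h2]; ring

theorem IsPeriodicInj.charge_act_simple_le (hm : 0 < m) (h : IsPeriodicInj m n b) (i : ZMod n) :
    charge m (act ((affSys n).simple i) b) ≤ charge m b + 1 := by
  classical
  rw [h.charge_act_simple hm]
  split_ifs <;> omega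

theorem IsPeriodicInj.charge_act_simple_eq_iff (hm : 0 < m) (h : IsPeriodicInj m n b)
    (i : ZMod n) : charge m (act ((affSys n).simple i) b) = charge m b + 1 ↔
      Occ b (i - 1) ∧ ¬ Occ b i := by
  classical
  rw [h.charge_act_simple hm]
  split_ifs with h1 h2 h2 <;> (simp [h1, h2]; try omega)

theorem IsPeriodicInj.charge_act_wordProd_le (hm : 0 < m) (h : IsPeriodicInj m n b)
    (ω : List (ZMod n)) : charge m (act ((affSys n).wordProd ω) b) ≤ charge m b + ω.length := by
  induction ω with
  | nil => simp [act_one]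
  | cons i ω ih =>
    rw [act_cons, List.length_cons]
    have := (h.act_wordProd ω).charge_act_simple_le hm i
    push_cast
    omega

/-- A letter raises the charge by at most one, and by one only if it moves a particle to an empty
class. -/
theorem IsPeriodicInj.charge_act_wordProd_eq_iff (hm : 0 < m) (h : IsPeriodicInj m n b)
    (ω : List (ZMod n)) : charge m (act ((affSys n).wordProd ω) b) = charge m b + ω.length ↔
      Allowed ω b := by
  induction ω with
  | nil => simp [act_one, Allowed]
  | cons i ω ih =>
    have h1 := (h.act_wordProd ω).charge_act_simple_le hm i
    have h2 := h.charge_act_wordProd_le hm ω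
    rw [Allowed, ← ih, ← (h.act_wordProd ω).charge_act_simple_eq_iff hm, act_cons, List.length_cons]
    push_cast
    constructor
    · intro h'
      constructor <;> omega
    · intro h'
      omega

theorem allowed_append {ω ω' : List (ZMod n)} {b : ℤ → ℤ} :
    Allowed (ω ++ ω') b ↔ Allowed ω' b ∧ Allowed ω (act ((affSys n).wordProd ω') b) := by
  induction ω with
  | nil => simp [Allowed]
  | cons i ω ih =>
    rw [List.cons_append, Allowed, Allowed, ih, CoxeterSystem.wordProd_append, act_mul, and_assoc]

theorem allowed_singleton {i : ZMod n} {b : ℤ → ℤ} :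
    Allowed [i] b ↔ Occ b (i - 1) ∧ ¬ Occ b i := by
  simp [Allowed, act_one]

theorem Allowed.isReduced (hm : 0 < m) (h : IsPeriodicInj m n b) {ω : List (ZMod n)}
    (hω : Allowed ω b) : (affSys n).IsReduced ω := by
  refine le_antisymm ((affSys n).length_wordProd_le ω) ?_
  obtain ⟨ω', hr, hω'⟩ := (affSys n).exists_isReduced ((affSys n).wordProd ω)
  have h1 := (h.charge_act_wordProd_eq_iff hm ω).2 hω
  have h2 := h.charge_act_wordProd_le hm ω'
  rw [← hω', h1] at h2
  rw [hω', hr.eq]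
  omega

theorem Allowed.of_isReduced (hm : 0 < m) (h : IsPeriodicInj m n b) {ω ω' : List (ZMod n)}
    (hω : Allowed ω b) (hr : (affSys n).IsReduced ω')
    (he : (affSys n).wordProd ω' = (affSys n).wordProd ω) : Allowed ω' b := by
  rw [← h.charge_act_wordProd_eq_iff hm, ← hr.eq, he, (hω.isReduced hm h).eq]
  exact (h.charge_act_wordProd_eq_iff hm ω).2 hω

theorem act_simple_of_occ {i : ZMod n} (h₂ : ¬ Occ b i) (k : ℤ) :
    act ((affSys n).simple i) b k = b k ∧ (b k : ZMod n) ≠ i - 1 ∨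
      act ((affSys n).simple i) b k = b k + 1 ∧ (b k : ZMod n) = i - 1 := by
  rw [act_simple]
  by_cases h1 : (b k : ZMod n) = i - 1
  · exact Or.inr ⟨affSwap_of_eq_sub_one h1, h1⟩
  · exact Or.inl ⟨affSwap_of_ne h1 fun h => h₂ ⟨k, h⟩, h1⟩

theorem le_act_simple {i : ZMod n} (h₂ : ¬ Occ b i) : b ≤ act ((affSys n).simple i) b := by
  intro k
  change b k ≤ act _ b k
  rcases act_simple_of_occ h₂ k with h | h <;> omega

theorem IsConf.act_simple (h : IsConf m n b) {i : ZMod n} (h₂ : ¬ Occ b i) :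
    IsConf m n (act ((affSys n).simple i) b) := by
  refine ⟨fun k l hkl => ?_, (h.isPeriodicInj.act_simple i).periodic⟩
  have h0 := h.anti hkl
  rcases act_simple_of_occ h₂ k with h1 | h1 <;> rcases act_simple_of_occ h₂ l with h3 | h3
  · omega
  · have : b k ≠ b l + 1 := fun he => h₂ ⟨k, by rw [he]; push_cast; rw [h3.2]; ring⟩
    omega
  · omega
  · omega

theorem Allowed.isConf (h : IsConf m n b) {ω : List (ZMod n)} (hω : Allowed ω b) :
    IsConf m n (act ((affSys n).wordProd ω) b) := by
  induction ω with
  | nil => rwa [CoxeterSystem.wordProd_nil, act_one]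
  | cons i ω ih => rw [act_cons]; exact (ih hω.1).act_simple hω.2.2

theorem Allowed.le_act {ω : List (ZMod n)} (hω : Allowed ω b) :
    b ≤ act ((affSys n).wordProd ω) b := by
  induction ω with
  | nil => rw [CoxeterSystem.wordProd_nil, act_one]
  | cons i ω ih => rw [act_cons]; exact (ih hω.1).trans (le_act_simple hω.2.2)

/-- The letters of an allowed word are the classes passed by the particles. -/
theorem Allowed.mem_iff {ω : List (ZMod n)} (hω : Allowed ω b)
    {j : ZMod n} : j ∈ ω ↔
      ∃ p c : ℤ, b p < c ∧ c ≤ act ((affSys n).wordProd ω) b p ∧ (c : ZMod n) = j := by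
  induction ω with
  | nil =>
    simp only [List.not_mem_nil, CoxeterSystem.wordProd_nil, act_one, false_iff]
    rintro ⟨p, c, h1, h2, -⟩
    omega
  | cons i ω ih =>
    rw [List.mem_cons, ih hω.1, act_cons]
    constructor
    · rintro (rfl | ⟨p, c, h1, h2, h3⟩)
      · obtain ⟨p, hp⟩ := hω.2.1
        have h4 : b p ≤ act ((affSys n).wordProd ω) b p := hω.1.le_act p
        refine ⟨p, act ((affSys n).wordProd ω) b p + 1, by omega, ?_, by push_cast; rw [hp]; ring⟩
        rw [act_simple, affSwap_of_eq_sub_one hp]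
      · exact ⟨p, c, h1, h2.trans (le_act_simple hω.2.2 p), h3⟩
    · rintro ⟨p, c, h1, h2, h3⟩
      by_cases h4 : c ≤ act ((affSys n).wordProd ω) b p
      · exact Or.inr ⟨p, c, h1, h4, h3⟩
      · left
        rcases act_simple_of_occ hω.2.2 p with h5 | h5
        · omega
        · have : c = act ((affSys n).wordProd ω) b p + 1 := by omega
          rw [← h3, this]; push_cast; rw [h5.2]; ring

theorem Allowed.exists_mem_range (hm : 0 < m) (h : IsPeriodicInj m n b) {ω : List (ZMod n)}
    (hω : Allowed ω b) {j : ZMod n} (hj : j ∈ ω) : ∃ p c : ℤ, 1 ≤ p ∧ p ≤ m ∧ b p < c ∧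
      c ≤ act ((affSys n).wordProd ω) b p ∧ (c : ZMod n) = j := by
  obtain ⟨p, c, h1, h2, h3⟩ := hω.mem_iff.1 hj
  obtain ⟨q, hq, t, rfl⟩ := exists_eq_add_mul_of_pos hm p
  rw [periodic_mul h.periodic] at h1
  rw [periodic_mul (h.act_wordProd ω).periodic] at h2
  refine ⟨q + 1, c + n * t, by omega, by omega, by omega, by omega, ?_⟩
  simpa using h3

theorem Allowed.charge_eq (hm : 0 < m) (h : IsPeriodicInj m n b) {ω : List (ZMod n)}
    (hω : Allowed ω b) :
    charge m (act ((affSys n).wordProd ω) b) = charge m b + ω.length :=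
  (h.charge_act_wordProd_eq_iff hm ω).2 hω

theorem charge_mono {b' : ℤ → ℤ} (h : b ≤ b') : charge m b ≤ charge m b' :=
  Finset.sum_le_sum fun _ _ => h _

theorem IsConf.act_simple_le {b' : ℤ → ℤ} (h : IsConf m n b)
    (h' : IsConf m n b') (hle : b ≤ b') {p : ℤ} (hp : b p < b' p)
    (hp' : b (p - 1) ≠ b p + 1) :
    act ((affSys n).simple ((b p + 1 : ℤ) : ZMod n)) b ≤ b' := by
  intro k
  change act _ b k ≤ b' k
  rcases act_simple_of_occ ((h.not_occ_iff p).2 hp') k with h1 | h1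
  · rw [h1.1]; exact hle k
  · rw [h1.1]
    have h2 : (b p : ZMod n) = b k := by rw [h1.2]; push_cast; ring
    obtain ⟨t, ht, ht'⟩ := h.isPeriodicInj.eq_of_cast_eq h2
    rw [ht', ht, periodic_mul h'.periodic]
    omega

theorem exists_allowed (hm : 0 < m) (hmn : m < n) {b b' : ℤ → ℤ} (h : IsConf m n b)
    (h' : IsConf m n b') (hle : b ≤ b') :
    ∃ ω : List (ZMod n), Allowed ω b ∧ act ((affSys n).wordProd ω) b = b' := by
  obtain ⟨N, hN⟩ : ∃ N : ℕ, charge m b' - charge m b = N :=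
    Int.eq_ofNat_of_zero_le (by have := charge_mono (m := m) hle; omega)
  induction N generalizing b with
  | zero =>
    refine ⟨[], trivial, ?_⟩
    rw [CoxeterSystem.wordProd_nil, act_one]
    by_contra hne
    obtain ⟨p, hp, hp'⟩ := h.exists_step hmn h' hle hne
    have h1 := charge_mono (m := m) (h.act_simple_le h' hle hp hp')
    have h2 := (h.isPeriodicInj.charge_act_simple_eq_iff hm ((b p + 1 : ℤ) : ZMod n)).2
      ⟨⟨p, by push_cast; ring⟩, (h.not_occ_iff p).2 hp'⟩
    omega
  | succ N ih =>
    have hne : b ≠ b' := by rintro rfl; push_cast at hN; omega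
    obtain ⟨p, hp, hp'⟩ := h.exists_step hmn h' hle hne
    have h2 := (h.isPeriodicInj.charge_act_simple_eq_iff hm ((b p + 1 : ℤ) : ZMod n)).2
      ⟨⟨p, by push_cast; ring⟩, (h.not_occ_iff p).2 hp'⟩
    obtain ⟨ω, h3, h4⟩ := ih (h.act_simple ((h.not_occ_iff p).2 hp'))
      (h.act_simple_le h' hle hp hp') (by push_cast at hN; omega)
    refine ⟨ω ++ [((b p + 1 : ℤ) : ZMod n)], ?_, ?_⟩
    · rw [allowed_append, allowed_singleton, CoxeterSystem.wordProd_singleton]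
      exact ⟨⟨⟨p, by push_cast; ring⟩, (h.not_occ_iff p).2 hp'⟩, h3⟩
    · rw [CoxeterSystem.wordProd_append, act_mul, CoxeterSystem.wordProd_singleton, h4]

end periodic

/-! ### Cyclically decreasing words and strips -/

section words

variable {n : ℕ} [Fact (1 < n)] {i : ZMod n} {ω : List (ZMod n)}

theorem isCycDecWord_cons :
    IsCycDecWord (i :: ω) ↔ IsCycDecWord ω ∧ i ∉ ω ∧ i + 1 ∉ ω := by
  unfold IsCycDecWord
  rw [List.nodup_cons]
  constructor
  · rintro ⟨⟨h1, h2⟩, h3⟩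
    refine ⟨⟨h2, fun j hj hj' => ?_⟩, h1, fun h => ?_⟩
    · have := h3 j (List.mem_cons_of_mem _ hj) (List.mem_cons_of_mem _ hj')
      rw [List.idxOf_cons_ne _ (by rintro rfl; exact h1 hj'),
        List.idxOf_cons_ne _ (by rintro rfl; exact h1 hj)] at this
      omega
    · have := h3 i List.mem_cons_self (List.mem_cons_of_mem _ h)
      rw [List.idxOf_cons_self] at this
      omega
  · rintro ⟨⟨h2, h3⟩, h1, h4⟩
    refine ⟨⟨h1, h2⟩, fun j hj hj' => ?_⟩
    have hij : i = j → j + 1 ∉ i :: ω := by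
      rintro rfl h
      rcases List.mem_cons.1 h with h | h
      · simp at h
      · exact h4 h
    have hne : i ≠ j := fun h => hij h hj'
    rw [List.idxOf_cons_ne _ hne]
    by_cases h : i = j + 1
    · rw [h, List.idxOf_cons_self]; omega
    · rw [List.idxOf_cons_ne _ h]
      have := h3 j ((List.mem_cons.1 hj).resolve_left hne.symm)
        ((List.mem_cons.1 hj').resolve_left (Ne.symm h))
      omega

theorem isCycIncWord_cons :
    IsCycIncWord (i :: ω) ↔ IsCycIncWord ω ∧ i ∉ ω ∧ i - 1 ∉ ω := by
  unfold IsCycIncWord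
  rw [List.nodup_cons]
  constructor
  · rintro ⟨⟨h1, h2⟩, h3⟩
    refine ⟨⟨h2, fun j hj hj' => ?_⟩, h1, fun h => ?_⟩
    · have := h3 j (List.mem_cons_of_mem _ hj) (List.mem_cons_of_mem _ hj')
      rw [List.idxOf_cons_ne _ (by rintro rfl; exact h1 hj),
        List.idxOf_cons_ne _ (by rintro rfl; exact h1 hj')] at this
      omega
    · have := h3 (i - 1) (List.mem_cons_of_mem _ h) (by rw [sub_add_cancel]; exact List.mem_cons_self)
      rw [sub_add_cancel, List.idxOf_cons_self] at this
      omega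
  · rintro ⟨⟨h2, h3⟩, h1, h4⟩
    refine ⟨⟨h1, h2⟩, fun j hj hj' => ?_⟩
    have hne : i ≠ j + 1 := by
      rintro rfl
      rw [add_sub_cancel_right] at h4
      rcases List.mem_cons.1 hj with h | h
      · simp at h
      · exact h4 h
    rw [List.idxOf_cons_ne _ hne]
    by_cases h : i = j
    · rw [h, List.idxOf_cons_self]; omega
    · rw [List.idxOf_cons_ne _ h]
      have := h3 j ((List.mem_cons.1 hj).resolve_left (Ne.symm h))
        ((List.mem_cons.1 hj').resolve_left hne.symm)
      omega

end words

section strips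

variable {m n : ℕ} {b : ℤ → ℤ}

theorem IsPeriodicInj.exists_finset_occ (hm : 0 < m) (h : IsPeriodicInj m n b) :
    ∃ S : Finset (ZMod n), S.card = m ∧ ∀ j, j ∈ S ↔ Occ b j := by
  refine ⟨(Finset.range m).image fun q : ℕ => (b (q + 1) : ZMod n), ?_, fun j => ?_⟩
  · rw [Finset.card_image_of_injOn, Finset.card_range]
    intro p hp q hq hpq
    exact h.eq_of_mem_range (Finset.mem_range.1 hp) (Finset.mem_range.1 hq) hpq
  · rw [Finset.mem_image]
    constructor
    · rintro ⟨q, -, hq⟩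
      exact ⟨_, hq⟩
    · intro ho
      obtain ⟨q, hq, hqj⟩ := ho.exists_mem_range hm h.periodic
      exact ⟨q, Finset.mem_range.2 hq, hqj⟩

variable [Fact (1 < n)] {ω : List (ZMod n)}

/-- The word of a sequence of moves is cyclically decreasing exactly if no particle reaches the
initial position of the next one, that is, if the added boxes form a horizontal strip. -/
theorem Allowed.isCycDecWord_iff (h : IsConf m n b) (hω : Allowed ω b) :
    IsCycDecWord ω ↔ ∀ k, act ((affSys n).wordProd ω) b k < b (k - 1) := by
  induction ω with
  | nil =>
    simp only [CoxeterSystem.wordProd_nil, act_one]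
    exact ⟨fun _ k => h.anti (by omega), fun _ => ⟨List.nodup_nil, by simp⟩⟩
  | cons i ω ih =>
    have hper := (h.isPeriodicInj.act_wordProd ω).periodic
    have hstep := act_simple_of_occ hω.2.2
    rw [isCycDecWord_cons, ih hω.1, act_cons]
    constructor
    · rintro ⟨h1, -, h3⟩ k
      have h1k := h1 k
      rcases hstep k with h4 | h4
      · omega
      · by_contra hc
        have h5 : b (k - 1) = act ((affSys n).wordProd ω) b k + 1 := by omega
        have h6 : (b (k - 1) : ZMod n) = i := by rw [h5]; push_cast; rw [h4.2]; ring
        have h7 : b (k - 1) ≤ act ((affSys n).wordProd ω) b (k - 1) := hω.1.le_act (k - 1)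
        have h8 : b (k - 1) ≠ act ((affSys n).wordProd ω) b (k - 1) := fun h9 =>
          hω.2.2 ⟨k - 1, by rw [← h9, h6]⟩
        exact h3 (hω.1.mem_iff.2 ⟨k - 1, b (k - 1) + 1, by omega, by omega, by push_cast; rw [h6]⟩)
    · intro h1
      have h2 (k) : act ((affSys n).wordProd ω) b k < b (k - 1) :=
        lt_of_le_of_lt (le_act_simple hω.2.2 k) (h1 k)
      -- A particle `p` that has passed `c`, where `c` or `c - 1` is the new position of `q`.
      have key (c : ℤ) (p : ℤ) (hc : b p < c) (hc' : c ≤ act ((affSys n).wordProd ω) b p) (d : ℤ)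
          (hd : (d : ZMod n) = i) (hdc : d = c ∨ d = c - 1) : False := by
        obtain ⟨q, hq⟩ : ∃ q, act ((affSys n).wordProd ω) b q = d - 1 := by
          refine Occ.exists_eq hper ?_
          have := hω.2.1
          push_cast
          rwa [hd]
        have h3 := h1 q
        rw [act_simple, affSwap_of_eq_sub_one (by rw [hq]; push_cast; rw [hd]), hq] at h3
        have h4 : p < q := (hω.1.isConf h).anti.lt_iff_gt.1 (by omega)
        have h5 := h.anti.antitone (show p ≤ q - 1 by omega)
        omega
      refine ⟨h2, fun h3 => ?_, fun h3 => ?_⟩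
      · obtain ⟨p, c, hc, hc', hci⟩ := hω.1.mem_iff.1 h3
        exact key c p hc hc' c hci (Or.inl rfl)
      · obtain ⟨p, c, hc, hc', hci⟩ := hω.1.mem_iff.1 h3
        exact key c p hc hc' (c - 1) (by push_cast; rw [hci]; ring) (Or.inr rfl)

/-- If every particle moves at most once, then the word of the moves is cyclically increasing. -/
theorem Allowed.isCycIncWord (h : IsConf m n b) (hω : Allowed ω b)
    (hs : ∀ k, act ((affSys n).wordProd ω) b k ≤ b k + 1) : IsCycIncWord ω := by
  induction ω with
  | nil => exact ⟨List.nodup_nil, by simp⟩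
  | cons i ω ih =>
    have hper := (h.isPeriodicInj.act_wordProd ω).periodic
    rw [act_cons] at hs
    have h2 (k) : act ((affSys n).wordProd ω) b k ≤ b k + 1 :=
      (le_act_simple hω.2.2 k).trans (hs k)
    rw [isCycIncWord_cons]
    refine ⟨ih hω.1 h2, fun h3 => ?_, fun h3 => ?_⟩
    · obtain ⟨p, c, hc, hc', hci⟩ := hω.1.mem_iff.1 h3
      have h4 : act ((affSys n).wordProd ω) b p = c := le_antisymm (by have := h2 p; omega) hc'
      exact hω.2.2 ⟨p, by rw [h4, hci]⟩
    · obtain ⟨p, c, hc, hc', hci⟩ := hω.1.mem_iff.1 h3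
      have h4 := h2 p
      have h5 := hs p
      have h6 : act ((affSys n).wordProd ω) b p = c := by omega
      rw [act_simple, affSwap_of_eq_sub_one (by rw [h6, hci])] at h5
      omega

theorem occ_act_simple_iff {i j : ZMod n} (h₁ : j ≠ i - 1) (h₂ : j ≠ i) :
    Occ (act ((affSys n).simple i) b) j ↔ Occ b j := by
  have key (b : ℤ → ℤ) (h : Occ b j) : Occ (act ((affSys n).simple i) b) j := by
    obtain ⟨p, hp⟩ := h
    refine ⟨p, ?_⟩
    rw [act_simple, affSwap_of_ne (by rwa [hp]) (by rwa [hp]), hp]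
  exact ⟨fun h => by simpa only [act_simple_act_simple] using key _ h, key b⟩

theorem occ_act_simple_sub_one (i : ZMod n) :
    Occ (act ((affSys n).simple i) b) (i - 1) ↔ Occ b i := by
  constructor
  · rintro ⟨p, hp⟩
    refine ⟨p, ?_⟩
    rw [← affSwap_affSwap i (b p), ← act_simple i b p, affSwap_of_eq_sub_one hp]
    push_cast
    rw [hp, sub_add_cancel]
  · rintro ⟨p, hp⟩
    refine ⟨p, ?_⟩
    rw [act_simple, affSwap_of_eq hp]
    push_cast
    rw [hp]

theorem occ_act_simple_self (i : ZMod n) :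
    Occ (act ((affSys n).simple i) b) i ↔ Occ b (i - 1) := by
  rw [← occ_act_simple_sub_one, act_simple_act_simple]

theorem occ_act_wordProd_iff {j : ZMod n} (h₁ : j ∉ ω) (h₂ : j + 1 ∉ ω) :
    Occ (act ((affSys n).wordProd ω) b) j ↔ Occ b j := by
  induction ω with
  | nil => rw [CoxeterSystem.wordProd_nil, act_one]
  | cons i ω ih =>
    rw [List.mem_cons, not_or] at h₁ h₂
    rw [act_cons, occ_act_simple_iff (fun h => h₂.1 (by rw [h, sub_add_cancel])) h₁.1, ih h₁.2 h₂.2]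

theorem Allowed.not_occ_of_isCycDecWord (hω : Allowed ω b) (hd : IsCycDecWord ω) {j : ZMod n}
    (hj : j ∈ ω) : ¬ Occ b j := by
  induction ω with
  | nil => simp at hj
  | cons i ω ih =>
    rw [isCycDecWord_cons] at hd
    rcases List.mem_cons.1 hj with rfl | hj
    · rw [← occ_act_wordProd_iff hd.2.1 hd.2.2]; exact hω.2.2
    · exact ih hω.1 hd.1 hj

theorem Allowed.occ_of_isCycIncWord (hω : Allowed ω b) (hd : IsCycIncWord ω) {j : ZMod n}
    (hj : j ∈ ω) : Occ b (j - 1) := by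
  induction ω with
  | nil => simp at hj
  | cons i ω ih =>
    rw [isCycIncWord_cons] at hd
    rcases List.mem_cons.1 hj with rfl | hj
    · rw [← occ_act_wordProd_iff hd.2.2 (by rw [sub_add_cancel]; exact hd.2.1)]; exact hω.2.1
    · exact ih hω.1 hd.1 hj

theorem Allowed.card_add_le_of_isCycDecWord (hm : 0 < m) (h : IsPeriodicInj m n b)
    (hω : Allowed ω b) (hd : IsCycDecWord ω) : ω.toFinset.card + m ≤ n := by
  have : NeZero n := ⟨by have := (Fact.out : 1 < n); omega⟩
  obtain ⟨S, hS, hS'⟩ := h.exists_finset_occ hm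
  rw [← hS, ← Finset.card_union_of_disjoint]
  · exact (Finset.card_le_univ _).trans_eq (ZMod.card n)
  · rw [Finset.disjoint_left]
    intro j hj hjS
    exact hω.not_occ_of_isCycDecWord hd (List.mem_toFinset.1 hj) ((hS' j).1 hjS)

theorem Allowed.card_le_of_isCycIncWord (hm : 0 < m) (h : IsPeriodicInj m n b)
    (hω : Allowed ω b) (hd : IsCycIncWord ω) : ω.toFinset.card ≤ m := by
  obtain ⟨S, hS, hS'⟩ := h.exists_finset_occ hm
  rw [← hS]
  refine Finset.card_le_card_of_injOn (fun j => j - 1) (fun j hj => ?_)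
    (fun _ _ _ _ h => sub_left_injective h)
  exact (hS' _).2 (hω.occ_of_isCycIncWord hd (List.mem_toFinset.1 hj))

end strips

/-! ### Words with the same effect on a configuration -/

section diamond

variable {m n : ℕ} {b : ℤ → ℤ}

theorem IsConf.min {b' : ℤ → ℤ} (h : IsConf m n b) (h' : IsConf m n b') :
    IsConf m n fun k => min (b k) (b' k) := by
  refine ⟨fun k l hkl => ?_, fun k => ?_⟩
  · have h1 := h.anti hkl
    have h2 := h'.anti hkl
    change Min.min (b l) (b' l) < Min.min (b k) (b' k)
    omega
  · have h1 := h.periodic k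
    have h2 := h'.periodic k
    change Min.min (b (k + m)) (b' (k + m)) = Min.min (b k) (b' k) - (n : ℤ)
    omega

variable [Fact (1 < n)]

theorem act_simple_min {i j : ZMod n} (hij : i ≠ j) (hi' : ¬ Occ b (i - 1))
    (hj : Occ b j) (hj' : ¬ Occ b (j - 1)) :
    act ((affSys n).simple j) (fun k => min (act ((affSys n).simple i) b k)
      (act ((affSys n).simple j) b k)) = act ((affSys n).simple i) b ∧
    Allowed [j] (fun k => min (act ((affSys n).simple i) b k)
      (act ((affSys n).simple j) b k)) := by
  have e : i - 1 ≠ j := fun h => hi' (by rwa [h])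
  have e' : j - 1 ≠ j := fun h => one_ne_zero (sub_eq_self.1 h)
  have e2 : i - 1 ≠ j - 1 := fun h => hij (sub_left_inj.1 h)
  have hc (k) : (min (affSwap i (b k)) (affSwap j (b k)) = b k - 1 ∧ affSwap i (b k) = b k - 1 ∧
      (b k : ZMod n) = i) ∨ (min (affSwap i (b k)) (affSwap j (b k)) = b k - 1 ∧
        affSwap i (b k) = b k ∧ (b k : ZMod n) = j) ∨
        (min (affSwap i (b k)) (affSwap j (b k)) = b k ∧ affSwap i (b k) = b k ∧
          (b k : ZMod n) ≠ j - 1 ∧ (b k : ZMod n) ≠ j) := by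
    have h1 : (b k : ZMod n) ≠ i - 1 := fun h => hi' ⟨k, h⟩
    have h2 : (b k : ZMod n) ≠ j - 1 := fun h => hj' ⟨k, h⟩
    by_cases h3 : (b k : ZMod n) = i
    · left
      rw [affSwap_of_eq h3, affSwap_of_ne (i := j) h2 (by rwa [h3])]
      exact ⟨by omega, by omega, h3⟩
    right
    rw [affSwap_of_ne h1 h3]
    by_cases h4 : (b k : ZMod n) = j
    · left
      rw [affSwap_of_eq h4]
      exact ⟨by omega, rfl, h4⟩
    · right
      rw [affSwap_of_ne h2 h4]
      exact ⟨by omega, rfl, h2, h4⟩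
  constructor
  · funext k
    simp only [act_simple]
    rcases hc k with ⟨h1, h2, h3⟩ | ⟨h1, h2, h3⟩ | ⟨h1, h2, h3, h4⟩
    · rw [h1, h2, affSwap_of_ne]
      · push_cast; rwa [h3]
      · push_cast; rwa [h3]
    · rw [h1, h2, affSwap_of_eq_sub_one]
      · ring
      · push_cast; rw [h3]
    · rw [h1, h2, affSwap_of_ne h3 h4]
  · rw [allowed_singleton]
    constructor
    · obtain ⟨p, hp⟩ := hj
      refine ⟨p, ?_⟩
      simp only [act_simple]
      rcases hc p with ⟨h1, h2, h3⟩ | ⟨h1, h2, h3⟩ | ⟨h1, h2, h3, h4⟩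
      · exact absurd (h3.symm.trans hp) hij
      · rw [h1]; push_cast; rw [h3]
      · exact absurd hp h4
    · rintro ⟨p, hp⟩
      simp only [act_simple] at hp
      rcases hc p with ⟨h1, h2, h3⟩ | ⟨h1, h2, h3⟩ | ⟨h1, h2, h3, h4⟩
      · rw [h1] at hp; push_cast at hp; rw [h3] at hp; exact e hp
      · rw [h1] at hp; push_cast at hp; rw [h3] at hp; exact e' hp
      · rw [h1] at hp; exact h4 hp

/-- Two sequences of moves between the same configurations have the same product. The last moves of
the two sequences are equal or commute, and in the second case both sequences can be
rearranged to continue a common one. -/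
theorem Allowed.wordProd_eq (hm : 0 < m) (hmn : m < n) (h : IsConf m n b)
    {ω ω' : List (ZMod n)} (hω : Allowed ω b) (hω' : Allowed ω' b)
    (he : act ((affSys n).wordProd ω) b = act ((affSys n).wordProd ω') b) :
    (affSys n).wordProd ω = (affSys n).wordProd ω' := by
  induction hN : ω.length generalizing ω ω' with
  | zero =>
    have h1 := hω.charge_eq hm h.isPeriodicInj
    have h2 := hω'.charge_eq hm h.isPeriodicInj
    rw [he] at h1
    rw [List.length_eq_zero_iff.1 hN, List.length_eq_zero_iff.1 (show ω'.length = 0 by omega)]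
  | succ N ih =>
    have hlen : ω'.length = ω.length := by
      have h1 := hω.charge_eq hm h.isPeriodicInj
      have h2 := hω'.charge_eq hm h.isPeriodicInj
      rw [he] at h1
      omega
    obtain ⟨i, α, rfl⟩ := List.exists_cons_of_length_eq_add_one hN
    obtain ⟨j, β, rfl⟩ := List.exists_cons_of_length_eq_add_one (hlen.trans hN)
    rw [List.length_cons] at hN
    rw [List.length_cons, List.length_cons] at hlen
    rw [act_cons, act_cons] at he
    rw [CoxeterSystem.wordProd_cons, CoxeterSystem.wordProd_cons]
    set c := act ((affSys n).simple i) (act ((affSys n).wordProd α) b) with hc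
    have hα : act ((affSys n).wordProd α) b = act ((affSys n).simple i) c := by
      rw [hc, act_simple_act_simple]
    have hβ : act ((affSys n).wordProd β) b = act ((affSys n).simple j) c := by
      rw [he, act_simple_act_simple]
    by_cases hij : i = j
    · rw [← hij] at hβ ⊢
      rw [ih hω.1 hω'.1 (hα.trans hβ.symm) (by omega)]
    have hα1 := hω.2.1
    have hα2 := hω.2.2
    have hβ1 := hω'.2.1
    have hβ2 := hω'.2.2
    rw [hα, occ_act_simple_sub_one] at hα1
    rw [hα, occ_act_simple_self] at hα2
    rw [hβ, occ_act_simple_sub_one] at hβ1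
    rw [hβ, occ_act_simple_self] at hβ2
    obtain ⟨e1, a1⟩ := act_simple_min hij hα2 hβ1 hβ2
    obtain ⟨e2, a2⟩ := act_simple_min (Ne.symm hij) hβ2 hα1 hα2
    simp only [min_comm (act ((affSys n).simple j) c _)] at e2 a2
    set d : ℤ → ℤ := fun k => min (act ((affSys n).simple i) c k) (act ((affSys n).simple j) c k)
    have hd : IsConf m n d := by
      have h1 := hω.1.isConf h
      have h2 := hω'.1.isConf h
      rw [hα] at h1
      rw [hβ] at h2
      exact h1.min h2
    have hbd : b ≤ d := by
      have h1 := hω.1.le_act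
      have h2 := hω'.1.le_act
      rw [hα] at h1
      rw [hβ] at h2
      exact fun k => le_min (h1 k) (h2 k)
    obtain ⟨γ, hγ, hγd⟩ := exists_allowed hm hmn h hd hbd
    have hjγ : Allowed (j :: γ) b := by
      rw [← List.singleton_append, allowed_append, hγd]; exact ⟨hγ, a1⟩
    have hiγ : Allowed (i :: γ) b := by
      rw [← List.singleton_append, allowed_append, hγd]; exact ⟨hγ, a2⟩
    rw [ih hω.1 hjγ (by rw [act_cons, hγd, e1, hα]) (by omega),
      ← ih hiγ hω'.1 (by rw [act_cons, hγd, e2, hβ]) ?_, CoxeterSystem.wordProd_cons,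
      CoxeterSystem.wordProd_cons, ← mul_assoc, ← mul_assoc, simple_mul_simple_comm]
    · rintro rfl
      rw [add_sub_cancel_right] at hβ2
      exact hβ2 hα1
    · rintro rfl
      rw [add_sub_cancel_right] at hα2
      exact hα2 hβ1
    · have h1 := hω'.1.charge_eq hm h.isPeriodicInj
      have h2 := hiγ.charge_eq hm h.isPeriodicInj
      rw [act_cons, hγd, e2, ← hβ] at h2
      omega

end diamond

/-! ### The ground state -/

/-- The configuration of the empty shape `∅[0]`. -/
def ground (m n : ℕ) (k : ℤ) : ℤ := -((n : ℤ) - m) * ((k - 1) / m) - k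

theorem ground_of_mem {m n : ℕ} {p : ℤ} (h₁ : 1 ≤ p) (h₂ : p ≤ m) : ground m n p = -p := by
  rw [ground, Int.ediv_eq_zero_of_lt (by omega) (by omega)]
  ring

theorem isConf_ground {m n : ℕ} (hm : 0 < m) (hmn : m < n) : IsConf m n (ground m n) := by
  refine ⟨fun k l hkl => ?_, fun k => ?_⟩
  · have h1 : (k - 1) / (m : ℤ) ≤ (l - 1) / m := Int.ediv_le_ediv (by omega) (by omega)
    have h2 := mul_le_mul_of_nonneg_left h1 (show 0 ≤ (n : ℤ) - m by omega)
    simp only [ground]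
    linarith
  · have h1 : (k + m - 1) / (m : ℤ) = (k - 1) / m + 1 := by
      rw [show k + m - 1 = k - 1 + m * 1 by ring, Int.add_mul_ediv_left _ _ (by omega)]
    simp only [ground, h1]
    ring

theorem IsConf.shift {m n : ℕ} {b : ℤ → ℤ} (h : IsConf m n b) (c d : ℤ) :
    IsConf m n fun k => b (k + c) + d := by
  refine ⟨fun k l hkl => ?_, fun k => ?_⟩
  · have := h.anti (show k + c < l + c by omega)
    change b (l + c) + d < b (k + c) + d
    omega
  · have := h.periodic (k + c)
    rw [add_right_comm] at this
    change b (k + m + c) + d = b (k + c) + d - (n : ℤ)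
    omega

theorem IsConf.le_sub {m n : ℕ} {b : ℤ → ℤ} (h : IsConf m n b) {k l : ℤ} (hkl : k ≤ l) :
    b l ≤ b k - (l - k) := by
  obtain ⟨t, ht⟩ := Int.eq_ofNat_of_zero_le (sub_nonneg.2 hkl)
  obtain rfl : l = k + t := by omega
  clear hkl ht
  induction t with
  | zero => simp
  | succ t ih =>
    have := h.anti (show k + (t : ℤ) < k + (t + 1 : ℕ) by push_cast; omega)
    push_cast at this ⊢
    omega

theorem IsConf.le_add_one {m n : ℕ} {b : ℤ → ℤ} (hm : 0 < m) (h : IsConf m n b) (p : ℤ) :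
    b p ≤ b (p + 1) + n := by
  have h1 := h.periodic (p + 1 - m)
  rw [sub_add_cancel] at h1
  have h2 := h.anti.antitone (show p + 1 - m ≤ p by omega)
  omega

theorem IsConf.exists_gap {m n : ℕ} {b : ℤ → ℤ} (h : IsConf m n b) (z : ℤ) :
    ∃ p, z < b p ∧ b (p + 1) ≤ z := by
  obtain ⟨p, hp, hp'⟩ := Int.exists_greatest_of_bdd (P := fun k => z < b k)
    ⟨max 0 (b 0 - z), fun k hk => by
      by_contra hc
      have := h.le_sub (show 0 ≤ k by omega)
      omega⟩
    ⟨-max 0 (z + 1 - b 0), by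
      have := h.le_sub (show -max 0 (z + 1 - b 0) ≤ 0 by omega)
      omega⟩
  refine ⟨p, hp, ?_⟩
  by_contra hc
  have := hp' (p + 1) (by omega)
  omega

theorem le_of_periodic {m n : ℕ} {b b' : ℤ → ℤ} (hm : 0 < m) (h : ∀ k, b (k + m) = b k - n)
    (h' : ∀ k, b' (k + m) = b' k - n) (p : ℤ) (hle : ∀ k, p ≤ k → k < p + m → b k ≤ b' k) :
    b ≤ b' := by
  intro k
  obtain ⟨q, hq, t, ht⟩ := exists_eq_add_mul_of_pos hm (k - p + 1)
  obtain rfl : k = p + q + m * t := by omega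
  have := hle (p + q) (by omega) (by omega)
  rw [periodic_mul h, periodic_mul h']
  exact sub_le_sub_right this _

section occ

variable {m n : ℕ} {i : ZMod n}

theorem zmod_ne_of_between {z c : ℤ} (h : z + 1 < c) (h' : c < z - 1 + n) :
    (c : ZMod n) ≠ z - 1 ∧ (c : ZMod n) ≠ z ∧ (c : ZMod n) ≠ z + 1 := by
  have h1 := intCast_zmod_ne (n := n) (z := z - 1) (w := c) (by omega) (by omega)
  have h2 := intCast_zmod_ne (n := n) (z := z) (w := c) (by omega) (by omega)
  have h3 := intCast_zmod_ne (n := n) (z := z + 1) (w := c) (by omega) (by omega)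
  push_cast at h1 h3
  exact ⟨h1.symm, h2.symm, h3.symm⟩

theorem zmod_ne_of_between' {z c : ℤ} (h : z + 1 < c + n) (h' : c < z - 1) :
    (c : ZMod n) ≠ z - 1 ∧ (c : ZMod n) ≠ z ∧ (c : ZMod n) ≠ z + 1 := by
  have := zmod_ne_of_between (n := n) (z := z) (c := c + n) h (by omega)
  simpa using this

theorem eq_zero_of_occ_ground (hm : 0 < m) (hmn : m < n) (h₁ : Occ (ground m n) (i - 1))
    (h₂ : ¬ Occ (ground m n) i) : i = 0 := by
  obtain ⟨q, hq, hqi⟩ := h₁.exists_mem_range hm (isConf_ground hm hmn).periodic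
  rw [ground_of_mem (by omega) (by omega)] at hqi
  obtain rfl : i = -(q : ℤ) := by
    push_cast at hqi ⊢
    linear_combination -hqi
  rcases Nat.eq_zero_or_pos q with rfl | hq0
  · simp
  · exact absurd ⟨q, by rw [ground_of_mem (by omega) (by omega)]; push_cast; ring⟩ h₂

end occ

/-! ### Elements that raise the ground state -/

section raising

variable {m n : ℕ}

theorem isReduced_append_right {α β : List (ZMod n)} (h : (affSys n).IsReduced (α ++ β)) :
    (affSys n).IsReduced β := by
  simpa using h.drop α.length

theorem isReduced_append_left {α β : List (ZMod n)} (h : (affSys n).IsReduced (α ++ β)) :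
    (affSys n).IsReduced α := by
  simpa using h.take α.length

theorem isReduced_append_of_length_eq {α β : List (ZMod n)} (hα : (affSys n).IsReduced α)
    (hβ : (affSys n).IsReduced β) (h : (affSys n).length ((affSys n).wordProd α *
      (affSys n).wordProd β) = (affSys n).length ((affSys n).wordProd α) +
      (affSys n).length ((affSys n).wordProd β)) : (affSys n).IsReduced (α ++ β) := by
  rw [CoxeterSystem.IsReduced, CoxeterSystem.wordProd_append, h, hα.eq, hβ.eq, List.length_append]

theorem simple_mul_wordProd_comm {i : ZMod n} {α : List (ZMod n)}
    (h : ∀ j ∈ α, j ≠ i - 1 ∧ j ≠ i ∧ j ≠ i + 1) :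
    (affSys n).simple i * (affSys n).wordProd α = (affSys n).wordProd α * (affSys n).simple i := by
  induction α with
  | nil => simp
  | cons j α ih =>
    have h1 := h j List.mem_cons_self
    rw [CoxeterSystem.wordProd_cons, ← mul_assoc, simple_mul_simple_comm h1.2.2
      (by rintro rfl; exact h1.1 (by ring)), mul_assoc, ih fun k hk => h k (List.mem_cons_of_mem _ hk),
      mul_assoc]

theorem length_append_of_isReduced {α β : List (ZMod n)} (h : (affSys n).IsReduced (α ++ β)) :
    (affSys n).length ((affSys n).wordProd (α ++ β)) = (affSys n).length ((affSys n).wordProd α) +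
      (affSys n).length ((affSys n).wordProd β) := by
  rw [h.eq, (isReduced_append_left h).eq, (isReduced_append_right h).eq, List.length_append]

theorem eq_zero_of_comm {ω : List (ZMod n)} {i : ZMod n} (hr : (affSys n).IsReduced (i :: ω))
    (hG : IsZeroGrassmannian ((affSys n).wordProd (i :: ω)))
    (h : ∀ j ∈ ω, j ≠ i - 1 ∧ j ≠ i ∧ j ≠ i + 1) : i = 0 := by
  have h1 : (affSys n).wordProd (ω ++ [i]) = (affSys n).wordProd (i :: ω) := by
    rw [CoxeterSystem.wordProd_append, CoxeterSystem.wordProd_singleton,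
      CoxeterSystem.wordProd_cons, simple_mul_wordProd_comm h]
  refine hG ω i ?_ h1
  rw [CoxeterSystem.IsReduced, h1, hr.eq]
  simp

variable [Fact (1 < n)]

/-- Some word of `w` only moves particles to empty places when applied to the ground state, in other
words, `A_w` does not annihilate the empty shape. -/
def IsRaising (m : ℕ) (w : AffSym n) : Prop :=
  ∃ ω : List (ZMod n), Allowed ω (ground m n) ∧ (affSys n).wordProd ω = w

theorem le_maxr {w v d : AffSym n} {J : Finset (ZMod n)} (hd : IsCycDecOn J d) (hw : w = v * d)
    (hl : (affSys n).length w = (affSys n).length v + (affSys n).length d) : J.card ≤ maxr w := by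
  have : NeZero n := ⟨by have := (Fact.out : 1 < n); omega⟩
  refine le_csSup ⟨n, ?_⟩ ⟨J, v, d, hd, hw, hl, rfl⟩
  rintro k ⟨J, -, -, -, -, -, rfl⟩
  exact (Finset.card_le_univ _).trans_eq (ZMod.card n)

theorem le_maxc {w v d : AffSym n} {J : Finset (ZMod n)} (hd : IsCycIncOn J d) (hw : w = v * d)
    (hl : (affSys n).length w = (affSys n).length v + (affSys n).length d) : J.card ≤ maxc w := by
  have : NeZero n := ⟨by have := (Fact.out : 1 < n); omega⟩
  refine le_csSup ⟨n, ?_⟩ ⟨J, v, d, hd, hw, hl, rfl⟩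
  rintro k ⟨J, -, -, -, -, -, rfl⟩
  exact (Finset.card_le_univ _).trans_eq (ZMod.card n)

theorem length_le_maxr {α δ : List (ZMod n)} (hr : (affSys n).IsReduced (α ++ δ))
    (hd : IsCycDecWord δ) : δ.length ≤ maxr ((affSys n).wordProd (α ++ δ)) := by
  rw [← List.toFinset_card_of_nodup hd.1]
  exact le_maxr ⟨δ, hd, rfl, rfl⟩ (CoxeterSystem.wordProd_append _ _ _)
    (length_append_of_isReduced hr)

theorem length_le_maxc {α δ : List (ZMod n)} (hr : (affSys n).IsReduced (α ++ δ))
    (hd : IsCycIncWord δ) : δ.length ≤ maxc ((affSys n).wordProd (α ++ δ)) := by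
  rw [← List.toFinset_card_of_nodup hd.1]
  exact le_maxc ⟨δ, hd, rfl, rfl⟩ (CoxeterSystem.wordProd_append _ _ _)
    (length_append_of_isReduced hr)

/-- The set `grassSet m n` is closed under passing to right factors of reduced products. -/
theorem mem_grassSet_of_mul {u v : AffSym n} (h : u * v ∈ grassSet m n)
    (hl : (affSys n).length (u * v) = (affSys n).length u + (affSys n).length v) :
    v ∈ grassSet m n := by
  obtain ⟨hG, h3, hc, hr⟩ := h
  obtain ⟨α, hα, rfl⟩ := (affSys n).exists_isReduced u
  have hred {ω : List (ZMod n)} (hω : (affSys n).IsReduced ω) (hv : (affSys n).wordProd ω = v) :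
      (affSys n).IsReduced (α ++ ω) := isReduced_append_of_length_eq hα hω (by rwa [hv])
  have hlen {v' d : AffSym n} (hv : v = v' * d)
      (hl' : (affSys n).length v = (affSys n).length v' + (affSys n).length d) :
      (affSys n).length ((affSys n).wordProd α * v) =
        (affSys n).length ((affSys n).wordProd α * v') + (affSys n).length d := by
    have h1 := (affSys n).length_mul_le ((affSys n).wordProd α) v'
    have h2 := (affSys n).length_mul_le ((affSys n).wordProd α * v') d
    rw [mul_assoc, ← hv] at h2
    omega
  refine ⟨fun ω i hω hv => ?_, fun ω hω hv i hn hi => ?_, ?_, ?_⟩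
  · refine hG (α ++ ω) i ?_ ?_
    · rw [List.append_assoc]; exact hred hω hv
    · rw [List.append_assoc, CoxeterSystem.wordProd_append, hv]
  · refine h3 (α ++ ω) (hred hω hv) ?_ i hn (hi.trans (List.suffix_append _ _).isInfix)
    rw [CoxeterSystem.wordProd_append, hv]
  · refine (csSup_le' ?_ : maxc v ≤ m)
    rintro k ⟨J, v', d, hd, hv, hl', rfl⟩
    exact (le_maxc hd (by rw [hv, mul_assoc]) (hlen hv hl')).trans hc
  · refine (csSup_le' ?_ : maxr v ≤ n - m)
    rintro k ⟨J, v', d, hd, hv, hl', rfl⟩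
    exact (le_maxr hd (by rw [hv, mul_assoc]) (hlen hv hl')).trans hr

theorem IsRaising.allowed (hm : 0 < m) (hmn : m < n) {ω : List (ZMod n)}
    (h : IsRaising m ((affSys n).wordProd ω)) (hr : (affSys n).IsReduced ω) :
    Allowed ω (ground m n) := by
  obtain ⟨ω', h1, h2⟩ := h
  exact h1.of_isReduced hm (isConf_ground hm hmn).isPeriodicInj hr h2.symm

theorem not_allowed_triple (h3 : 3 ≤ n) {b : ℤ → ℤ} (i : ZMod n) : ¬ Allowed [i, i + 1, i] b := by
  intro h
  have h1 : (1 : ZMod n) ≠ 0 := one_ne_zero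
  have h2 : (2 : ZMod n) ≠ 0 := by
    have := intCast_zmod_ne (n := n) (z := 0) (w := 2) (by norm_num) (by omega)
    simpa using this.symm
  have ho := h.2.1
  rw [act_cons, occ_act_simple_iff (by simp) (fun h => h2 (by linear_combination -h)),
    act_cons, occ_act_simple_sub_one, CoxeterSystem.wordProd_nil, act_one] at ho
  have ho' := h.1.2.2
  have h4 := h.1.1.2.2
  rw [CoxeterSystem.wordProd_nil, act_one] at h4
  exact h4 ho

theorem IsRaising.mem_grassSet (hm : 0 < m) (hmn : m < n) {w : AffSym n} (h : IsRaising m w) :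
    w ∈ grassSet m n := by
  have hg := isConf_ground hm hmn
  refine ⟨fun ω i hω hw => ?_, fun ω hω hw i hn hi => ?_, ?_, ?_⟩
  · have h1 := IsRaising.allowed hm hmn (hw ▸ h) hω
    rw [allowed_append, allowed_singleton] at h1
    exact eq_zero_of_occ_ground hm hmn h1.1.1 h1.1.2
  · have h1 := IsRaising.allowed hm hmn (hw ▸ h) hω
    obtain ⟨s, t, rfl⟩ := hi
    rw [allowed_append, allowed_append] at h1
    exact not_allowed_triple hn i h1.2.1
  · refine (csSup_le' ?_ : maxc w ≤ m)
    rintro k ⟨J, v, d, ⟨ω, hω, rfl, rfl⟩, rfl, hl, rfl⟩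
    obtain ⟨α, hα, rfl⟩ := (affSys n).exists_isReduced v
    rw [← CoxeterSystem.wordProd_append] at h
    have h1 := h.allowed hm hmn (isReduced_append_of_length_eq hα (isReduced_of_nodup hω.1) hl)
    exact (allowed_append.1 h1).1.card_le_of_isCycIncWord hm hg.isPeriodicInj hω
  · refine (csSup_le' ?_ : maxr w ≤ n - m)
    rintro k ⟨J, v, d, ⟨ω, hω, rfl, rfl⟩, rfl, hl, rfl⟩
    obtain ⟨α, hα, rfl⟩ := (affSys n).exists_isReduced v
    rw [← CoxeterSystem.wordProd_append] at h
    have h1 := h.allowed hm hmn (isReduced_append_of_length_eq hα (isReduced_of_nodup hω.1) hl)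
    have := (allowed_append.1 h1).1.card_add_le_of_isCycDecWord hm hg.isPeriodicInj hω
    omega

/-- A raising element can be built along any configuration between the ground state and its own. -/
theorem Allowed.exists_factor (hm : 0 < m) (hmn : m < n) {ω α : List (ZMod n)} {y : ℤ → ℤ}
    (hω : Allowed ω (ground m n)) (hy : IsConf m n y) (hgy : ground m n ≤ y)
    (hα : Allowed α y)
    (he : act ((affSys n).wordProd α) y = act ((affSys n).wordProd ω) (ground m n)) :
    ∃ β : List (ZMod n), Allowed β (ground m n) ∧
      act ((affSys n).wordProd β) (ground m n) = y ∧
      (affSys n).wordProd ω = (affSys n).wordProd α * (affSys n).wordProd β ∧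
      ω.length = α.length + β.length := by
  have hg := isConf_ground hm hmn
  obtain ⟨β, hβ, rfl⟩ := exists_allowed hm hmn hg hy hgy
  have hαβ : Allowed (α ++ β) (ground m n) := allowed_append.2 ⟨hβ, hα⟩
  have h1 : (affSys n).wordProd ω = (affSys n).wordProd (α ++ β) :=
    hω.wordProd_eq hm hmn hg hαβ (by rw [CoxeterSystem.wordProd_append, act_mul, he])
  refine ⟨β, hβ, rfl, by rw [h1, CoxeterSystem.wordProd_append], ?_⟩
  rw [← List.length_append, ← (hαβ.isReduced hm hg.isPeriodicInj).eq, ← h1,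
    (hω.isReduced hm hg.isPeriodicInj).eq]

end raising

/-! ### The elements of the Grassmannian set raise the ground configuration -/

section cases

variable {m n : ℕ}

/-- The right-hand side is the configuration in which the particles `p, …, p + m - 1` occupy the `m`
places directly below `z`. -/
theorem ground_le_corner (hm : 0 < m) (hmn : m < n) {p z : ℤ} (h : ground m n p ≤ z - 1) :
    ground m n ≤ fun k => ground m n (k + (1 - p)) + z := by
  have hg := isConf_ground hm hmn
  refine le_of_periodic hm hg.periodic (hg.shift _ _).periodic p fun k hk hk' => ?_
  rw [ground_of_mem (p := k + (1 - p)) (by omega) (by omega)]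
  have := hg.le_sub hk
  omega

variable [Fact (1 < n)] {i : ZMod n} {ω : List (ZMod n)} {b : ℤ → ℤ}

/-- A letter `i` of a reduced word cannot meet an empty class `i - 1` and an occupied class `i`: this
would lower the configuration, contrary to the length or to the Grassmannian property. -/
theorem false_of_not_occ_of_occ (hm : 0 < m) (hmn : m < n)
    (hr : (affSys n).IsReduced (i :: ω))
    (hG : IsZeroGrassmannian ((affSys n).wordProd (i :: ω)))
    (hω : Allowed ω (ground m n)) (hb : act ((affSys n).wordProd ω) (ground m n) = b)
    (h₁ : ¬ Occ b (i - 1)) (h₂ : Occ b i) : False := by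
  have hg := isConf_ground hm hmn
  have hbc : IsConf m n b := hb ▸ hω.isConf hg
  have hgb : ground m n ≤ b := hb ▸ hω.le_act
  obtain ⟨q, hq, hqi⟩ := h₂.exists_mem_range hm hbc.periodic
  obtain ⟨p, hp, hp1, hpm⟩ : ∃ p : ℤ, p = q + 1 ∧ 1 ≤ p ∧ p ≤ m := ⟨q + 1, rfl, by omega, by omega⟩
  rw [← hp] at hqi
  have hgp := ground_of_mem (n := n) hp1 hpm
  have hgbp : ground m n p ≤ b p := hgb p
  rcases hgbp.lt_or_eq with hlt | heq
  · -- The particle can move back, so that `s_i` shortens the word.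
    have hval (k) : act ((affSys n).simple i) b k = b k - 1 ∧ (b k : ZMod n) = i ∨
        act ((affSys n).simple i) b k = b k := by
      rw [act_simple]
      by_cases h : (b k : ZMod n) = i
      · exact Or.inl ⟨affSwap_of_eq h, h⟩
      · exact Or.inr (affSwap_of_ne (fun h' => h₁ ⟨k, h'⟩) h)
    have hyc : IsConf m n (act ((affSys n).simple i) b) := by
      refine ⟨fun k l hkl => ?_, (hbc.isPeriodicInj.act_simple i).periodic⟩
      have h0 := hbc.anti hkl
      rcases hval k with ⟨h3, h4⟩ | h3 <;> rcases hval l with ⟨h5, h6⟩ | h5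
      · omega
      · have : b l ≠ b k - 1 := fun h => h₁ ⟨l, by rw [h]; push_cast; rw [h4]⟩
        omega
      · omega
      · omega
    have hgy : ground m n ≤ act ((affSys n).simple i) b := by
      intro k
      have h3 : ground m n k ≤ b k := hgb k
      rcases hval k with ⟨h4, h5⟩ | h4
      · obtain ⟨t, rfl, ht⟩ := hbc.isPeriodicInj.eq_of_cast_eq (hqi.trans h5.symm)
        change ground m n (p + m * t) ≤ act ((affSys n).simple i) b (p + m * t)
        rw [h4, ht, periodic_mul hg.periodic]
        omega
      · change ground m n k ≤ act ((affSys n).simple i) b k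
        rwa [h4]
    obtain ⟨β, -, -, hβ, hlen⟩ := hω.exists_factor (α := [i]) hm hmn hyc hgy
      (by rw [allowed_singleton, occ_act_simple_sub_one, occ_act_simple_self]; exact ⟨h₂, h₁⟩)
      (by rw [CoxeterSystem.wordProd_singleton, act_simple_act_simple, hb])
    have h3 := hr.eq
    rw [CoxeterSystem.wordProd_cons, hβ, CoxeterSystem.wordProd_singleton,
      CoxeterSystem.simple_mul_simple_cancel_left] at h3
    have h4 := (affSys n).length_wordProd_le β
    simp only [List.length_cons, List.length_nil] at h3 hlen
    omega
  · -- The particle has not moved, and neither have its neighbours.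
    have hnext : b (p + 1) < b p - 1 := by
      have h3 := hbc.anti (show p < p + 1 by omega)
      have h4 : b (p + 1) ≠ b p - 1 := fun h => h₁ ⟨p + 1, by rw [h]; push_cast; rw [hqi]⟩
      omega
    have hpm' : p = m := by
      by_contra hne
      have h3 := ground_of_mem (n := n) (show 1 ≤ p + 1 by omega) (show p + 1 ≤ m by omega)
      have h4 : ground m n (p + 1) ≤ b (p + 1) := hgb (p + 1)
      omega
    have hb1 : b (p + 1) = b 1 - n := by rw [hpm', add_comm]; exact hbc.periodic 1
    have hi0 := eq_zero_of_comm hr hG fun j hj => by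
      obtain ⟨p', c, h3, h4, h5, h6, rfl⟩ := hω.exists_mem_range hm hg.isPeriodicInj hj
      rw [hb] at h6
      rw [ground_of_mem h3 h4] at h5
      have h7 := hbc.le_sub h3
      have : p' ≠ p := by rintro rfl; omega
      rw [← hqi]
      exact zmod_ne_of_between (by omega) (by omega)
    rw [hi0] at hqi
    have := intCast_zmod_ne (n := n) (z := b p) (w := 0) (by omega) (by omega)
    exact this (by simpa using hqi)

theorem allowed_singleton_of_step (hb : IsConf m n b) {p : ℤ} (hp : b (p - 1) ≠ b p + 1)
    {j : ZMod n} (hj : ((b p + 1 : ℤ) : ZMod n) = j) : Allowed [j] b := by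
  subst hj
  exact allowed_singleton.2 ⟨⟨p, by push_cast; ring⟩, (hb.not_occ_iff p).2 hp⟩

/-- If `w = s_i v` is reduced and `v = v' s_j s_i v''` where the letters of `v'` commute with `s_i`,
then `w` is not `321`-avoiding. -/
theorem false_of_triple {α β : List (ZMod n)} {j : ZMod n} (h3 : 3 ≤ n)
    (hr : (affSys n).IsReduced (i :: ω)) (hA : Is321Avoiding ((affSys n).wordProd (i :: ω)))
    (hα : ∀ j ∈ α, j ≠ i - 1 ∧ j ≠ i ∧ j ≠ i + 1)
    (he : (affSys n).wordProd ω = (affSys n).wordProd (α ++ [j, i]) * (affSys n).wordProd β)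
    (hl : ω.length = (α ++ [j, i]).length + β.length) (hj : j = i + 1 ∨ i = j + 1) : False := by
  have key {x y z : ZMod n} (hxyz : (affSys n).wordProd [i, j, i] = (affSys n).wordProd [x, y, z]) :
      (affSys n).IsReduced (α ++ [x, y, z] ++ β) ∧
      (affSys n).wordProd (α ++ [x, y, z] ++ β) = (affSys n).wordProd (i :: ω) := by
    have h1 : (affSys n).wordProd (α ++ [x, y, z] ++ β) = (affSys n).wordProd (i :: ω) := by
      rw [CoxeterSystem.wordProd_cons, he]
      simp only [CoxeterSystem.wordProd_append]
      rw [← mul_assoc, ← mul_assoc, simple_mul_wordProd_comm hα, ← hxyz,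
        CoxeterSystem.wordProd_cons _ i]
      simp only [mul_assoc]
    refine ⟨?_, h1⟩
    rw [CoxeterSystem.IsReduced, h1, hr.eq, List.length_cons, hl]
    simp
    omega
  rcases hj with rfl | rfl
  · obtain ⟨h1, h2⟩ := key rfl
    exact hA _ h1 h2 i h3 ⟨α, β, rfl⟩
  · obtain ⟨h1, h2⟩ := key (x := j) (y := j + 1) (z := j) (by
      have := simple_braid (n := n) (by omega) j
      simpa [CoxeterSystem.wordProd_cons, mul_assoc] using this.symm)
    exact hA _ h1 h2 j h3 ⟨α, β, rfl⟩

/-- A letter `i` of a reduced word of an element of `grassSet m n` cannot meet two empty classes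
`i - 1` and `i`: it would complete a factor `s_i s_j s_i`, or be a final letter
other than `0`, or extend a column of `m` boxes against the bound on `maxc`. -/
theorem false_of_not_occ_of_not_occ (hm : 0 < m) (hmn : m < n)
    (hr : (affSys n).IsReduced (i :: ω))
    (hG : (affSys n).wordProd (i :: ω) ∈ grassSet m n)
    (hω : Allowed ω (ground m n)) (hb : act ((affSys n).wordProd ω) (ground m n) = b)
    (h₁ : ¬ Occ b (i - 1)) (h₂ : ¬ Occ b i) : False := by
  have hg := isConf_ground hm hmn
  have hbc : IsConf m n b := hb ▸ hω.isConf hg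
  have hgb : ground m n ≤ b := hb ▸ hω.le_act
  obtain ⟨p, z, hp1, hpm, hzi, hzp, hzp'⟩ : ∃ p z : ℤ, 1 ≤ p ∧ p ≤ m ∧ (z : ZMod n) = i ∧
      z < b p ∧ b (p + 1) ≤ z := by
    obtain ⟨z, hz⟩ := ZMod.intCast_surjective i
    obtain ⟨p, hp, hp'⟩ := hbc.exists_gap z
    obtain ⟨q, hq, t, rfl⟩ := exists_eq_add_mul_of_pos hm p
    rw [add_right_comm, periodic_mul hbc.periodic] at hp'
    rw [periodic_mul hbc.periodic] at hp
    exact ⟨q + 1, z + n * t, by omega, by omega, by simpa using hz, by omega, by omega⟩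
  have hzp2 : b (p + 1) ≤ z - 2 := by
    have h3 : b (p + 1) ≠ z := fun h => h₂ ⟨_, by rw [h, hzi]⟩
    have h4 : b (p + 1) ≠ z - 1 := fun h => h₁ ⟨_, by rw [h]; push_cast; rw [hzi]⟩
    omega
  have hpn := hbc.le_add_one hm p
  have hn3 : 3 ≤ n := by omega
  have hgp := ground_of_mem (n := n) hp1 hpm
  by_cases hgz : ground m n p ≤ z - 1
  · -- The particle `p` has passed `z - 1`, `z` and `z + 1`.
    set y : ℤ → ℤ := fun k => min (b k) (ground m n (k + (1 - p)) + z) with hy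
    have hyc : IsConf m n y := hbc.min (hg.shift _ _)
    have hgy : ground m n ≤ y := fun k => le_min (hgb k) (ground_le_corner hm hmn hgz k)
    have hyb : y ≤ b := fun k => min_le_left _ _
    have hyp : y p = z - 1 := by
      simp only [hy]
      rw [show p + (1 - p) = 1 by ring, ground_of_mem le_rfl (by omega)]
      omega
    have hyk (k) (hk : p < k) (hk' : k < p + m) : y k = b k := by
      simp only [hy]
      rw [ground_of_mem (by omega) (by omega)]
      have := hbc.le_sub (show p + 1 ≤ k by omega)
      omega
    have hyprev : z + 1 < y (p - 1) := by
      have h3 := hyc.periodic (p - 1)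
      by_cases hm1 : m = 1
      · rw [hm1, Nat.cast_one, sub_add_cancel] at h3
        omega
      · rw [hyk _ (by omega) (by omega)] at h3
        have h4 := hbc.periodic (p - 1)
        have h5 := hbc.anti (show p - 1 < p by omega)
        omega
    have a1 : Allowed [i] y := allowed_singleton_of_step hyc (p := p) (by omega)
      (by rw [hyp, sub_add_cancel, hzi])
    have hy1c := a1.isConf hyc
    rw [CoxeterSystem.wordProd_singleton] at hy1c
    have hst := act_simple_of_occ (allowed_singleton.1 a1).2
    have hy1p : act ((affSys n).simple i) y p = z := by
      rw [act_simple, affSwap_of_eq_sub_one (by rw [hyp]; push_cast; rw [hzi]), hyp]; ring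
    have a2 : Allowed [i + 1] (act ((affSys n).simple i) y) := by
      refine allowed_singleton_of_step hy1c (p := p) ?_ ?_
      · rcases hst (p - 1) with h | h <;> omega
      · rw [hy1p]; push_cast; rw [hzi]
    have hst2 := act_simple_of_occ (allowed_singleton.1 a2).2
    have hy2p : act ((affSys n).simple (i + 1)) (act ((affSys n).simple i) y) p = z + 1 := by
      rw [act_simple, affSwap_of_eq_sub_one (by rw [hy1p, hzi]; ring), hy1p]
    have a12 : Allowed [i + 1, i] y := by
      rw [← List.singleton_append, allowed_append, CoxeterSystem.wordProd_singleton]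
      exact ⟨a1, a2⟩
    have e12 : act ((affSys n).wordProd [i + 1, i]) y =
        act ((affSys n).simple (i + 1)) (act ((affSys n).simple i) y) := by
      rw [act_cons, CoxeterSystem.wordProd_singleton]
    have hy2c := a12.isConf hyc
    have hy2k (k) (hk : p < k) (hk' : k < p + m) :
        act ((affSys n).wordProd [i + 1, i]) y k = b k := by
      have hbk := hyk k hk hk'
      have hbk' := hbc.le_sub (show p + 1 ≤ k by omega)
      have hbk2 : z - n + 1 < b k := by
        have h3 := hbc.anti (show k < p + m by omega)
        rw [hbc.periodic] at h3
        omega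
      have h1 : act ((affSys n).simple i) y k = b k := by
        rcases hst k with h | h
        · rw [h.1, hbk]
        · exfalso
          rw [hbk] at h
          exact h₁ ⟨k, h.2⟩
      rw [e12]
      rcases hst2 k with h | h
      · rw [h.1, h1]
      · exfalso
        rw [h1, add_sub_cancel_right] at h
        exact h₂ ⟨k, h.2⟩
    have hy2b : act ((affSys n).wordProd [i + 1, i]) y ≤ b := by
      refine le_of_periodic hm hy2c.periodic hbc.periodic p fun k hk hk' => ?_
      rcases hk.eq_or_lt with rfl | hk
      · rw [e12, hy2p]; omega
      · rw [hy2k k hk hk']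
    obtain ⟨α, hα, hαb⟩ := exists_allowed hm hmn hy2c hbc hy2b
    have hall : Allowed (α ++ [i + 1, i]) y := allowed_append.2 ⟨a12, hα⟩
    obtain ⟨β, -, -, hβ, hlen⟩ := hω.exists_factor hm hmn hyc hgy hall
      (by rw [CoxeterSystem.wordProd_append, act_mul, hαb, hb])
    refine false_of_triple hn3 hr hG.2.1 (fun j hj => ?_) hβ hlen (Or.inl rfl)
    obtain ⟨k, c, hk, hk', hkc, hck, rfl⟩ := hα.exists_mem_range hm hy2c.isPeriodicInj hj
    rw [hαb] at hck
    have hkp : k = p := by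
      by_contra hne
      rcases lt_or_gt_of_ne hne with hlt | hlt
      · have h3 := hy2k (k + m) (by omega) (by omega)
        rw [hy2c.periodic, hbc.periodic] at h3
        omega
      · rw [hy2k k hlt (by omega)] at hkc
        omega
    subst hkp
    rw [e12, hy2p] at hkc
    rw [← hzi]
    exact zmod_ne_of_between (by omega) (by omega)
  · have hpm' : p = m := by
      by_contra hne
      have h3 := ground_of_mem (n := n) (show 1 ≤ p + 1 by omega) (show p + 1 ≤ m by omega)
      have h4 : ground m n (p + 1) ≤ b (p + 1) := hgb (p + 1)
      omega
    have hb1 : b (p + 1) = b 1 - n := by rw [hpm', add_comm]; exact hbc.periodic 1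
    have hgb1 : ground m n 1 ≤ b 1 := hgb 1
    rw [ground_of_mem le_rfl (by omega)] at hgb1
    have hb1p := hbc.le_sub hp1
    rcases lt_or_eq_of_le (show z ≤ -m by omega) with hlt | heq
    · have hi0 := eq_zero_of_comm hr hG.1 fun j hj => by
        obtain ⟨p', c, h3, h4, h5, h6, rfl⟩ := hω.exists_mem_range hm hg.isPeriodicInj hj
        rw [hb] at h6
        rw [ground_of_mem h3 h4] at h5
        have h7 := hbc.le_sub h3
        rw [← hzi]
        exact zmod_ne_of_between (by omega) (by omega)
      rw [hi0] at hzi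
      have := intCast_zmod_ne (n := n) (z := z) (w := 0) (by omega) (by omega)
      exact this (by simpa using hzi)
    · -- The shape contains a column of `m` boxes, which `s_i` extends.
      have hcc : IsConf m n fun k => ground m n (k + 0) + 1 := hg.shift 0 1
      have hcb : (fun k => ground m n (k + 0) + 1) ≤ b := by
        refine le_of_periodic hm hcc.periodic hbc.periodic 1 fun k hk hk' => ?_
        rw [add_zero, ground_of_mem hk (by omega)]
        have := hbc.le_sub (show k ≤ p by omega)
        omega
      obtain ⟨β, hβ, hβc⟩ := exists_allowed hm hmn hg hcc
        (fun k => by change ground m n k ≤ ground m n (k + 0) + 1; rw [add_zero]; omega)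
      obtain ⟨α, hα, hαb⟩ := exists_allowed hm hmn hcc hbc hcb
      have hβlen : β.length = m := by
        have h3 := hβ.charge_eq hm hg.isPeriodicInj
        rw [hβc] at h3
        simp only [charge, add_zero, Finset.sum_add_distrib, Finset.sum_const, Finset.card_range,
          nsmul_eq_mul, mul_one] at h3
        omega
      have hβl (j) (hj : j ∈ β) : ∃ c : ℤ, (c : ZMod n) = j ∧ -(m : ℤ) < c ∧ c ≤ 0 := by
        obtain ⟨p', c, h3, h4, h5, h6, rfl⟩ := hβ.exists_mem_range hm hg.isPeriodicInj hj
        rw [hβc] at h6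
        simp only [add_zero] at h6
        rw [ground_of_mem h3 h4] at h5 h6
        exact ⟨c, rfl, by omega, by omega⟩
      have hinc : IsCycIncWord (i :: β) := by
        rw [isCycIncWord_cons]
        refine ⟨hβ.isCycIncWord hg fun k => by rw [hβc]; simp, fun h => ?_, fun h => ?_⟩
        · obtain ⟨c, hc, h3, h4⟩ := hβl _ h
          exact intCast_zmod_ne (n := n) (z := z) (w := c) (by omega) (by omega) (hzi.trans hc.symm)
        · obtain ⟨c, hc, h3, h4⟩ := hβl _ h
          refine intCast_zmod_ne (n := n) (z := z - 1) (w := c) (by omega) (by omega) ?_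
          rw [hc]; push_cast; rw [hzi]
      have hall : Allowed (α ++ β) (ground m n) := by
        rw [allowed_append, hβc]; exact ⟨hβ, hα⟩
      have hωe : (affSys n).wordProd ω = (affSys n).wordProd (α ++ β) :=
        hω.wordProd_eq hm hmn hg hall
          (by rw [CoxeterSystem.wordProd_append, act_mul, hβc, hαb, hb])
      have hlen : ω.length = α.length + β.length := by
        rw [← List.length_append, ← (hall.isReduced hm hg.isPeriodicInj).eq, ← hωe,
          (hω.isReduced hm hg.isPeriodicInj).eq]
      have hwe : (affSys n).wordProd (α ++ i :: β) = (affSys n).wordProd (i :: ω) := by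
        rw [CoxeterSystem.wordProd_append, CoxeterSystem.wordProd_cons _ i ω, hωe,
          CoxeterSystem.wordProd_append, CoxeterSystem.wordProd_cons, ← mul_assoc, ← mul_assoc,
          simple_mul_wordProd_comm]
        intro j hj
        obtain ⟨p', c, h3, h4, h5, h6, rfl⟩ := hα.exists_mem_range hm hcc.isPeriodicInj hj
        rw [hαb] at h6
        rw [add_zero, ground_of_mem h3 h4] at h5
        have h7 := hbc.le_sub h3
        rw [← hzi]
        exact zmod_ne_of_between (by omega) (by omega)
      have := length_le_maxc (α := α) (δ := i :: β)
        (by rw [CoxeterSystem.IsReduced, hwe, hr.eq]; simp; omega) hinc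
      rw [hwe, List.length_cons] at this
      have := hG.2.2.1
      omega

/-- A letter `i` of a reduced word of an element of `grassSet m n` cannot meet two occupied classes
`i - 1` and `i`: this mirrors `false_of_not_occ_of_not_occ`, with a row of `n - m` boxes and the bound
on `maxr` in the last case. -/
theorem false_of_occ_of_occ (hm : 0 < m) (hmn : m < n)
    (hr : (affSys n).IsReduced (i :: ω))
    (hG : (affSys n).wordProd (i :: ω) ∈ grassSet m n)
    (hω : Allowed ω (ground m n)) (hb : act ((affSys n).wordProd ω) (ground m n) = b)
    (h₁ : Occ b (i - 1)) (h₂ : Occ b i) : False := by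
  have hg := isConf_ground hm hmn
  have hbc : IsConf m n b := hb ▸ hω.isConf hg
  have hgb : ground m n ≤ b := hb ▸ hω.le_act
  obtain ⟨p, z, hp1, hpm, hzi, hzp⟩ : ∃ p z : ℤ, 1 ≤ p ∧ p ≤ m ∧ (z : ZMod n) = i ∧ b p = z := by
    obtain ⟨q, hq, hqi⟩ := h₂.exists_mem_range hm hbc.periodic
    exact ⟨q + 1, _, by omega, by omega, hqi, rfl⟩
  have hzp1 : b (p + 1) = z - 1 := by
    have h3 : Occ b (((z - 1 : ℤ)) : ZMod n) := by push_cast; rwa [hzi]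
    obtain ⟨q, hq⟩ := h3.exists_eq hbc.periodic
    have := hbc.eq_sub_one_iff (p := q) (q := p) (by omega)
    rwa [show p + 1 = q by omega]
  have hm2 : 2 ≤ m := by
    by_contra hm2
    obtain rfl : m = 1 := by omega
    have := hbc.periodic p
    rw [Nat.cast_one] at this
    omega
  have hn3 : 3 ≤ n := by omega
  have hgp := ground_of_mem (n := n) hp1 hpm
  have hgbp : ground m n p ≤ b p := hgb p
  by_cases hgz : ground m n p ≤ z - 1
  · -- The particles `p + 1` and `p` have made their last moves to `z - 1` and `z`.
    set y : ℤ → ℤ := fun k => min (b k) (ground m n (k + (1 - p)) + z) with hy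
    have hyc : IsConf m n y := hbc.min (hg.shift _ _)
    have hgy : ground m n ≤ y := fun k => le_min (hgb k) (ground_le_corner hm hmn hgz k)
    have hyb : y ≤ b := fun k => min_le_left _ _
    have hyk (k) (hk : p ≤ k) (hk' : k < p + m) : y k = min (b k) (z - 1 - (k - p)) := by
      simp only [hy]
      rw [ground_of_mem (by omega) (by omega)]
      omega
    have hyp : y p = z - 1 := by rw [hyk p le_rfl (by omega)]; omega
    have hyp1 : y (p + 1) = z - 2 := by rw [hyk (p + 1) (by omega) (by omega)]; omega
    have hyprev : z < y (p - 1) := by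
      have h3 := hyc.periodic (p - 1)
      have h4 := hbc.periodic (p - 1)
      have h5 := hbc.anti (show p - 1 < p by omega)
      rw [hyk _ (by omega) (by omega)] at h3
      omega
    have a1 : Allowed [i] y := allowed_singleton_of_step hyc (p := p) (by omega)
      (by rw [hyp, sub_add_cancel, hzi])
    have hy1c := a1.isConf hyc
    rw [CoxeterSystem.wordProd_singleton] at hy1c
    have hst := act_simple_of_occ (allowed_singleton.1 a1).2
    have hy1p : act ((affSys n).simple i) y p = z := by
      rw [act_simple, affSwap_of_eq_sub_one (by rw [hyp]; push_cast; rw [hzi]), hyp]; ring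
    have hz2 : ((z - 2 : ℤ) : ZMod n) ≠ i - 1 := by
      have := intCast_zmod_ne (n := n) (z := z - 2) (w := z - 1) (by omega) (by omega)
      push_cast at this ⊢
      rwa [hzi] at this ⊢
    have hy1p1 : act ((affSys n).simple i) y (p + 1) = z - 2 := by
      rcases hst (p + 1) with h | h
      · rw [h.1, hyp1]
      · rw [hyp1] at h
        exact absurd h.2 hz2
    have a2 : Allowed [i - 1] (act ((affSys n).simple i) y) := by
      refine allowed_singleton_of_step hy1c (p := p + 1) ?_ ?_
      · rw [add_sub_cancel_right]; omega
      · rw [hy1p1]; push_cast; rw [hzi]; ring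
    have hst2 := act_simple_of_occ (allowed_singleton.1 a2).2
    have a12 : Allowed [i - 1, i] y := by
      rw [← List.singleton_append, allowed_append, CoxeterSystem.wordProd_singleton]
      exact ⟨a1, a2⟩
    have e12 : act ((affSys n).wordProd [i - 1, i]) y =
        act ((affSys n).simple (i - 1)) (act ((affSys n).simple i) y) := by
      rw [act_cons, CoxeterSystem.wordProd_singleton]
    have hy2c := a12.isConf hyc
    have hy2p : act ((affSys n).wordProd [i - 1, i]) y p = z := by
      rw [e12]
      rcases hst2 p with h | h
      · rw [h.1, hy1p]
      · exfalso
        have := intCast_zmod_ne (n := n) (z := z - 2) (w := z) (by omega) (by omega)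
        rw [hy1p] at h
        refine this ?_
        rw [h.2]; push_cast; rw [hzi]; ring
    have hy2p1 : act ((affSys n).wordProd [i - 1, i]) y (p + 1) = z - 1 := by
      rw [e12, act_simple, affSwap_of_eq_sub_one, hy1p1]
      · ring
      · rw [hy1p1]; push_cast; rw [hzi]; ring
    have hyk2 (k) (hk : p + 1 < k) (hk' : k < p + m) : z - n < y k ∧ y k < z - 2 := by
      have h3 := hyc.anti hk
      have h4 := hyc.le_sub (show k ≤ p - 1 + m by omega)
      rw [hyc.periodic] at h4
      omega
    have hy2k (k) (hk : p + 1 < k) (hk' : k < p + m) :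
        act ((affSys n).wordProd [i - 1, i]) y k = y k := by
      obtain ⟨h3, h4⟩ := hyk2 k hk hk'
      have h1 : act ((affSys n).simple i) y k = y k := by
        rcases hst k with h | h
        · exact h.1
        · exfalso
          refine intCast_zmod_ne (n := n) (z := y k) (w := z - 1) (by omega) (by omega) ?_
          rw [h.2]; push_cast; rw [hzi]
      rw [e12]
      rcases hst2 k with h | h
      · rw [h.1, h1]
      · exfalso
        rw [h1] at h
        refine intCast_zmod_ne (n := n) (z := y k) (w := z - 2) (by omega) (by omega) ?_
        rw [h.2]; push_cast; rw [hzi]; ring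
    have hy2b : act ((affSys n).wordProd [i - 1, i]) y ≤ b := by
      refine le_of_periodic hm hy2c.periodic hbc.periodic p fun k hk hk' => ?_
      rcases hk.eq_or_lt with rfl | hk
      · rw [hy2p]; omega
      rcases (show p + 1 ≤ k by omega).eq_or_lt with rfl | hk
      · rw [hy2p1, hzp1]
      · rw [hy2k k hk hk']; exact hyb k
    obtain ⟨α, hα, hαb⟩ := exists_allowed hm hmn hy2c hbc hy2b
    have hall : Allowed (α ++ [i - 1, i]) y := allowed_append.2 ⟨a12, hα⟩
    obtain ⟨β, -, -, hβ, hlen⟩ := hω.exists_factor hm hmn hyc hgy hall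
      (by rw [CoxeterSystem.wordProd_append, act_mul, hαb, hb])
    refine false_of_triple hn3 hr hG.2.1 (fun j hj => ?_) hβ hlen (Or.inr (by ring))
    obtain ⟨k', c', hkc', hck', hcj⟩ := hα.mem_iff.1 hj
    rw [hαb] at hck'
    obtain ⟨q, hq, t, ht⟩ := exists_eq_add_mul_of_pos hm (k' - p + 1)
    obtain ⟨k, rfl⟩ : ∃ k, k' = k + m * t := ⟨p + q, by omega⟩
    obtain ⟨c, rfl⟩ : ∃ c, c' = c - n * t := ⟨c' + n * t, by omega⟩
    rw [periodic_mul hy2c.periodic] at hkc'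
    rw [periodic_mul hbc.periodic] at hck'
    have hkp : p ≤ k := by omega
    have hkp' : k < p + m := by omega
    have hkp2 : p + 1 < k := by
      by_contra hne
      rcases (show k = p ∨ k = p + 1 by omega) with rfl | rfl
      · omega
      · omega
    rw [hy2k k hkp2 hkp', hyk k hkp hkp'] at hkc'
    have h5 := hyk2 k hkp2 hkp'
    rw [hyk k hkp hkp'] at h5
    have h6 := hbc.le_sub hkp
    have hcj' : (c : ZMod n) = j := by rw [← hcj]; simp
    rw [← hzi, ← hcj']
    exact zmod_ne_of_between' (by omega) (by omega)
  · have hzp0 : z = -p := by omega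
    rcases lt_or_eq_of_le hpm with hlt | heq
    · have hi0 := eq_zero_of_comm hr hG.1 fun j hj => by
        obtain ⟨p', c, h3, h4, h5, h6, rfl⟩ := hω.exists_mem_range hm hg.isPeriodicInj hj
        rw [hb] at h6
        rw [ground_of_mem h3 h4] at h5
        have h7 := hbc.le_sub h3
        have h8 := hbc.periodic 1
        have h9 := hbc.anti (show p + 1 < 1 + m by omega)
        have h10 : p' < p := by
          by_contra h11
          have := hbc.le_sub (show p ≤ p' by omega)
          omega
        rw [← hzi]
        exact zmod_ne_of_between (by omega) (by omega)
      rw [hi0] at hzi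
      have := intCast_zmod_ne (n := n) (z := z) (w := 0) (by omega) (by omega)
      exact this (by simpa using hzi)
    · -- The shape contains a row of `n - m` boxes, which `s_i` extends.
      have hb1 : b (p + 1) = b 1 - n := by rw [heq, add_comm]; exact hbc.periodic 1
      obtain ⟨y, hy⟩ : ∃ y : ℤ → ℤ, ∀ k, y k = ground m n (k + -1) + -1 := ⟨_, fun _ => rfl⟩
      have hyc : IsConf m n y := by
        rw [show y = fun k => ground m n (k + -1) + -1 from funext hy]
        exact hg.shift (-1) (-1)
      have hy1 : y 1 = n - m - 1 := by
        have h3 := hyc.periodic 1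
        have h4 := hy (1 + m)
        rw [ground_of_mem (by omega) (by omega)] at h4
        omega
      have hyk (k : ℤ) (hk : 1 < k) (hk' : k ≤ m) : y k = -k := by
        rw [hy, ground_of_mem (by omega) (by omega)]; omega
      have hgy : ground m n ≤ y := by
        refine le_of_periodic hm hg.periodic hyc.periodic 1 fun k hk hk' => ?_
        rw [ground_of_mem hk (by omega)]
        rcases hk.eq_or_lt with rfl | hk
        · omega
        · rw [hyk k hk (by omega)]
      have hyb : y ≤ b := by
        refine le_of_periodic hm hyc.periodic hbc.periodic 1 fun k hk hk' => ?_
        rcases hk.eq_or_lt with rfl | hk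
        · omega
        · rw [hyk k hk (by omega)]
          have h3 : ground m n k ≤ b k := hgb k
          rwa [ground_of_mem (by omega) (by omega)] at h3
      obtain ⟨β, hβ, hβy⟩ := exists_allowed hm hmn hg hyc hgy
      obtain ⟨α, hα, hαb⟩ := exists_allowed hm hmn hyc hbc hyb
      have hβlen : (β.length : ℤ) = n - m := by
        have h3 := hβ.charge_eq hm hg.isPeriodicInj
        have h4 := Finset.sum_range_sub (fun k : ℕ => ground m n k) m
        have h5 : ground m n 0 = n - m := by
          have := hg.periodic 0
          rw [zero_add, ground_of_mem (by omega) (by omega)] at this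
          omega
        rw [hβy] at h3
        simp only [charge, hy, Finset.sum_add_distrib, Finset.sum_const, Finset.card_range,
          nsmul_eq_mul, add_neg_cancel_right] at h3
        rw [Finset.sum_sub_distrib, ground_of_mem (by omega) (by omega)] at h4
        push_cast at h4
        rw [h5] at h4
        omega
      have hβl (j) (hj : j ∈ β) : ∃ c : ℤ, (c : ZMod n) = j ∧ 0 ≤ c ∧ c ≤ n - m - 1 := by
        obtain ⟨p', c, h3, h4, h5, h6, rfl⟩ := hβ.exists_mem_range hm hg.isPeriodicInj hj
        rw [hβy] at h6
        rw [ground_of_mem h3 h4] at h5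
        rcases h3.eq_or_lt with rfl | h3
        · exact ⟨c, rfl, by omega, by omega⟩
        · rw [hyk p' h3 h4] at h6
          omega
      have hdec : IsCycDecWord (i :: β) := by
        rw [isCycDecWord_cons, hβ.isCycDecWord_iff hg]
        refine ⟨fun k => ?_, fun h => ?_, fun h => ?_⟩
        · rw [hβy, hy, ← sub_eq_add_neg k]; omega
        · obtain ⟨c, hc, h3, h4⟩ := hβl _ h
          exact intCast_zmod_ne (n := n) (z := z) (w := c) (by omega) (by omega) (hzi.trans hc.symm)
        · obtain ⟨c, hc, h3, h4⟩ := hβl _ h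
          refine intCast_zmod_ne (n := n) (z := z + 1) (w := c) (by omega) (by omega) ?_
          rw [hc]; push_cast; rw [hzi]
      have hall : Allowed (α ++ β) (ground m n) := by
        rw [allowed_append, hβy]; exact ⟨hβ, hα⟩
      have hωe : (affSys n).wordProd ω = (affSys n).wordProd (α ++ β) :=
        hω.wordProd_eq hm hmn hg hall
          (by rw [CoxeterSystem.wordProd_append, act_mul, hβy, hαb, hb])
      have hlen : ω.length = α.length + β.length := by
        rw [← List.length_append, ← (hall.isReduced hm hg.isPeriodicInj).eq, ← hωe,
          (hω.isReduced hm hg.isPeriodicInj).eq]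
      have hwe : (affSys n).wordProd (α ++ i :: β) = (affSys n).wordProd (i :: ω) := by
        rw [CoxeterSystem.wordProd_append, CoxeterSystem.wordProd_cons _ i ω, hωe,
          CoxeterSystem.wordProd_append, CoxeterSystem.wordProd_cons, ← mul_assoc, ← mul_assoc,
          simple_mul_wordProd_comm]
        intro j hj
        obtain ⟨p', c, h3, h4, h5, h6, rfl⟩ := hα.exists_mem_range hm hyc.isPeriodicInj hj
        rw [hαb] at h6
        rcases h3.eq_or_lt with rfl | h3
        · omega
        · rw [hyk p' h3 h4] at h5
          have h7 := hbc.le_sub h3.le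
          have h8 : p' ≠ m := by
            intro h
            rw [← heq] at h
            rw [h] at h5 h6
            omega
          rw [← hzi]
          exact zmod_ne_of_between (by omega) (by omega)
      have := length_le_maxr (α := α) (δ := i :: β)
        (by rw [CoxeterSystem.IsReduced, hwe, hr.eq]; simp; omega) hdec
      rw [hwe, List.length_cons] at this
      have := hG.2.2.2
      omega

/-- The reduced words of the elements of `grassSet m n` act on the ground state without annihilating
it. -/
theorem allowed_of_mem_grassSet (hm : 0 < m) (hmn : m < n) {ω : List (ZMod n)}
    (hr : (affSys n).IsReduced ω) (h : (affSys n).wordProd ω ∈ grassSet m n) :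
    Allowed ω (ground m n) := by
  induction ω with
  | nil => trivial
  | cons i ω ih =>
    have hr' : (affSys n).IsReduced ([i] ++ ω) := hr
    have h' : (affSys n).wordProd [i] * (affSys n).wordProd ω ∈ grassSet m n := by
      rwa [← CoxeterSystem.wordProd_append]
    have hω := ih (isReduced_append_right hr') (mem_grassSet_of_mul h' (by
      rw [← CoxeterSystem.wordProd_append]; exact length_append_of_isReduced hr'))
    by_cases h₁ : Occ (act ((affSys n).wordProd ω) (ground m n)) (i - 1) <;>
      by_cases h₂ : Occ (act ((affSys n).wordProd ω) (ground m n)) i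
    · exact (false_of_occ_of_occ hm hmn hr h hω rfl h₁ h₂).elim
    · exact ⟨hω, h₁, h₂⟩
    · exact (false_of_not_occ_of_occ hm hmn hr h.1 hω rfl h₁ h₂).elim
    · exact (false_of_not_occ_of_not_occ hm hmn hr h hω rfl h₁ h₂).elim

theorem mem_grassSet_iff (hm : 0 < m) (hmn : m < n) {w : AffSym n} :
    w ∈ grassSet m n ↔ IsRaising m w := by
  refine ⟨fun h => ?_, fun h => h.mem_grassSet hm hmn⟩
  obtain ⟨ω, hω, rfl⟩ := (affSys n).exists_isReduced w
  exact ⟨ω, allowed_of_mem_grassSet hm hmn hω h, rfl⟩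

end cases

/-! ### Flags of strips and the Bender–Knuth involutions -/

/-- A chain of configurations from the ground state to `b` in which `t (k + 1)` arises from `t k` by
adding a horizontal strip of `e k` boxes. -/
structure IsFlag (m n : ℕ) (e : ℕ → ℕ) (b : ℤ → ℤ) (t : ℕ → ℤ → ℤ) : Prop where
  zero : t 0 = ground m n
  conf : ∀ k, IsConf m n (t k)
  le_succ : ∀ k p, t k p ≤ t (k + 1) p
  strip : ∀ k p, t (k + 1) p < t k (p - 1)
  weight : ∀ k, charge m (t (k + 1)) = charge m (t k) + e k
  top : ∃ N, ∀ k, N ≤ k → t k = b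

/-- The Bender–Knuth involution: the condition on `y` in a chain `x ⊆ y ⊆ z` of horizontal strips is
that `y p` lies between `max (x p) (z (p + 1) + 1)` and `min (x (p - 1) - 1) (z p)`, and the
involution reflects these intervals. -/
def benderKnuth (x y z : ℤ → ℤ) (p : ℤ) : ℤ :=
  min (x (p - 1) - 1) (z p) + max (x p) (z (p + 1) + 1) - y p

theorem IsConf.of_succ_lt {m n : ℕ} {b : ℤ → ℤ} (h : ∀ k, b (k + 1) < b k)
    (h' : ∀ k, b (k + m) = b k - n) : IsConf m n b :=
  ⟨strictAnti_int_of_succ_lt h, h'⟩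

section benderKnuth

variable {m n : ℕ} {x y z : ℤ → ℤ}

theorem isConf_benderKnuth (hx : IsConf m n x) (hy : IsConf m n y) (hz : IsConf m n z)
    (hxy : ∀ p, x p ≤ y p) (hxy' : ∀ p, y p < x (p - 1)) (hyz : ∀ p, y p ≤ z p)
    (hyz' : ∀ p, z p < y (p - 1)) : IsConf m n (benderKnuth x y z) := by
  refine IsConf.of_succ_lt (fun p => ?_) fun p => ?_
  · have h1 := hxy p
    have h2 := hxy' p
    have h3 := hyz p
    have h4 := hyz' (p + 1)
    have h5 := hxy (p + 1)
    have h6 := hxy' (p + 1)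
    have h7 := hyz (p + 1)
    have h8 := hyz' (p + 1 + 1)
    rw [add_sub_cancel_right] at h4 h6 h8
    simp only [benderKnuth, add_sub_cancel_right]
    omega
  · have h1 := hx.periodic p
    have h2 := hx.periodic (p - 1)
    have h3 := hy.periodic p
    have h4 := hz.periodic p
    have h5 := hz.periodic (p + 1)
    simp only [benderKnuth]
    rw [show p + m - 1 = p - 1 + m by ring, show p + (m : ℤ) + 1 = p + 1 + m by ring]
    omega

theorem charge_benderKnuth (hx : IsConf m n x) (hz : IsConf m n z) :
    charge m (benderKnuth x y z) = charge m x + charge m z - charge m y := by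
  have h1 (k : ℕ) : benderKnuth x y z (k + 1) = x (k + 1) + z (k + 1) - y (k + 1) +
      ((max (x (k + 1 : ℕ)) (z ((k + 1 : ℕ) + 1) + 1) - x (k + 1 : ℕ)) -
        (max (x k) (z (k + 1) + 1) - x k)) := by
    simp only [benderKnuth, add_sub_cancel_right]
    push_cast
    omega
  have h2 := hx.periodic 0
  have h3 := hz.periodic 1
  rw [zero_add] at h2
  rw [add_comm] at h3
  simp only [charge, h1]
  rw [Finset.sum_add_distrib, Finset.sum_range_sub
    (fun k : ℕ => max (x k) (z (k + 1) + 1) - x k), Finset.sum_sub_distrib, Finset.sum_add_distrib]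
  push_cast
  rw [h2, h3]
  omega

/-- The Bender–Knuth involution applied to the term `k + 1` of a chain. -/
def toggleFlag (k : ℕ) (t : ℕ → ℤ → ℤ) : ℕ → ℤ → ℤ :=
  Function.update t (k + 1) (benderKnuth (t k) (t (k + 1)) (t (k + 2)))

theorem toggleFlag_toggleFlag (k : ℕ) (t : ℕ → ℤ → ℤ) :
    toggleFlag k (toggleFlag k t) = t := by
  unfold toggleFlag
  rw [Function.update_self, Function.update_of_ne (by omega), Function.update_of_ne (by omega),
    Function.update_idem]
  conv_rhs => rw [← Function.update_eq_self (k + 1) t]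
  congr 1
  funext p
  simp only [benderKnuth]
  ring

theorem IsFlag.toggleFlag {e : ℕ → ℕ} {b : ℤ → ℤ} {t : ℕ → ℤ → ℤ} (h : IsFlag m n e b t) (k : ℕ) :
    IsFlag m n (e ∘ Equiv.swap k (k + 1)) b (toggleFlag k t) := by
  have hne {l : ℕ} (hl : l ≠ k + 1) : _root_.toggleFlag k t l = t l := Function.update_of_ne hl _ _
  have heq : _root_.toggleFlag k t (k + 1) = benderKnuth (t k) (t (k + 1)) (t (k + 2)) :=
    Function.update_self _ _ _
  have hconf : IsConf m n (benderKnuth (t k) (t (k + 1)) (t (k + 2))) :=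
    isConf_benderKnuth (h.conf _) (h.conf _) (h.conf _) (h.le_succ _) (h.strip _) (h.le_succ _)
      (h.strip _)
  have hcharge := charge_benderKnuth (y := t (k + 1)) (h.conf k) (h.conf (k + 2))
  have hbd (p) : t k p ≤ benderKnuth (t k) (t (k + 1)) (t (k + 2)) p ∧
      t (k + 2) (p + 1) < benderKnuth (t k) (t (k + 1)) (t (k + 2)) p ∧
      benderKnuth (t k) (t (k + 1)) (t (k + 2)) p ≤ t (k + 2) p ∧
      benderKnuth (t k) (t (k + 1)) (t (k + 2)) p < t k (p - 1) := by
    have h1 := h.le_succ k p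
    have h2 := h.strip k p
    have h3 := h.le_succ (k + 1) p
    have h4 := h.strip (k + 1) (p + 1)
    rw [add_sub_cancel_right] at h4
    simp only [benderKnuth]
    rw [show k + 1 + 1 = k + 2 from rfl] at h3 h4
    omega
  refine ⟨by rw [hne (by omega), h.zero], fun l => ?_, fun l p => ?_, fun l p => ?_, fun l => ?_, ?_⟩
  · by_cases hl : l = k + 1
    · rw [hl, heq]; exact hconf
    · rw [hne hl]; exact h.conf l
  · by_cases hl : l = k + 1
    · rw [hl, heq, hne (by omega)]; exact (hbd p).2.2.1
    by_cases hl' : l = k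
    · rw [hl', heq, hne (by omega)]; exact (hbd p).1
    · rw [hne hl, hne (by omega)]; exact h.le_succ l p
  · by_cases hl : l = k + 1
    · have := (hbd (p - 1)).2.1
      rw [sub_add_cancel] at this
      rw [hl, heq, hne (by omega)]; exact this
    by_cases hl' : l = k
    · rw [hl', heq, hne (by omega)]; exact (hbd p).2.2.2
    · rw [hne hl, hne (by omega)]; exact h.strip l p
  · have hk := h.weight k
    have hk1 := h.weight (k + 1)
    by_cases hl : l = k + 1
    · rw [hl, heq, hne (by omega), Function.comp_apply, Equiv.swap_apply_right]
      rw [show k + 1 + 1 = k + 2 from rfl] at hk1 ⊢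
      omega
    by_cases hl' : l = k
    · rw [hl', heq, hne (by omega), Function.comp_apply, Equiv.swap_apply_left]
      rw [show k + 1 + 1 = k + 2 from rfl] at hk1
      omega
    · rw [hne hl, hne (by omega), Function.comp_apply, Equiv.swap_apply_of_ne_of_ne hl' hl]
      exact h.weight l
  · obtain ⟨N, hN⟩ := h.top
    refine ⟨max N (k + 2), fun l hl => ?_⟩
    rw [hne (by omega), hN l (by omega)]

theorem card_isFlag_swap (e : ℕ → ℕ) (b : ℤ → ℤ) (k : ℕ) :
    Nat.card {t // IsFlag m n e b t} = Nat.card {t // IsFlag m n (e ∘ Equiv.swap k (k + 1)) b t} := by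
  refine Nat.card_congr ⟨fun t => ⟨_, t.2.toggleFlag k⟩, fun t => ⟨toggleFlag k t.1, ?_⟩,
    fun t => Subtype.ext (toggleFlag_toggleFlag k t.1),
    fun t => Subtype.ext (toggleFlag_toggleFlag k t.1)⟩
  have := t.2.toggleFlag k
  rwa [Function.comp_assoc, ← Equiv.coe_trans, ← Equiv.Perm.mul_def, Equiv.swap_mul_self] at this

/-- The number of chains of strips does not depend on the order of the sizes of the strips. -/
theorem card_isFlag_perm (b : ℤ → ℤ) {l l' : List ℕ} (h : l.Perm l') (l₀ : List ℕ) :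
    Nat.card {t // IsFlag m n (fun k => (l₀ ++ l).getD k 0) b t} =
      Nat.card {t // IsFlag m n (fun k => (l₀ ++ l').getD k 0) b t} := by
  induction h generalizing l₀ with
  | nil => rfl
  | cons a _ ih => simpa using ih (l₀ ++ [a])
  | swap a c l =>
    rw [card_isFlag_swap _ b l₀.length]
    have : (fun k => (l₀ ++ c :: a :: l).getD k 0) ∘ Equiv.swap l₀.length (l₀.length + 1) =
        fun k => (l₀ ++ a :: c :: l).getD k 0 := by
      funext k
      rw [Function.comp_apply]
      by_cases h1 : k = l₀.length
      · rw [h1, Equiv.swap_apply_left]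
        simp [List.getD_eq_getElem?_getD]
      by_cases h2 : k = l₀.length + 1
      · rw [h2, Equiv.swap_apply_right]
        simp [List.getD_eq_getElem?_getD]
      rw [Equiv.swap_apply_of_ne_of_ne h1 h2, List.getD_eq_getElem?_getD,
        List.getD_eq_getElem?_getD, List.getElem?_append, List.getElem?_append]
      split_ifs with h3
      · rfl
      · obtain ⟨d, hd⟩ : ∃ d, k - l₀.length = d + 2 := ⟨k - l₀.length - 2, by omega⟩
        rw [hd]
        simp
    rw [this]
  | trans _ _ ih₁ ih₂ => rw [ih₁, ih₂]

theorem card_isFlag_reverse (b : ℤ → ℤ) {e : ℕ → ℕ} {N : ℕ} (he : ∀ k, N ≤ k → e k = 0) :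
    Nat.card {t // IsFlag m n (fun k => if k < N then e (N - 1 - k) else 0) b t} =
      Nat.card {t // IsFlag m n e b t} := by
  have h1 := card_isFlag_perm (m := m) (n := n) b (List.reverse_perm ((List.range N).map e)) []
  have h2 : (fun k => ([] ++ ((List.range N).map e)).getD k 0) = e := by
    funext k
    rw [List.nil_append, List.getD_eq_getElem?_getD, List.getElem?_map]
    by_cases hk : k < N
    · simp [List.getElem?_range hk]
    · rw [List.getElem?_eq_none (by simpa using hk), he k (by omega)]
      rfl
  have h3 : (fun k => ([] ++ ((List.range N).map e).reverse).getD k 0) =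
      fun k => if k < N then e (N - 1 - k) else 0 := by
    funext k
    rw [List.nil_append, List.getD_eq_getElem?_getD]
    split_ifs with hk
    · rw [List.getElem?_reverse (by simpa using hk), List.getElem?_map]
      simp [List.getElem?_range (show N - 1 - k < N by omega)]
    · rw [List.getElem?_eq_none (by simpa using hk)]
      rfl
  rwa [h2, h3] at h1

end benderKnuth

theorem IsConf.eq_of_charge_eq {m n : ℕ} {b b' : ℤ → ℤ} (hm : 0 < m) (hb : IsConf m n b)
    (hb' : IsConf m n b') (hle : b ≤ b') (hc : charge m b = charge m b') : b = b' := by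
  have h1 := (Finset.sum_eq_sum_iff_of_le (s := Finset.range m)
    (f := fun k : ℕ => b (k + 1)) (g := fun k : ℕ => b' (k + 1)) fun k _ => hle _).1 hc
  funext p
  obtain ⟨q, hq, t, rfl⟩ := exists_eq_add_mul_of_pos hm p
  rw [periodic_mul hb.periodic, periodic_mul hb'.periodic]
  exact congrArg (· - _) (h1 q (Finset.mem_range.2 hq))

namespace IsFlag

variable {m n : ℕ} {e : ℕ → ℕ} {b : ℤ → ℤ} {t : ℕ → ℤ → ℤ}

theorem mono (h : IsFlag m n e b t) : Monotone t := monotone_nat_of_le_succ h.le_succ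

theorem ground_le (h : IsFlag m n e b t) (k : ℕ) : ground m n ≤ t k :=
  h.zero ▸ h.mono (Nat.zero_le k)

theorem le_top (h : IsFlag m n e b t) (k : ℕ) : t k ≤ b := by
  obtain ⟨N, hN⟩ := h.top
  rw [← hN _ (le_max_left N k)]
  exact h.mono (le_max_right N k)

theorem eq_top (hm : 0 < m) (h : IsFlag m n e b t) {N : ℕ} (he : ∀ k, N ≤ k → e k = 0) {k : ℕ}
    (hk : N ≤ k) : t k = b := by
  have h1 (l : ℕ) (hl : N ≤ l) : t (l + 1) = t l := by
    refine ((h.conf l).eq_of_charge_eq hm (h.conf _) (h.le_succ l) ?_).symm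
    rw [h.weight, he l hl, Nat.cast_zero, add_zero]
  have h2 (d : ℕ) : t (k + d) = t k := by
    induction d with
    | zero => rfl
    | succ d ih => rw [← add_assoc, h1 _ (by omega), ih]
  obtain ⟨M, hM⟩ := h.top
  rw [← h2 M, hM _ (by omega)]

end IsFlag

/-! ### Cyclically decreasing decompositions as flags -/

section raising

variable {m n : ℕ} [Fact (1 < n)] {v w : AffSym n}

theorem IsRaising.isConf (hm : 0 < m) (hmn : m < n) (h : IsRaising m w) :
    IsConf m n (act w (ground m n)) := by
  obtain ⟨ω, hω, rfl⟩ := h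
  exact hω.isConf (isConf_ground hm hmn)

theorem IsRaising.ground_le (h : IsRaising m w) : ground m n ≤ act w (ground m n) := by
  obtain ⟨ω, hω, rfl⟩ := h
  exact hω.le_act

theorem IsRaising.charge_eq (hm : 0 < m) (hmn : m < n) (h : IsRaising m w) :
    charge m (act w (ground m n)) = charge m (ground m n) + (affSys n).length w := by
  obtain ⟨ω, hω, rfl⟩ := h
  have hg := (isConf_ground hm hmn).isPeriodicInj
  rw [hω.charge_eq hm hg, (hω.isReduced hm hg).eq]

theorem IsRaising.eq_of_act_eq (hm : 0 < m) (hmn : m < n) (hv : IsRaising m v)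
    (hw : IsRaising m w) (h : act v (ground m n) = act w (ground m n)) : v = w := by
  obtain ⟨ω, hω, rfl⟩ := hv
  obtain ⟨ω', hω', rfl⟩ := hw
  exact hω.wordProd_eq hm hmn (isConf_ground hm hmn) hω' h

theorem isRaising_one (m : ℕ) : IsRaising m (1 : AffSym n) := ⟨[], trivial, by simp⟩

theorem exists_isRaising (hm : 0 < m) (hmn : m < n) {b : ℤ → ℤ} (hb : IsConf m n b)
    (h : ground m n ≤ b) : ∃ w : AffSym n, IsRaising m w ∧ act w (ground m n) = b := by
  obtain ⟨ω, hω, h⟩ := exists_allowed hm hmn (isConf_ground hm hmn) hb h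
  exact ⟨_, ⟨ω, hω, rfl⟩, h⟩

theorem IsRaising.of_mul (hm : 0 < m) (hmn : m < n) {u v : AffSym n} (h : IsRaising m (u * v))
    (hl : (affSys n).length (u * v) = (affSys n).length u + (affSys n).length v) :
    IsRaising m v := by
  rw [← mem_grassSet_iff hm hmn] at h ⊢
  exact mem_grassSet_of_mul h hl

/-- Multiplying by a cyclically decreasing element adds a horizontal strip. -/
theorem IsRaising.strip_of_mul (hm : 0 < m) (hmn : m < n) {d : AffSym n} {J : Finset (ZMod n)}
    (h : IsRaising m (d * v)) (hd : IsCycDecOn J d)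
    (hl : (affSys n).length (d * v) = (affSys n).length d + (affSys n).length v) (p : ℤ) :
    act v (ground m n) p ≤ act (d * v) (ground m n) p ∧
      act (d * v) (ground m n) p < act v (ground m n) (p - 1) := by
  have hv := h.of_mul hm hmn hl
  obtain ⟨δ, hδ, -, rfl⟩ := hd
  obtain ⟨β, hβ, rfl⟩ := (affSys n).exists_isReduced v
  rw [← CoxeterSystem.wordProd_append] at h
  have h1 := h.allowed hm hmn (isReduced_append_of_length_eq (isReduced_of_nodup hδ.1) hβ hl)
  rw [allowed_append] at h1
  rw [act_mul]
  exact ⟨h1.2.le_act p, (h1.2.isCycDecWord_iff (hv.isConf hm hmn)).1 hδ p⟩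

theorem IsRaising.exists_isCycDecOn (hm : 0 < m) (hmn : m < n) (hv : IsRaising m v)
    (hw : IsRaising m w)
    (h₁ : ∀ p, act v (ground m n) p ≤ act w (ground m n) p)
    (h₂ : ∀ p, act w (ground m n) p < act v (ground m n) (p - 1)) :
    (∃ J, IsCycDecOn J (w * v⁻¹)) ∧
      (affSys n).length (w * v⁻¹) + (affSys n).length v = (affSys n).length w := by
  have hvc := hv.isConf hm hmn
  have hvl := hv.charge_eq hm hmn
  have hwl := hw.charge_eq hm hmn
  obtain ⟨δ, hδ, hδw⟩ := exists_allowed hm hmn hvc (hw.isConf hm hmn) h₁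
  obtain ⟨β, hβ, rfl⟩ := hv
  have h3 : Allowed (δ ++ β) (ground m n) := allowed_append.2 ⟨hβ, hδ⟩
  have h4 : (affSys n).wordProd δ * (affSys n).wordProd β = w := by
    rw [← CoxeterSystem.wordProd_append]
    refine IsRaising.eq_of_act_eq hm hmn ⟨_, h3, rfl⟩ hw ?_
    rw [CoxeterSystem.wordProd_append, act_mul, hδw]
  rw [← h4, mul_inv_cancel_right]
  refine ⟨⟨_, δ, (hδ.isCycDecWord_iff hvc).2 (by rwa [hδw]), rfl, rfl⟩, ?_⟩
  rw [h4, (hδ.isReduced hm hvc.isPeriodicInj).eq]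
  have h5 := hδ.charge_eq hm hvc.isPeriodicInj
  rw [hδw] at h5
  omega

/-- In a decomposition `w = f 0 * f 1 * ⋯` the right factors `f k * f (k + 1) * ⋯` yield a flag, read
from the last factor to the first one. -/
theorem numCycDecDecomp_eq (hm : 0 < m) (hmn : m < n) (hw : IsRaising m w) (e : ℕ →₀ ℕ) :
    numCycDecDecomp w e = Nat.card {t // IsFlag m n e (act w (ground m n)) t} := by
  obtain ⟨N, he⟩ : ∃ N, ∀ k, N ≤ k → e k = 0 := by
    obtain ⟨N, hN⟩ := e.support.exists_nat_subset_range
    refine ⟨N, fun k hk => ?_⟩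
    by_contra h
    have := Finset.mem_range.1 (hN (Finsupp.mem_support_iff.2 h))
    omega
  rw [← card_isFlag_reverse _ he]
  set P : (ℕ → AffSym n) → ℕ → AffSym n := fun f k => ((List.range k).map f).prod with hP
  have hP0 (f) : P f 0 = 1 := by simp [hP]
  have hPs (f) (k) : P f (k + 1) = P f k * f k := List.prod_range_succ f k
  have hPt {f} (hf : ∀ k, N ≤ k → f k = 1) {k} (hk : N ≤ k) : P f k = P f N := by
    induction k, hk using Nat.le_induction with
    | base => rfl
    | succ k hk ih => rw [hPs, ih, hf k hk, mul_one]
  -- The number of factors may be taken to be `N`.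
  have hchar (f : ℕ → AffSym n) (hlen : ∀ k, (affSys n).length (f k) = e k) :
      (∃ M, (∀ k, M ≤ k → f k = 1) ∧ ((List.range M).map f).prod = w ∧
        ∑ k ∈ Finset.range M, (affSys n).length (f k) = (affSys n).length w) →
      (∀ k, N ≤ k → f k = 1) ∧ P f N = w ∧
        ∑ k ∈ Finset.range N, e k = (affSys n).length w := by
    rintro ⟨M, h1, h2, h3⟩
    have hfN (k) (hk : N ≤ k) : f k = 1 := by
      rw [← (affSys n).length_eq_zero_iff, hlen, he k hk]
    have h4 {A B : ℕ} (hAB : A ≤ B) (hA : ∀ k, A ≤ k → f k = 1) : P f B = P f A ∧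
        ∑ k ∈ Finset.range B, e k = ∑ k ∈ Finset.range A, e k := by
      induction B, hAB using Nat.le_induction with
      | base => exact ⟨rfl, rfl⟩
      | succ B hB ih =>
        have h5 := hlen B
        rw [hA B hB, (affSys n).length_one] at h5
        rw [hPs, hA B hB, mul_one, Finset.sum_range_succ, ← h5, add_zero]
        exact ih
    have h5 := h4 (le_max_left M N) h1
    have h6 := h4 (le_max_right M N) hfN
    refine ⟨hfN, ?_, ?_⟩
    · rw [← h6.1, h5.1]; exact h2
    · rw [← h6.2, h5.2, ← h3]
      exact Finset.sum_congr rfl fun k _ => (hlen k).symm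
  -- The right factors of a decomposition.
  have hv (f : ℕ → AffSym n) (hlen : ∀ k, (affSys n).length (f k) = e k)
      (hf : ∀ k, N ≤ k → f k = 1) (hprod : P f N = w)
      (hsum : ∑ k ∈ Finset.range N, e k = (affSys n).length w) (k : ℕ) :
      IsRaising m ((P f k)⁻¹ * w) ∧ (P f k)⁻¹ * w = f k * ((P f (k + 1))⁻¹ * w) ∧
      (affSys n).length ((P f k)⁻¹ * w) =
        e k + (affSys n).length ((P f (k + 1))⁻¹ * w) := by
    have h1 (k) : (P f k)⁻¹ * w = f k * ((P f (k + 1))⁻¹ * w) := by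
      rw [hPs, mul_inv_rev, mul_assoc, mul_inv_cancel_left]
    set A : ℕ → ℕ := fun k => (affSys n).length ((P f k)⁻¹ * w) + ∑ l ∈ Finset.range k, e l with hA
    have hAmono : Monotone A := by
      refine monotone_nat_of_le_succ fun k => ?_
      have h2 := (affSys n).length_mul_le (f k) ((P f (k + 1))⁻¹ * w)
      rw [← h1, hlen] at h2
      simp only [hA, Finset.sum_range_succ]
      omega
    have hA0 : A 0 = (affSys n).length w := by simp [hA, hP0]
    have hAN : ∀ k, N ≤ k → A k = (affSys n).length w := by
      intro k hk
      have h2 : ∑ l ∈ Finset.range k, e l = ∑ l ∈ Finset.range N, e l := by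
        refine (Finset.sum_subset (Finset.range_mono hk) fun l _ hl => he l ?_).symm
        simpa using hl
      simp only [hA]
      rw [hPt hf hk, hprod, inv_mul_cancel, CoxeterSystem.length_one, h2, hsum, zero_add]
    have hAk (k) : A k = (affSys n).length w := by
      refine le_antisymm ?_ (hA0 ▸ hAmono (Nat.zero_le k))
      rw [← hAN _ (le_max_left N k)]
      exact hAmono (le_max_right N k)
    have hPlen (k) : (affSys n).length (P f k) ≤ ∑ l ∈ Finset.range k, e l := by
      induction k with
      | zero => simp [hP0]
      | succ k ih =>
        rw [hPs, Finset.sum_range_succ, ← hlen]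
        exact ((affSys n).length_mul_le _ _).trans (by omega)
    refine ⟨?_, h1 k, ?_⟩
    · refine IsRaising.of_mul (u := P f k) hm hmn (by rwa [mul_inv_cancel_left]) ?_
      rw [mul_inv_cancel_left]
      have h2 := hAk k
      have h3 := hPlen k
      have h4 := (affSys n).length_mul_le (P f k) ((P f k)⁻¹ * w)
      rw [mul_inv_cancel_left] at h4
      simp only [hA] at h2
      omega
    · have h2 := hAk k
      have h3 := hAk (k + 1)
      simp only [hA, Finset.sum_range_succ] at h2 h3
      omega
  refine Nat.card_congr (Equiv.ofBijective
    (fun f => ⟨fun k => act ((P f.1 (N - k))⁻¹ * w) (ground m n), ?_⟩) ⟨?_, ?_⟩)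
  · obtain ⟨f, hJ, hlen, hex⟩ := f
    obtain ⟨hf, hprod, hsum⟩ := hchar f hlen hex
    have hv := hv f hlen hf hprod hsum
    have hstrip (k : ℕ) := IsRaising.strip_of_mul (v := (P f (k + 1))⁻¹ * w) hm hmn
      ((hv k).2.1 ▸ (hv k).1) (hJ k).choose_spec (by
        rw [← (hv k).2.1, (hv k).2.2, hlen])
    have hstep (k) : N - (k + 1) + 1 = N - k ∨ N - (k + 1) = N - k := by omega
    refine ⟨?_, fun k => (hv _).1.isConf hm hmn, fun k p => ?_, fun k p => ?_, fun k => ?_,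
      N, fun k hk => ?_⟩
    · simp only [Nat.sub_zero, hprod, inv_mul_cancel, act_one]
    · rcases hstep k with h | h
      · have := (hstrip (N - (k + 1)) p).1
        rw [h, ← h, ← (hv (N - (k + 1))).2.1, h] at this
        exact this
      · simp only [h]; exact le_rfl
    · rcases hstep k with h | h
      · have := (hstrip (N - (k + 1)) p).2
        rw [← (hv (N - (k + 1))).2.1, h] at this
        exact this
      · simp only [h]
        exact ((hv _).1.isConf hm hmn).anti (by omega)
    · simp only
      rw [(hv _).1.charge_eq hm hmn, (hv _).1.charge_eq hm hmn]
      split_ifs with hk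
      · have := (hv (N - (k + 1))).2.2
        rw [show N - (k + 1) + 1 = N - k by omega, show N - (k + 1) = N - 1 - k by omega] at this
        rw [show N - (k + 1) = N - 1 - k by omega, this]
        push_cast
        ring
      · rw [show N - (k + 1) = N - k by omega]; simp
    · simp only [show N - k = 0 by omega, hP0, inv_one, one_mul]
  · rintro ⟨f, hJ, hlen, hex⟩ ⟨f', hJ', hlen', hex'⟩ h
    obtain ⟨hf, hprod, hsum⟩ := hchar f hlen hex
    obtain ⟨hf', hprod', hsum'⟩ := hchar f' hlen' hex'
    have hv1 := hv f hlen hf hprod hsum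
    have hv2 := hv f' hlen' hf' hprod' hsum'
    have h1 (k : ℕ) : act ((P f (N - k))⁻¹ * w) (ground m n) =
        act ((P f' (N - k))⁻¹ * w) (ground m n) := congrFun (Subtype.ext_iff.1 h) k
    have h2 (k : ℕ) (hk : k ≤ N) : P f k = P f' k := by
      have h3 := h1 (N - k)
      rw [show N - (N - k) = k by omega] at h3
      exact inv_injective (mul_right_cancel ((hv1 k).1.eq_of_act_eq hm hmn (hv2 k).1 h3))
    refine Subtype.ext (funext fun k => ?_)
    rcases lt_or_ge k N with hk | hk
    · have h3 := h2 (k + 1) hk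
      rw [hPs, hPs, h2 k hk.le] at h3
      exact mul_left_cancel h3
    · exact (hf k hk).trans (hf' k hk).symm
  · rintro ⟨t, ht⟩
    have htop := ht.eq_top hm (N := N) (fun k hk => if_neg (by omega)) le_rfl
    choose v hvr hvt using fun k => exists_isRaising hm hmn (ht.conf (N - k)) (ht.ground_le (N - k))
    have hv0 : v 0 = w := (hvr 0).eq_of_act_eq hm hmn hw (by rw [hvt]; exact htop)
    have hv1 (k) (hk : N ≤ k) : v k = 1 := by
      refine (hvr k).eq_of_act_eq hm hmn (isRaising_one m) ?_
      rw [hvt, act_one, show N - k = 0 by omega, ht.zero]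
    have hcyc (k) : (∃ J, IsCycDecOn J (v k * (v (k + 1))⁻¹)) ∧
        (affSys n).length (v k * (v (k + 1))⁻¹) + (affSys n).length (v (k + 1)) =
          (affSys n).length (v k) := by
      refine (hvr (k + 1)).exists_isCycDecOn hm hmn (hvr k) (fun p => ?_) fun p => ?_
      · rw [hvt, hvt]; exact ht.mono (by omega) p
      · rw [hvt, hvt]
        rcases lt_or_ge k N with hk | hk
        · have := ht.strip (N - (k + 1)) p
          rwa [show N - (k + 1) + 1 = N - k by omega] at this
        · rw [show N - (k + 1) = N - k by omega]
          exact (ht.conf _).anti (by omega)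
    have hlen (k) : (affSys n).length (v k * (v (k + 1))⁻¹) = e k := by
      have h1 := (hcyc k).2
      rcases lt_or_ge k N with hk | hk
      · have h2 := ht.weight (N - (k + 1))
        rw [show N - (k + 1) + 1 = N - k by omega, ← hvt k, ← hvt (k + 1),
          (hvr _).charge_eq hm hmn, (hvr _).charge_eq hm hmn, if_pos (by omega),
          show N - 1 - (N - (k + 1)) = k by omega] at h2
        omega
      · rw [he k hk, hv1 k hk, hv1 (k + 1) (by omega)]
        simp
    have hPv (k) : P (fun k => v k * (v (k + 1))⁻¹) k = w * (v k)⁻¹ := by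
      induction k with
      | zero => rw [hP0, hv0, mul_inv_cancel]
      | succ k ih => rw [hPs, ih, mul_assoc, inv_mul_cancel_left]
    refine ⟨⟨fun k => v k * (v (k + 1))⁻¹, fun k => (hcyc k).1, hlen, N, fun k hk => ?_, ?_, ?_⟩, ?_⟩
    · change v k * (v (k + 1))⁻¹ = 1
      rw [hv1 k hk, hv1 (k + 1) (by omega), mul_inv_cancel]
    · have := hPv N
      rwa [hv1 N le_rfl, inv_one, mul_one] at this
    · have h1 (k) : ∑ l ∈ Finset.range k, (affSys n).length (v l * (v (l + 1))⁻¹) +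
          (affSys n).length (v k) = (affSys n).length w := by
        induction k with
        | zero => rw [Finset.sum_range_zero, zero_add, hv0]
        | succ k ih =>
          have := (hcyc k).2
          rw [Finset.sum_range_succ]
          omega
      have := h1 N
      rwa [hv1 N le_rfl, CoxeterSystem.length_one, add_zero] at this
    · refine Subtype.ext (funext fun k => ?_)
      simp only
      rw [hPv, mul_inv_rev, inv_inv, inv_mul_cancel_right, hvt]
      rcases le_or_gt k N with hk | hk
      · rw [show N - (N - k) = k by omega]
      · rw [show N - k = 0 by omega, Nat.sub_zero, htop]
        exact (ht.eq_top hm (N := N) (fun k hk => if_neg (by omega)) hk.le).symm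

end raising

/-! ### Cylindric shapes as particle configurations -/

theorem rowLen_bot (j : ℕ) : (⊥ : YoungDiagram).rowLen j = 0 := by
  by_contra h
  exact YoungDiagram.notMem_bot _ (YoungDiagram.mem_iff_lt_rowLen.2 (Nat.pos_of_ne_zero h))

theorem YoungDiagram.ext_rowLen {Y Z : YoungDiagram} (h : ∀ j, Y.rowLen j = Z.rowLen j) : Y = Z := by
  ext ⟨i, j⟩
  rw [YoungDiagram.mem_cells, YoungDiagram.mem_cells, YoungDiagram.mem_iff_lt_rowLen,
    YoungDiagram.mem_iff_lt_rowLen, h]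

theorem BoxPartition.rowLen_eq_zero {m n : ℕ} (lam : BoxPartition m n) {j : ℕ} (hj : m ≤ j) :
    lam.1.rowLen j = 0 := by
  by_contra h
  have h1 := YoungDiagram.mem_iff_lt_colLen.1
    (YoungDiagram.mem_iff_lt_rowLen.2 (Nat.pos_of_ne_zero h))
  have := lam.2.2
  omega

/-- The particle configuration of `λ[r]`. -/
def BoxPartition.conf {m n : ℕ} (lam : BoxPartition m n) (r k : ℤ) : ℤ := lam.seq r k - k

section conf

variable {m n : ℕ}

theorem BoxPartition.conf_apply (lam : BoxPartition m n) (r : ℤ) {j : ℕ} (hj : j < m) :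
    lam.conf r (r + j + 1) = lam.1.rowLen j - j - 1 := by
  have := lam.seq_apply r j hj
  rw [BoxPartition.conf, show r + j + 1 = ((j + 1 : ℕ) : ℤ) + r by push_cast; ring, this]
  push_cast
  ring

theorem BoxPartition.conf_periodic (hm : 0 < m) (lam : BoxPartition m n) (r k : ℤ) :
    lam.conf r (k + m) = lam.conf r k - n := by
  have := lam.seq_periodic hm r k
  simp only [BoxPartition.conf]
  omega

theorem exists_eq_add_add_mul {m : ℕ} (hm : 0 < m) (r k : ℤ) :
    ∃ j < m, ∃ t : ℤ, k = r + j + 1 + m * t := by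
  obtain ⟨j, hj, t, ht⟩ := exists_eq_add_mul_of_pos hm (k - r)
  exact ⟨j, hj, t, by omega⟩

theorem BoxPartition.isConf (hm : 0 < m) (hmn : m < n) (lam : BoxPartition m n) (r : ℤ) :
    IsConf m n (lam.conf r) := by
  refine IsConf.of_succ_lt (fun k => ?_) (lam.conf_periodic hm r)
  obtain ⟨j, hj, t, rfl⟩ := exists_eq_add_add_mul hm r k
  rw [add_right_comm _ (m * t : ℤ), periodic_mul (lam.conf_periodic hm r),
    periodic_mul (lam.conf_periodic hm r), lam.conf_apply r hj]
  rcases (show j + 1 ≤ m from hj).lt_or_eq with hj' | hj'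
  · have h1 := lam.conf_apply r hj'
    rw [show r + ((j + 1 : ℕ) : ℤ) + 1 = r + j + 1 + 1 by push_cast; ring] at h1
    rw [h1]
    have := lam.1.rowLen_anti j (j + 1) (by omega)
    push_cast
    omega
  · have h1 := lam.conf_periodic hm r (r + 1)
    have h2 := lam.conf_apply r hm
    have h3 := lam.2.1
    rw [Nat.cast_zero, add_zero] at h2
    rw [show r + (j : ℤ) + 1 + 1 = r + 1 + m by omega, h1, h2]
    omega

/-- The number `r` is determined by the configuration of `λ[r]`. -/
theorem BoxPartition.conf_bounds (hm : 0 < m) (hmn : m < n) (lam : BoxPartition m n) (r : ℤ) :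
    lam.conf r (r + 1) < n - m ∧ (n : ℤ) - m ≤ lam.conf r r := by
  have h1 := lam.conf_apply r hm
  rw [Nat.cast_zero, add_zero] at h1
  have h2 := lam.conf_apply r (show m - 1 < m by omega)
  have h3 := lam.conf_periodic hm r r
  rw [show r + ((m - 1 : ℕ) : ℤ) + 1 = r + m by omega] at h2
  have h4 := lam.2.1
  omega

theorem BoxPartition.conf_injective (hm : 0 < m) (hmn : m < n) {lam lam' : BoxPartition m n}
    {r r' : ℤ} (h : lam.conf r = lam'.conf r') : lam = lam' ∧ r = r' := by
  have h1 := lam.conf_bounds hm hmn r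
  have h2 := lam'.conf_bounds hm hmn r'
  have hc := lam'.isConf hm hmn r'
  rw [h] at h1
  have h3 : r' < r + 1 := hc.anti.lt_iff_gt.1 (by omega)
  have h4 : r < r' + 1 := hc.anti.lt_iff_gt.1 (by omega)
  obtain rfl : r = r' := by omega
  refine ⟨Subtype.ext (YoungDiagram.ext_rowLen fun j => ?_), rfl⟩
  rcases lt_or_ge j m with hj | hj
  · have h5 := lam.conf_apply r hj
    rw [h, lam'.conf_apply r hj] at h5
    omega
  · rw [lam.rowLen_eq_zero hj, lam'.rowLen_eq_zero hj]

theorem IsConf.exists_boxPartition (hm : 0 < m) {b : ℤ → ℤ} (hb : IsConf m n b) :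
    ∃ (lam : BoxPartition m n) (r : ℤ), lam.conf r = b := by
  obtain ⟨r, hr, hr'⟩ := hb.exists_gap (n - m - 1)
  set f : ℕ → ℕ := fun j => (b (r + j + 1) + j + 1).toNat with hf
  have hfb (j : ℕ) (hj : j < m) : (f j : ℤ) = b (r + j + 1) + j + 1 := by
    have h1 := hb.le_sub (show r + j + 1 ≤ r + m by omega)
    have h2 := hb.periodic r
    simp only [hf]
    omega
  have hfanti (i j : ℕ) (hij : i ≤ j) (hj : j < m) : f j ≤ f i := by
    have h1 := hb.le_sub (show r + i + 1 ≤ r + j + 1 by omega)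
    have h2 := hfb i (by omega)
    have h3 := hfb j hj
    omega
  let Y : YoungDiagram :=
    { cells := (Finset.range m).biUnion fun i => (Finset.range (f i)).image fun j => (i, j)
      isLowerSet := by
        rintro ⟨i, j⟩ ⟨i', j'⟩ ⟨hi, hj⟩ h
        simp only [Finset.coe_biUnion, Finset.coe_range, Set.mem_Iio, Finset.coe_image,
          Set.mem_iUnion, Set.mem_image, Prod.mk.injEq, exists_prop] at h ⊢
        obtain ⟨_, h1, _, h2, rfl, rfl⟩ := h
        simp only at hi hj
        exact ⟨i', by omega, j', lt_of_lt_of_le (by omega) (hfanti i' _ hi h1), rfl, rfl⟩ }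
  have hY (i j : ℕ) : (i, j) ∈ Y ↔ i < m ∧ j < f i := by
    rw [← YoungDiagram.mem_cells]
    simp [Y]
  have hrow (i : ℕ) (hi : i < m) : Y.rowLen i = f i := by
    refine le_antisymm ?_ ?_
    · by_contra h
      have h1 := (hY i (f i)).1 (YoungDiagram.mem_iff_lt_rowLen.2 (by omega))
      omega
    · by_contra h
      have h1 := YoungDiagram.mem_iff_lt_rowLen.1 ((hY i (Y.rowLen i)).2 ⟨hi, by omega⟩)
      omega
  have hbox : Y.rowLen 0 ≤ n - m ∧ Y.colLen 0 ≤ m := by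
    constructor
    · rw [hrow 0 hm]
      have := hfb 0 hm
      simp only [Nat.cast_zero, add_zero] at this
      omega
    · by_contra h
      have h1 := (hY m 0).1 (YoungDiagram.mem_iff_lt_colLen.2 (by omega))
      omega
  obtain ⟨lam, hlam⟩ : ∃ lam : BoxPartition m n, ∀ i < m, lam.1.rowLen i = f i :=
    ⟨(⟨Y, hbox⟩ : BoxPartition m n), hrow⟩
  refine ⟨lam, r, funext fun k => ?_⟩
  obtain ⟨j, hj, t, rfl⟩ := exists_eq_add_add_mul hm r k
  rw [periodic_mul hb.periodic, periodic_mul (lam.conf_periodic hm r), lam.conf_apply _ hj,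
    hlam j hj, hfb j hj]
  ring

theorem BoxPartition.conf_empty (m n : ℕ) : (BoxPartition.empty m n).conf 0 = ground m n := by
  funext k
  simp only [BoxPartition.conf, BoxPartition.seq, BoxPartition.empty, rowLen_bot, ground]
  ring_nf

end conf

/-- The particle configuration of the outer sequence of a cylindric shape. -/
def CylShape.conf {m n : ℕ} (x : CylShape m n) : ℤ → ℤ := x.lam.conf x.r

section straight

variable {m n : ℕ} {x y : CylShape m n}

theorem CylShape.isConf (hm : 0 < m) (hmn : m < n) (x : CylShape m n) : IsConf m n x.conf :=
  x.lam.isConf hm hmn x.r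

theorem ground_le_conf (hx : x ∈ straightShapes m n) : ground m n ≤ x.conf := by
  intro k
  rw [← BoxPartition.conf_empty]
  have := x.le k
  rw [hx.2.1, hx.2.2] at this
  simp only [CylShape.conf, BoxPartition.conf]
  omega

theorem mem_straightShapes (hm : 0 < m) (hmn : m < n) (h₁ : x.mu = BoxPartition.empty m n)
    (h₂ : x.s = 0) : x ∈ straightShapes m n := by
  refine ⟨?_, h₁, h₂⟩
  by_contra hr
  have h3 := (x.lam.conf_bounds hm hmn x.r).1
  have h4 := (x.isConf hm hmn).anti.antitone (show x.r + 1 ≤ 0 by omega)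
  have h5 := x.le 0
  have h6 := congrFun (BoxPartition.conf_empty m n) 0
  have h7 := (isConf_ground hm hmn).periodic 0
  rw [zero_add, ground_of_mem (by omega) le_rfl] at h7
  rw [h₁, h₂] at h5
  simp only [CylShape.conf, BoxPartition.conf] at h3 h4 h6
  omega

theorem eq_of_conf_eq (hm : 0 < m) (hmn : m < n) (hx : x ∈ straightShapes m n)
    (hy : y ∈ straightShapes m n) (h : x.conf = y.conf) : x = y := by
  obtain ⟨h1, h2⟩ := BoxPartition.conf_injective hm hmn h
  exact CylShape.ext h1 h2 (hx.2.1.trans hy.2.1.symm) (hx.2.2.trans hy.2.2.symm)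

theorem exists_straightShape (hm : 0 < m) (hmn : m < n) {b : ℤ → ℤ} (hb : IsConf m n b)
    (hgb : ground m n ≤ b) : ∃ x ∈ straightShapes m n, x.conf = b := by
  obtain ⟨lam, r, rfl⟩ := hb.exists_boxPartition hm
  refine ⟨⟨lam, r, BoxPartition.empty m n, 0, fun k => ?_⟩, mem_straightShapes hm hmn rfl rfl, rfl⟩
  have := hgb k
  rw [← BoxPartition.conf_empty] at this
  simp only [BoxPartition.conf] at this
  omega

theorem empty_mem_straightShapes (m n : ℕ) : CylShape.empty m n ∈ straightShapes m n :=
  ⟨le_rfl, rfl, rfl⟩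

theorem conf_empty (m n : ℕ) : (CylShape.empty m n).conf = ground m n :=
  BoxPartition.conf_empty m n

/-- The box in row `p` whose diagonal is numbered by `z`. In the row of a particle, the number of the
diagonal of a box is the position that the particle reaches when the box is added. -/
def cell (m n : ℕ) (p z : ℤ) : Cylinder m n := Cylinder.box p (z + p)

theorem box_eq_cell (p q : ℤ) : (Cylinder.box p q : Cylinder m n) = cell m n p (q - p) := by
  rw [cell, sub_add_cancel]

theorem cell_eq_iff {p z p' z' : ℤ} :
    cell m n p z = cell m n p' z' ↔ ∃ t : ℤ, p' = p + m * t ∧ z' = z - n * t := by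
  rw [cell, cell, Cylinder.box, Cylinder.box, QuotientAddGroup.eq, AddSubgroup.mem_zmultiples_iff]
  constructor
  · rintro ⟨t, ht⟩
    simp only [Prod.smul_mk, smul_eq_mul, Prod.neg_mk, Prod.mk_add_mk, Prod.mk.injEq] at ht
    refine ⟨-t, by linarith, by linarith⟩
  · rintro ⟨t, rfl, rfl⟩
    refine ⟨-t, ?_⟩
    simp only [Prod.smul_mk, smul_eq_mul, Prod.neg_mk, Prod.mk_add_mk, Prod.mk.injEq]
    constructor <;> ring

theorem exists_eq_cell (c : Cylinder m n) : ∃ p z, c = cell m n p z := by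
  obtain ⟨⟨i, j⟩, rfl⟩ := QuotientAddGroup.mk_surjective c
  exact ⟨i, j - i, box_eq_cell i j⟩

theorem cell_mem_diagram (hm : 0 < m) (hmn : m < n) (hx : x ∈ straightShapes m n) {p z : ℤ} :
    cell m n p z ∈ x.diagram ↔ ground m n p < z ∧ z ≤ x.conf p := by
  have hseq (i : ℤ) : x.mu.seq x.s i = ground m n i + i := by
    rw [hx.2.1, hx.2.2, ← BoxPartition.conf_empty, BoxPartition.conf]; ring
  have hseq' (i : ℤ) : x.lam.seq x.r i = x.conf i + i := by
    rw [CylShape.conf, BoxPartition.conf]; ring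
  constructor
  · rintro ⟨i, j, h, h1, h2⟩
    rw [box_eq_cell, cell_eq_iff] at h
    obtain ⟨t, rfl, ht⟩ := h
    rw [hseq, periodic_mul (isConf_ground hm hmn).periodic] at h1
    rw [hseq', periodic_mul (x.isConf hm hmn).periodic] at h2
    omega
  · rintro ⟨h1, h2⟩
    exact ⟨p, z + p, rfl, by rw [hseq]; omega, by rw [hseq']; omega⟩

theorem diagram_subset_iff (hm : 0 < m) (hmn : m < n) (hx : x ∈ straightShapes m n)
    (hy : y ∈ straightShapes m n) : x.diagram ⊆ y.diagram ↔ x.conf ≤ y.conf := by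
  constructor
  · intro h p
    have h1 : ground m n p ≤ x.conf p := ground_le_conf hx p
    have h2 : ground m n p ≤ y.conf p := ground_le_conf hy p
    rcases h1.eq_or_lt with h3 | h3
    · rw [← h3]; exact h2
    · exact ((cell_mem_diagram hm hmn hy).1
        (h ((cell_mem_diagram hm hmn hx).2 ⟨h3, le_rfl⟩))).2
  · intro h c hc
    obtain ⟨p, z, rfl⟩ := exists_eq_cell c
    rw [cell_mem_diagram hm hmn hx] at hc
    exact (cell_mem_diagram hm hmn hy).2 ⟨hc.1, hc.2.trans (h p)⟩

variable [Fact (1 < n)]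

theorem addsBox_of_allowed (hm : 0 < m) (hmn : m < n) (hx : x ∈ straightShapes m n)
    (hy : y ∈ straightShapes m n) {i : ZMod n} (h : Allowed [i] x.conf)
    (h' : y.conf = act ((affSys n).simple i) x.conf) : CylShape.AddsBox i x y := by
  rw [allowed_singleton] at h
  have hst := act_simple_of_occ h.2
  rw [← h'] at hst
  obtain ⟨p, hp⟩ := h.1
  have hpi : ((x.conf p + 1 : ℤ) : ZMod n) = i := by push_cast; rw [hp]; ring
  have hyp : y.conf p = x.conf p + 1 := by rw [h', act_simple, affSwap_of_eq_sub_one hp]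
  have hgp : ground m n p ≤ x.conf p := ground_le_conf hx p
  refine ⟨hy.2.1.trans hx.2.1.symm, hy.2.2.trans hx.2.2.symm, p, x.conf p + 1 + p, ?_, ?_, ?_⟩
  · rwa [add_sub_cancel_right]
  · rw [box_eq_cell, add_sub_cancel_right, cell_mem_diagram hm hmn hx]
    omega
  · rw [box_eq_cell, add_sub_cancel_right]
    ext c
    obtain ⟨k, z, rfl⟩ := exists_eq_cell c
    rw [Set.mem_insert_iff, cell_mem_diagram hm hmn hx, cell_mem_diagram hm hmn hy]
    constructor
    · rintro ⟨h1, h2⟩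
      rcases hst k with h3 | h3
      · exact Or.inr ⟨h1, by omega⟩
      · by_cases h4 : z ≤ x.conf k
        · exact Or.inr ⟨h1, h4⟩
        · left
          obtain ⟨t, ht, ht'⟩ := (x.isConf hm hmn).isPeriodicInj.eq_of_cast_eq (h3.2.trans hp.symm)
          exact cell_eq_iff.2 ⟨t, ht, by omega⟩
    · rintro (h1 | h1)
      · obtain ⟨t, rfl, ht⟩ := cell_eq_iff.1 h1
        rw [periodic_mul (x.isConf hm hmn).periodic] at ht hgp
        rw [periodic_mul (y.isConf hm hmn).periodic, periodic_mul (x.isConf hm hmn).periodic] at hyp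
        rw [periodic_mul (isConf_ground hm hmn).periodic] at hgp
        omega
      · have := le_act_simple h.2 k
        rw [← h'] at this
        exact ⟨h1.1, h1.2.trans this⟩

theorem conf_of_addsBox (hm : 0 < m) (hmn : m < n) (hx : x ∈ straightShapes m n)
    {i : ZMod n} (h : CylShape.AddsBox i x y) : y ∈ straightShapes m n ∧
      y.conf = act ((affSys n).simple i) x.conf := by
  obtain ⟨hmu, hs, p, q, hpq, hnot, hins⟩ := h
  have hy : y ∈ straightShapes m n :=
    mem_straightShapes hm hmn (hmu.trans hx.2.1) (hs.trans hx.2.2)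
  refine ⟨hy, ?_⟩
  obtain ⟨z, rfl⟩ : ∃ z, q = z + p := ⟨q - p, by ring⟩
  rw [add_sub_cancel_right] at hpq
  rw [box_eq_cell, add_sub_cancel_right] at hnot hins
  have hxc := x.isConf hm hmn
  have hyc := y.isConf hm hmn
  have hxy (k : ℤ) : x.conf k ≤ y.conf k :=
    (diagram_subset_iff hm hmn hx hy).1 (hins ▸ Set.subset_insert _ _) k
  have hnew (k z' : ℤ) (h1 : x.conf k < z') (h2 : z' ≤ y.conf k) :
      ∃ t : ℤ, p = k + m * t ∧ z = z' - n * t := by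
    have h3 : cell m n k z' ∈ y.diagram := (cell_mem_diagram hm hmn hy).2
      ⟨lt_of_le_of_lt (ground_le_conf hx k) h1, h2⟩
    rw [hins] at h3
    rcases h3 with h3 | h3
    · exact cell_eq_iff.1 h3
    · have := ((cell_mem_diagram hm hmn hx).1 h3).2
      omega
  have hpz : cell m n p z ∈ y.diagram := by rw [hins]; exact Set.mem_insert _ _
  rw [cell_mem_diagram hm hmn hy] at hpz
  rw [cell_mem_diagram hm hmn hx] at hnot
  -- The new boxes of a row all represent the same box, so there is only one of them.
  have huniq (k z' : ℤ) (h1 : x.conf k < z') (h2 : z' ≤ y.conf k) :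
      z' = x.conf k + 1 ∧ y.conf k = z' := by
    obtain ⟨t, ht, ht'⟩ := hnew k z' h1 h2
    have key (z'' : ℤ) (h3 : x.conf k < z'') (h4 : z'' ≤ y.conf k) : z'' = z' := by
      obtain ⟨s, hs, hs'⟩ := hnew k z'' h3 h4
      have h5 : (m : ℤ) * t = m * s := by omega
      have h6 : t = s := mul_left_cancel₀ (by omega) h5
      subst h6
      omega
    exact ⟨(key _ (by omega) (by omega)).symm, key _ (by omega) le_rfl⟩
  have hp := huniq p z (by omega) hpz.2
  have hocc : (x.conf p : ZMod n) = i - 1 := by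
    rw [← hpq, hp.1]; push_cast; ring
  funext k
  rw [act_simple]
  by_cases h1 : (x.conf k : ZMod n) = i - 1
  · rw [affSwap_of_eq_sub_one h1]
    obtain ⟨t, rfl, -⟩ := hxc.isPeriodicInj.eq_of_cast_eq (hocc.trans h1.symm)
    rw [periodic_mul hxc.periodic, periodic_mul hyc.periodic]
    omega
  · have h2 : y.conf k = x.conf k := by
      by_contra hne
      have h3 := hxy k
      obtain ⟨t, rfl, -⟩ := hnew k (y.conf k) (by omega) le_rfl
      rw [periodic_mul hxc.periodic] at hocc
      exact h1 (by rw [← hocc]; simp)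
    rw [h2, affSwap_of_ne h1]
    intro h3
    -- Otherwise the new particle at `z` would coincide with the particle `k`.
    obtain ⟨t, ht, ht'⟩ := hyc.isPeriodicInj.eq_of_cast_eq (p := k) (q := p)
      (by rw [h2, h3, hp.2, hpq])
    rw [ht, periodic_mul hxc.periodic] at hocc
    exact h1 (by rw [← hocc]; simp)

theorem actGen_eq_some (hm : 0 < m) (hmn : m < n) (hx : x ∈ straightShapes m n) {i : ZMod n}
    (h : Allowed [i] x.conf) : ∃ y ∈ straightShapes m n, CylShape.actGen i x = some y ∧
      y.conf = act ((affSys n).simple i) x.conf := by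
  have h2 := h
  rw [allowed_singleton] at h2
  obtain ⟨y, hy, hyx⟩ := exists_straightShape hm hmn ((x.isConf hm hmn).act_simple h2.2)
    ((ground_le_conf hx).trans (le_act_simple h2.2))
  have hex : ∃ y, CylShape.AddsBox i x y := ⟨y, addsBox_of_allowed hm hmn hx hy h hyx⟩
  obtain ⟨h3, h4⟩ := conf_of_addsBox hm hmn hx hex.choose_spec
  exact ⟨_, h3, by rw [CylShape.actGen, dif_pos hex], h4⟩

theorem actWord_eq_some (hm : 0 < m) (hmn : m < n) {ω : List (ZMod n)}
    (hω : Allowed ω (ground m n)) : ∃ y ∈ straightShapes m n,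
      CylShape.actWord ω (CylShape.empty m n) = some y ∧
        y.conf = act ((affSys n).wordProd ω) (ground m n) := by
  induction ω with
  | nil => exact ⟨_, empty_mem_straightShapes m n, rfl, by simp [conf_empty, act_one]⟩
  | cons i ω ih =>
    obtain ⟨x, hx, h1, h2⟩ := ih hω.1
    obtain ⟨y, hy, h3, h4⟩ := actGen_eq_some (i := i) hm hmn hx
      (by rw [allowed_singleton, h2]; exact hω.2)
    refine ⟨y, hy, ?_, by rw [h4, h2, act_cons]⟩
    rw [CylShape.actWord, h1, Option.bind_some, h3]

end straight

/-! ### Semistandard tableaux as flags -/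

theorem exists_cut {a b : ℤ} (hab : a ≤ b) {Q : ℤ → Prop}
    (hQ : ∀ z, a < z → z + 1 ≤ b → Q (z + 1) → Q z) :
    ∃ v, a ≤ v ∧ v ≤ b ∧ ∀ z, a < z → z ≤ b → (Q z ↔ z ≤ v) := by
  obtain ⟨v, ⟨h1, h2, h3⟩, h4⟩ := Int.exists_greatest_of_bdd
    (P := fun v => a ≤ v ∧ v ≤ b ∧ (a < v → Q v)) ⟨b, fun v hv => hv.2.1⟩
    ⟨a, le_rfl, hab, fun h => absurd h (lt_irrefl a)⟩
  have hdown (d : ℕ) (hd : a < v - d) : Q (v - d) := by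
    induction d with
    | zero => rw [Nat.cast_zero, sub_zero] at hd ⊢; exact h3 hd
    | succ d ih =>
      refine hQ _ hd (by push_cast; omega) ?_
      rw [show v - ((d + 1 : ℕ) : ℤ) + 1 = v - d by push_cast; ring]
      exact ih (by push_cast at hd; omega)
  refine ⟨v, h1, h2, fun z hz hz' => ⟨fun h => h4 z ⟨hz.le, hz', fun _ => h⟩, fun h => ?_⟩⟩
  have := hdown (v - z).toNat (by omega)
  rwa [show v - ((v - z).toNat : ℤ) = z by omega] at this

theorem cut_unique {a b v v' : ℤ} {Q : ℤ → Prop} (h₁ : a ≤ v) (h₂ : v ≤ b)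
    (h : ∀ z, a < z → z ≤ b → (Q z ↔ z ≤ v)) (h₁' : a ≤ v') (h₂' : v' ≤ b)
    (h' : ∀ z, a < z → z ≤ b → (Q z ↔ z ≤ v')) : v = v' := by
  rcases lt_trichotomy v v' with hlt | heq | hlt
  · have := (h v' (by omega) h₂').1 ((h' v' (by omega) h₂').2 le_rfl)
    omega
  · exact heq
  · have := (h' v (by omega) h₂).1 ((h v (by omega) h₂).2 le_rfl)
    omega

section tableaux

variable {m n : ℕ} {x : CylShape m n}

/-- `t k` is the configuration of the boxes with entries less than `k` in the filling `T`. -/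
def IsLevel (x : CylShape m n) (T : x.diagram → ℕ) (t : ℕ → ℤ → ℤ) : Prop :=
  ∀ (k : ℕ) (p z : ℤ) (h : cell m n p z ∈ x.diagram), T ⟨_, h⟩ < k ↔ z ≤ t k p

/-- The filling with the entry `k` in the boxes of `t (k + 1)` that are not in `t k`. -/
noncomputable def levelFilling (x : CylShape m n) (t : ℕ → ℤ → ℤ) (c : x.diagram) : ℕ :=
  sInf {k | ∃ p z, c = cell m n p z ∧ z ≤ t (k + 1) p}

theorem IsFlag.isLevel_levelFilling (hm : 0 < m) (hmn : m < n) (hx : x ∈ straightShapes m n)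
    {e : ℕ → ℕ} {t : ℕ → ℤ → ℤ} (ht : IsFlag m n e x.conf t) : IsLevel x (levelFilling x t) t := by
  intro k p z h
  have hz := (cell_mem_diagram hm hmn hx).1 h
  have hset : {k | ∃ p' z', cell m n p z = cell m n p' z' ∧ z' ≤ t (k + 1) p'} =
      {k | z ≤ t (k + 1) p} := by
    ext l
    constructor
    · rintro ⟨p', z', h1, h2⟩
      obtain ⟨s, rfl, rfl⟩ := cell_eq_iff.1 h1
      rw [periodic_mul (ht.conf _).periodic] at h2
      change z ≤ _
      omega
    · intro h1
      exact ⟨p, z, rfl, h1⟩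
  have hne : {k | z ≤ t (k + 1) p}.Nonempty := by
    obtain ⟨N, hN⟩ := ht.top
    exact ⟨N, by change z ≤ _; rw [hN _ (by omega)]; exact hz.2⟩
  rw [levelFilling, hset]
  constructor
  · intro h1
    exact (show z ≤ _ from Nat.sInf_mem hne).trans (ht.mono h1 p)
  · intro h1
    cases k with
    | zero => rw [ht.zero] at h1; omega
    | succ k => exact Nat.lt_succ_of_le (Nat.sInf_le h1)

theorem IsLevel.filling_unique {T T' : x.diagram → ℕ} {t : ℕ → ℤ → ℤ} (h : IsLevel x T t)
    (h' : IsLevel x T' t) : T = T' := by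
  funext ⟨c, hc⟩
  obtain ⟨p, z, rfl⟩ := exists_eq_cell c
  refine eq_of_forall_gt_iff fun k => ?_
  rw [h k p z hc, h' k p z hc]

theorem IsLevel.flag_unique (hm : 0 < m) (hmn : m < n) (hx : x ∈ straightShapes m n)
    {T : x.diagram → ℕ} {t t' : ℕ → ℤ → ℤ} (h : IsLevel x T t) (h' : IsLevel x T t')
    (ht : ∀ k, ground m n ≤ t k ∧ t k ≤ x.conf) (ht' : ∀ k, ground m n ≤ t' k ∧ t' k ≤ x.conf) :
    t = t' := by
  funext k p
  refine cut_unique (Q := fun z => ∃ hc : cell m n p z ∈ x.diagram, T ⟨_, hc⟩ < k)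
    ((ht k).1 p) ((ht k).2 p) (fun z h1 h2 => ?_) ((ht' k).1 p) ((ht' k).2 p) (fun z h1 h2 => ?_)
  · have hc := (cell_mem_diagram hm hmn hx).2 ⟨h1, h2⟩
    rw [← h k p z hc]
    exact ⟨fun ⟨_, h3⟩ => h3, fun h3 => ⟨hc, h3⟩⟩
  · have hc := (cell_mem_diagram hm hmn hx).2 ⟨h1, h2⟩
    rw [← h' k p z hc]
    exact ⟨fun ⟨_, h3⟩ => h3, fun h3 => ⟨hc, h3⟩⟩

theorem IsLevel.isSemistandard {T : x.diagram → ℕ} {t : ℕ → ℤ → ℤ} (h : IsLevel x T t)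
    (ht : ∀ k p, t (k + 1) p < t k (p - 1)) : x.IsSemistandard T := by
  constructor
  · intro i j h1 h2
    simp only [box_eq_cell] at h1 h2 ⊢
    have h3 := (h _ _ _ h2).1 (Nat.lt_add_one _)
    exact Nat.lt_add_one_iff.1 ((h _ _ _ h1).2 (by omega))
  · intro i j h1 h2
    simp only [box_eq_cell] at h1 h2 ⊢
    have h3 := (h _ _ _ h2).1 (Nat.lt_add_one _)
    have h4 := ht (T ⟨_, h2⟩) (i + 1)
    rw [add_sub_cancel_right] at h4
    exact (h _ _ _ h1).2 (by omega)

/-- The boxes with entry `k` lie, row by row, between the configurations `t k` and `t (k + 1)`. -/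
theorem IsLevel.charge_eq (hm : 0 < m) (hmn : m < n) (hx : x ∈ straightShapes m n)
    {T : x.diagram → ℕ} {t : ℕ → ℤ → ℤ} (h : IsLevel x T t) {k : ℕ}
    (hper : ∀ l p, t l (p + m) = t l p - n) (hle : ∀ p, t k p ≤ t (k + 1) p)
    (ht : ∀ k, ground m n ≤ t k ∧ t k ≤ x.conf) :
    charge m (t (k + 1)) = charge m (t k) + Nat.card {c // T c = k} := by
  set S : Finset (Σ _ : ℕ, ℤ) :=
    (Finset.range m).sigma fun q => Finset.Ioc (t k (q + 1)) (t (k + 1) (q + 1)) with hS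
  have hmem (s : S) : s.1.1 < m ∧ t k (s.1.1 + 1) < s.1.2 ∧ s.1.2 ≤ t (k + 1) (s.1.1 + 1) := by
    obtain ⟨h1, h2⟩ := Finset.mem_sigma.1 s.2
    exact ⟨Finset.mem_range.1 h1, Finset.mem_Ioc.1 h2⟩
  have hcell (s : S) : cell m n (s.1.1 + 1) s.1.2 ∈ x.diagram := by
    obtain ⟨-, h2, h3⟩ := hmem s
    exact (cell_mem_diagram hm hmn hx).2
      ⟨lt_of_le_of_lt ((ht k).1 _) h2, h3.trans ((ht (k + 1)).2 _)⟩
  have hiff {p z : ℤ} (hc : cell m n p z ∈ x.diagram) :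
      T ⟨_, hc⟩ = k ↔ t k p < z ∧ z ≤ t (k + 1) p := by
    have h1 := h k p z hc
    have h2 := h (k + 1) p z hc
    omega
  have hcard : Nat.card {c // T c = k} = S.card := by
    rw [← Nat.card_eq_finsetCard]
    refine (Nat.card_congr (Equiv.ofBijective
      (fun s : S => (⟨⟨_, hcell s⟩, (hiff (hcell s)).2 (hmem s).2⟩ : {c // T c = k})) ⟨?_, ?_⟩)).symm
    · intro s s' hss
      have h1 : cell m n (s.1.1 + 1) s.1.2 = cell m n (s'.1.1 + 1) s'.1.2 :=
        congrArg (fun c => c.1.1) hss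
      obtain ⟨r, hr, hr'⟩ := cell_eq_iff.1 h1
      have h2 := hmem s
      have h3 := hmem s'
      have h4 : r = 0 := by
        have h5 : (m : ℤ) * r < m * 1 := by omega
        have h6 : (m : ℤ) * (-1) < m * r := by omega
        have h7 := lt_of_mul_lt_mul_left h5 (by omega)
        have h8 := lt_of_mul_lt_mul_left h6 (by omega)
        omega
      subst h4
      obtain ⟨⟨q, z⟩, hs⟩ := s
      obtain ⟨⟨q', z'⟩, hs'⟩ := s'
      simp only [mul_zero, add_zero, sub_zero] at hr hr'
      obtain rfl : q' = q := by omega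
      obtain rfl : z' = z := hr'
      rfl
    · rintro ⟨⟨c, hc⟩, hk⟩
      obtain ⟨p, z, rfl⟩ := exists_eq_cell c
      rw [hiff hc] at hk
      obtain ⟨q, hq, r, rfl⟩ := exists_eq_add_mul_of_pos hm p
      rw [periodic_mul (hper k), periodic_mul (hper (k + 1))] at hk
      refine ⟨⟨⟨q, z + n * r⟩, ?_⟩, ?_⟩
      · rw [hS, Finset.mem_sigma, Finset.mem_range, Finset.mem_Ioc]
        exact ⟨hq, by simp only; omega, by simp only; omega⟩
      · refine Subtype.ext (Subtype.ext ?_)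
        exact cell_eq_iff.2 ⟨r, rfl, by ring⟩
  rw [hcard, hS, Finset.card_sigma]
  simp only [charge, Int.card_Ioc]
  push_cast
  rw [← Finset.sum_add_distrib]
  refine Finset.sum_congr rfl fun q _ => ?_
  have := hle (q + 1)
  omega

theorem exists_isFlag (hm : 0 < m) (hmn : m < n) (hx : x ∈ straightShapes m n)
    {T : x.diagram → ℕ} (hT : x.IsSemistandard T) {e : ℕ → ℕ}
    (he : ∀ k, Nat.card {c // T c = k} = e k) :
    ∃ t, IsFlag m n e x.conf t ∧ IsLevel x T t := by
  have hg := isConf_ground hm hmn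
  have hxc := x.isConf hm hmn
  have hgx := ground_le_conf hx
  have hmem {p z : ℤ} (h1 : ground m n p < z) (h2 : z ≤ x.conf p) : cell m n p z ∈ x.diagram :=
    (cell_mem_diagram hm hmn hx).2 ⟨h1, h2⟩
  have hcongr {c c' : Cylinder m n} (hcc : c = c') (h : c ∈ x.diagram) (h' : c' ∈ x.diagram) :
      T ⟨c, h⟩ = T ⟨c', h'⟩ := by
    subst hcc; rfl
  have hrow {p z : ℤ} (h : cell m n p z ∈ x.diagram) (h' : cell m n p (z + 1) ∈ x.diagram) :
      T ⟨_, h⟩ ≤ T ⟨_, h'⟩ := by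
    have h1 : cell m n p (z + 1) = Cylinder.box p (z + p + 1) := by rw [cell, add_right_comm]
    rw [hcongr h1 h' (h1 ▸ h')]
    exact hT.1 p (z + p) h (h1 ▸ h')
  have hcol {p z : ℤ} (h : cell m n (p - 1) (z + 1) ∈ x.diagram) (h' : cell m n p z ∈ x.diagram) :
      T ⟨_, h⟩ < T ⟨_, h'⟩ := by
    have h1 : cell m n (p - 1) (z + 1) = Cylinder.box (p - 1) (z + p) := by
      rw [cell]; congr 1; ring
    have h3 : cell m n p z = Cylinder.box (p - 1 + 1) (z + p) := by rw [cell, sub_add_cancel]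
    rw [hcongr h1 h (h1 ▸ h), hcongr h3 h' (h3 ▸ h')]
    exact hT.2 (p - 1) (z + p) (h1 ▸ h) (h3 ▸ h')
  choose t ht1 ht2 ht3 using fun (k : ℕ) (p : ℤ) => exists_cut (hgx p)
    (Q := fun z => ∃ hc : cell m n p z ∈ x.diagram, T ⟨_, hc⟩ < k) (by
      rintro z h1 h2 ⟨hc, h3⟩
      exact ⟨hmem h1 (by omega), lt_of_le_of_lt (hrow _ _) h3⟩)
  have hlevel : IsLevel x T t := by
    intro k p z hc
    have hz := (cell_mem_diagram hm hmn hx).1 hc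
    rw [← ht3 k p z hz.1 hz.2]
    exact ⟨fun h => ⟨hc, h⟩, fun ⟨_, h⟩ => h⟩
  have hper (k : ℕ) (p : ℤ) : t k (p + m) = t k p - n := by
    have h0 := ht1 k (p + m)
    have h0' := ht2 k (p + m)
    rw [hg.periodic] at h0
    rw [hxc.periodic] at h0'
    have h1 := cut_unique (v' := t k (p + m) + n) (ht1 k p) (ht2 k p) (ht3 k p) (by omega)
      (by omega) fun z h2 h3 => by
        have h4 : cell m n p z = cell m n (p + m) (z - n) := cell_eq_iff.2 ⟨1, by ring, by ring⟩
        have h5 := ht3 k (p + m) (z - n) (by rw [hg.periodic]; omega) (by rw [hxc.periodic]; omega)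
        rw [h4, h5]
        omega
    omega
  have hsucc (k : ℕ) (p : ℤ) : t k p ≤ t (k + 1) p := by
    rcases (ht1 k p).eq_or_lt with h1 | h1
    · rw [← h1]; exact ht1 _ _
    · have hc := hmem h1 (ht2 k p)
      have h2 := (hlevel k p _ hc).2 le_rfl
      exact (hlevel (k + 1) p _ hc).1 (by omega)
  have hstrip (k : ℕ) (p : ℤ) : t (k + 1) p < t k (p - 1) := by
    by_contra! h
    have h1 := ht1 k (p - 1)
    have h2 := ht2 (k + 1) p
    have h3 := hg.anti (show p - 1 < p by omega)
    have h4 := hxc.anti (show p - 1 < p by omega)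
    have hc : cell m n p (t k (p - 1)) ∈ x.diagram := hmem (by omega) (by omega)
    have hc' : cell m n (p - 1) (t k (p - 1) + 1) ∈ x.diagram := hmem (by omega) (by omega)
    have h5 := hcol hc' hc
    have h6 := (hlevel (k + 1) p _ hc).2 h
    have h7 := (hlevel k (p - 1) _ hc').1 (by omega)
    omega
  refine ⟨t, ⟨?_, fun k => ?_, hsucc, hstrip, fun k => ?_, ?_⟩, hlevel⟩
  · funext p
    refine le_antisymm ?_ (ht1 0 p)
    by_contra! h1
    have := (hlevel 0 p _ (hmem h1 (ht2 0 p))).2 le_rfl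
    omega
  · refine IsConf.of_succ_lt (fun p => ?_) (hper k)
    have h1 := hsucc k (p + 1)
    have h2 := hstrip k (p + 1)
    rw [add_sub_cancel_right] at h2
    omega
  · rw [← he]
    exact hlevel.charge_eq hm hmn hx hper (hsucc k) fun k => ⟨ht1 k, ht2 k⟩
  · classical
    -- The entries are bounded by those in the last boxes of the rows `1, …, m`.
    set M : ℕ → ℕ := fun q => if hc : cell m n (q + 1) (x.conf (q + 1)) ∈ x.diagram then
      T ⟨_, hc⟩ + 1 else 0 with hM
    refine ⟨(Finset.range m).sup M, fun k hk => ?_⟩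
    refine le_antisymm (ht2 k) (le_of_periodic hm hxc.periodic (hper k) 1 fun p hp hp' => ?_)
    obtain ⟨q, rfl⟩ : ∃ q : ℕ, p = q + 1 := ⟨(p - 1).toNat, by omega⟩
    rcases (hgx (q + 1)).eq_or_lt with h1 | h1
    · rw [← h1]; exact ht1 k _
    · have hc := hmem h1 le_rfl
      have h2 : M q ≤ (Finset.range m).sup M := Finset.le_sup (Finset.mem_range.2 (by omega))
      simp only [hM, dif_pos hc] at h2
      exact (hlevel k _ _ hc).1 (by simp only [hM] at hk; omega)

theorem numTableaux_eq (hm : 0 < m) (hmn : m < n) (hx : x ∈ straightShapes m n) (e : ℕ →₀ ℕ) :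
    x.numTableaux e = Nat.card {t // IsFlag m n e x.conf t} := by
  have hb {t} (ht : IsFlag m n e x.conf t) (k : ℕ) : ground m n ≤ t k ∧ t k ≤ x.conf :=
    ⟨ht.ground_le k, ht.le_top k⟩
  have hT (t : {t // IsFlag m n e x.conf t}) : x.IsSemistandard (levelFilling x t.1) ∧
      ∀ k, Nat.card {c // levelFilling x t.1 c = k} = e k := by
    have h := t.2.isLevel_levelFilling hm hmn hx
    refine ⟨h.isSemistandard t.2.strip, fun k => ?_⟩
    have h1 := h.charge_eq (k := k) hm hmn hx (fun l => (t.2.conf l).periodic) (t.2.le_succ k)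
      (hb t.2)
    have h2 := t.2.weight k
    omega
  refine (Nat.card_congr (Equiv.ofBijective (fun t => ⟨levelFilling x t.1, hT t⟩) ⟨?_, ?_⟩)).symm
  · intro t t' h
    have h1 := t.2.isLevel_levelFilling hm hmn hx
    have h2 := t'.2.isLevel_levelFilling hm hmn hx
    rw [← show levelFilling x t.1 = levelFilling x t'.1 from Subtype.ext_iff.1 h] at h2
    exact Subtype.ext (h1.flag_unique hm hmn hx h2 (hb t.2) (hb t'.2))
  · rintro ⟨T, hT, hTe⟩
    obtain ⟨t, ht, hl⟩ := exists_isFlag hm hmn hx hT hTe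
    exact ⟨⟨t, ht⟩, Subtype.ext ((ht.isLevel_levelFilling hm hmn hx).filling_unique hl)⟩

end tableaux

/-! ### The weak order and the bijection -/

section weakOrder

variable {m n : ℕ} [Fact (1 < n)] {v w : AffSym n}

theorem WeakLE.act_le (hm : 0 < m) (hmn : m < n) (hv : IsRaising m v) (h : WeakLE w v) :
    act w (ground m n) ≤ act v (ground m n) := by
  suffices IsRaising m w ∧ act w (ground m n) ≤ act v (ground m n) from this.2
  induction h using Relation.ReflTransGen.head_induction_on with
  | refl => exact ⟨hv, le_rfl⟩
  | head hc _ ih =>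
    obtain ⟨i, rfl, hl⟩ := hc
    have hl' := hl.symm
    rw [add_comm, ← (affSys n).length_simple i] at hl'
    refine ⟨ih.1.of_mul hm hmn hl', le_trans (fun p => ?_) ih.2⟩
    refine (ih.1.strip_of_mul hm hmn (J := {i}) ⟨[i], ?_, by simp, by simp⟩ hl' p).1
    rw [isCycDecWord_cons]
    exact ⟨⟨List.nodup_nil, by simp⟩, by simp, by simp⟩

theorem weakLE_of_allowed (hm : 0 < m) (hmn : m < n) (hw : IsRaising m w) {ω : List (ZMod n)}
    (hω : Allowed ω (act w (ground m n))) : WeakLE w ((affSys n).wordProd ω * w) := by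
  have hR {α : List (ZMod n)} (hα : Allowed α (act w (ground m n))) :
      IsRaising m ((affSys n).wordProd α * w) ∧
        (affSys n).length ((affSys n).wordProd α * w) = (affSys n).length w + α.length := by
    have h0 := hw.charge_eq hm hmn
    have h1 := hα.charge_eq hm (hw.isConf hm hmn).isPeriodicInj
    obtain ⟨β, hβ, rfl⟩ := hw
    have h2 : IsRaising m ((affSys n).wordProd α * (affSys n).wordProd β) :=
      ⟨α ++ β, allowed_append.2 ⟨hβ, hα⟩, CoxeterSystem.wordProd_append _ _ _⟩
    have h3 := h2.charge_eq hm hmn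
    rw [act_mul] at h3
    exact ⟨h2, by omega⟩
  induction ω with
  | nil => rw [CoxeterSystem.wordProd_nil, one_mul]; exact Relation.ReflTransGen.refl
  | cons i ω ih =>
    refine (ih hω.1).tail ⟨i, ?_, ?_⟩
    · rw [CoxeterSystem.wordProd_cons, mul_assoc]
    · rw [(hR hω.1).2, (hR hω).2, List.length_cons]
      omega

theorem weakLE_iff (hm : 0 < m) (hmn : m < n) (hw : IsRaising m w) (hv : IsRaising m v) :
    WeakLE w v ↔ act w (ground m n) ≤ act v (ground m n) := by
  refine ⟨WeakLE.act_le hm hmn hv, fun h => ?_⟩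
  obtain ⟨ω, hω, hωv⟩ := exists_allowed hm hmn (hw.isConf hm hmn) (hv.isConf hm hmn) h
  have h1 := weakLE_of_allowed hm hmn hw hω
  obtain ⟨β, hβ, rfl⟩ := hw
  have h2 : (affSys n).wordProd ω * (affSys n).wordProd β = v := by
    refine IsRaising.eq_of_act_eq hm hmn ⟨ω ++ β, allowed_append.2 ⟨hβ, hω⟩,
      CoxeterSystem.wordProd_append _ _ _⟩ hv ?_
    rw [act_mul, hωv]
  rwa [h2] at h1

end weakOrder

theorem theorem4p10 (m n : ℕ) (hm : 0 < m) (hmn : m < n) :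
    ∃ φ : grassSet m n ≃ straightShapes m n,
      (∀ (w : grassSet m n) (ω : List (ZMod n)), (affSys n).IsReduced ω →
        (affSys n).wordProd ω = (w : AffSym n) →
          CylShape.actWord ω (CylShape.empty m n) = some (φ w : CylShape m n)) ∧
      (∀ w v : grassSet m n, WeakLE (w : AffSym n) (v : AffSym n) ↔
        (φ w : CylShape m n).diagram ⊆ (φ v : CylShape m n).diagram) ∧
      (∀ w : grassSet m n, affineStanley (w : AffSym n) = (φ w : CylShape m n).schur) := by
  have : Fact (1 < n) := ⟨by omega⟩
  have hraise (w : grassSet m n) : IsRaising m (w : AffSym n) := (mem_grassSet_iff hm hmn).1 w.2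
  choose f hf hfc using fun w : grassSet m n =>
    exists_straightShape hm hmn ((hraise w).isConf hm hmn) (hraise w).ground_le
  have hbij : Function.Bijective fun w : grassSet m n => (⟨f w, hf w⟩ : straightShapes m n) := by
    constructor
    · intro w v h
      have h1 : f w = f v := Subtype.ext_iff.1 h
      refine Subtype.ext ((hraise w).eq_of_act_eq hm hmn (hraise v) ?_)
      rw [← hfc, ← hfc, h1]
    · rintro ⟨x, hx⟩
      obtain ⟨w, hw, hwx⟩ := exists_isRaising hm hmn (x.isConf hm hmn) (ground_le_conf hx)
      refine ⟨⟨w, (mem_grassSet_iff hm hmn).2 hw⟩, Subtype.ext ?_⟩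
      exact eq_of_conf_eq hm hmn (hf _) hx ((hfc _).trans hwx)
  refine ⟨Equiv.ofBijective _ hbij, fun w ω hr hω => ?_, fun w v => ?_, fun w => ?_⟩
  · obtain ⟨y, hy, h1, h2⟩ := actWord_eq_some hm hmn (IsRaising.allowed hm hmn (hω ▸ hraise w) hr)
    rw [h1]
    refine congrArg some (eq_of_conf_eq hm hmn hy (hf w) ?_)
    rw [h2, hω]
    exact (hfc w).symm
  · rw [weakLE_iff hm hmn (hraise w) (hraise v), ← hfc, ← hfc]
    exact (diagram_subset_iff hm hmn (hf w) (hf v)).symm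
  · funext e
    change (numCycDecDecomp (w : AffSym n) e : ℤ) = ((f w).numTableaux e : ℤ)
    rw [numCycDecDecomp_eq hm hmn (hraise w), numTableaux_eq hm hmn (hf w), hfc]
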